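/- A *continuum* is a nonempty compact connected metrizable space; an *arc* is a space homeomorphic to $[0,1]$; for $m\ge 1$ a *simple-$m$-od* is a Hausdorff space that is the union of $m$ arcs, all having a common end point $p$, any two of which meet only in $p$. A continuum is *simple-$m$-od-like* if it is homeomorphic to the inverse limit of a sequence of simple-$m$-ods with continuous surjective bonding maps. Let $n\ge 3$. Let $X_0$ be the graph with vertices $v_0,\dots,v_{n+2}$ that is the union of the $n$ arms $\langle v_0,v_i\rangle$ ($1\le i\le n-2$), $\langle v_0,v_{n-1},v_{n+1}\rangle$ and $\langle v_0,v_n,v_{n+2}\rangle$. Let $X_1$ be the subdivision of $X_0$ in which arm $i$ ($1\le i\le n-3$) is subdivided into $2n$ edges, arm $n-2$ into $2$ edges, the edges $v_0v_{n-1}$ and $v_{n-1}v_{n+1}$ of arm $n-1$ into $3$ edges and $1$ edge, and the edges $v_0v_n$ and $v_nv_{n+2}$ of arm $n$ into $2n-1$ edges and $1$ edge, respectively. Let ${}_n\phi:X_1\to X_0$ be the map that is linear on each edge of $X_1$ and sends the successive vertices of the arms of $X_1$, starting from the centre $v_0$, to the vertices of $X_0$ with the following indices: - arm $i$, $1\le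 i\le n-3$: $\;0,\,n-1,\,0,\,c_1,\,0,\,c_2,\,0,\,\dots,\,0,\,c_{n-2},\,0,\,n,\,n+2$, where $c_s\in\{1,\dots,n-2\}$ and $c_s\equiv i+s-1 \pmod{n-2}$; - arm $n-2$: $\;0,\,n-1,\,n+1$; - arm $n-1$: $\;0,\,n-1,\,0,\,n,\,n+2$; - arm $n$: $\;0,\,n-1,\,0,\,n-2,\,0,\,1,\,0,\,2,\,0,\,\dots,\,0,\,n-3,\,0,\,n,\,n+2$. Realize $X_0$ and $X_1$ on one simple-$n$-od $T$, so that ${}_n\phi$ becomes a self-map of $T$, and let ${}_nK=\varprojlim(T\xleftarrow{{}_n\phi}T\xleftarrow{{}_n\phi}\cdots)$. Then $T$ is a simple-$n$-od, and ${}_n\phi$ is a continuous surjection which maps every edge of $X_1$ linearly onto an edge of $X_0$ (a light simplicial map); ${}_nK$ is a continuum which is simple-$n$-od-like and not simple-$(n-1)$-od-like, and every proper nondegenerate subcontinuum of ${}_nK$ is an arc. -/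

import Mathlib

namespace NOd

/-- A continuum: a (nonempty) compact connected metrizable space. -/
def IsContinuum (X : Type*) [TopologicalSpace X] : Prop :=
  CompactSpace X ∧ ConnectedSpace X ∧ TopologicalSpace.MetrizableSpace X

/-- A subset of a space is an arc if it is homeomorphic to `[0,1]`. -/
def IsArc {X : Type*} [TopologicalSpace X] (W : Set X) : Prop :=
  Nonempty (W ≃ₜ unitInterval)

/-- A simple-`n`-od: the union of `n` arcs joined at a common end point `p`
(any two of the arcs meet only in `p`). -/
def IsSimpleOd (n : ℕ) (Y : Type*) [TopologicalSpace Y] : Prop :=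
  T2Space Y ∧ ∃ (p : Y) (γ : Fin n → unitInterval → Y),
    (∀ i, Topology.IsEmbedding (γ i) ∧ γ i 0 = p) ∧
    (∀ i j, i ≠ j → Set.range (γ i) ∩ Set.range (γ j) = {p}) ∧
    (⋃ i, Set.range (γ i)) = Set.univ

/-- The inverse limit of the sequence `X 0 ← X 1 ← X 2 ← ⋯`, a subspace of the product. -/
def inverseLimit (X : ℕ → Type*) (f : ∀ i, X (i + 1) → X i) : Set (∀ i, X i) :=
  {x | ∀ i, f i (x (i + 1)) = x i}

/-- A space is simple-`n`-od-like if it is homeomorphic to an inverse limit of simple-`n`-ods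
with continuous surjective bonding maps. -/
def IsSimpleOdLike (n : ℕ) (X : Type*) [TopologicalSpace X] : Prop :=
  ∃ (Y : ℕ → Type) (_ : ∀ i, TopologicalSpace (Y i)) (f : ∀ i, Y (i + 1) → Y i),
    (∀ i, IsSimpleOd n (Y i)) ∧ (∀ i, Continuous (f i) ∧ Function.Surjective (f i)) ∧
    Nonempty (X ≃ₜ inverseLimit Y f)

/-!
The simple-`n`-od is realized in `Fin n → ℝ` on the coordinate half-axes. The arms are numbered
`1, …, n`, arm `a` lying on the axis of index `a - 1`. It carries two graph structures:

* the graph `X₀` with vertices `v_0, …, v_{n+2}` and edges `v_0 v_i` for `1 ≤ i ≤ n`,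
  `v_{n-1} v_{n+1}` and `v_n v_{n+2}`; arm `i` ends at `v_i` for `i ≤ n - 2`, while arms `n - 1`
  and `n` end at `v_{n+1}` and `v_{n+2}`;
* the subdivision `X₁` of `X₀` whose vertices are the points with integer coordinates, so that
  the length of an arm is the number of edges of `X₁` that it consists of.
-/

/-- Number of edges of `X₁` on arm `a`. -/
def armLen (n a : ℕ) : ℕ :=
  if a = n - 2 then 2 else if a = n - 1 then 4 else 2 * n

/-- The point at distance `t` from the centre on arm `i + 1`. -/
def armPoint (n : ℕ) (i : Fin n) (t : ℝ) : Fin n → ℝ := Pi.single i t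

/-- The simple-`n`-od with the prescribed arm lengths. -/
def Od (n : ℕ) : Set (Fin n → ℝ) :=
  {x | ∃ (i : Fin n) (t : ℝ), 0 ≤ t ∧ t ≤ armLen n (i + 1) ∧ x = armPoint n i t}

/-- The arm of `X₀` on which the vertex `v_a`, `a ≠ 0`, lies. -/
def vertexArm (n a : ℕ) : ℕ := if a ≤ n then a else a - 2

/-- The distance of the vertex `v_a` of `X₀` from the centre. -/
def vertexDist (n a : ℕ) : ℕ :=
  if a = 0 then 0
  else if a = n - 1 then 3
  else if a = n then 2 * n - 1
  else armLen n (vertexArm n a)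

/-- The vertex `v_a` of `X₀`, for `0 ≤ a ≤ n + 2`. -/
def vertex (n a : ℕ) : Fin n → ℝ :=
  fun i => if (i : ℕ) + 1 = vertexArm n a then (vertexDist n a : ℝ) else 0

/-- `v_a` and `v_b` are adjacent in `X₀`. -/
def Adj₀ (n a b : ℕ) : Prop :=
  ((a = 0 ∧ 1 ≤ b ∧ b ≤ n) ∨ (a = n - 1 ∧ b = n + 1) ∨ (a = n ∧ b = n + 2)) ∨
  ((b = 0 ∧ 1 ≤ a ∧ a ≤ n) ∨ (b = n - 1 ∧ a = n + 1) ∨ (b = n ∧ a = n + 2))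

/-- The map on vertices: the `k`-th vertex of `X₁` on arm `a` (counted from the centre, which is
the `0`-th one) is sent to the vertex `v_b` of `X₀` with `b = phiVertex n a k`. The successive
values on the arms are

* arm `a`, `1 ≤ a ≤ n - 3`: `0, n-1, 0, c_1, 0, c_2, 0, …, 0, c_{n-2}, 0, n, n+2`, where
  `c_s ∈ {1, …, n-2}` and `c_s ≡ a + s - 1` modulo `n - 2`;
* arm `n - 2`: `0, n-1, n+1`;
* arm `n - 1`: `0, n-1, 0, n, n+2`;
* arm `n`: `0, n-1, 0, n-2, 0, 1, 0, 2, 0, …, 0, n-3, 0, n, n+2`. -/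
def phiVertex (n a k : ℕ) : ℕ :=
  if a = n - 2 then
    (if k = 0 then 0 else if k = 1 then n - 1 else n + 1)
  else if a = n - 1 then
    (if k = 0 then 0 else if k = 1 then n - 1 else if k = 2 then 0 else if k = 3 then n else n + 2)
  else
    (if k = 1 then n - 1
     else if k = 2 * n - 1 then n
     else if k = 2 * n then n + 2
     else if k % 2 = 0 then 0
     else if a = n then (if k = 3 then n - 2 else (k - 3) / 2)
     else (a + (k - 1) / 2 - 2) % (n - 2) + 1)

/-- The restriction of the bonding map to arm `a`, as a function of the distance `t ≥ 0` from the
centre: linear interpolation of `k ↦ vertex n (phiVertex n a k)`. -/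
noncomputable def phiArm (n a : ℕ) (t : ℝ) : Fin n → ℝ :=
  AffineMap.lineMap (vertex n (phiVertex n a ⌊t⌋₊)) (vertex n (phiVertex n a (⌊t⌋₊ + 1)))
    (t - ⌊t⌋₊)

/-- The bonding map, for points of `Od n` (at most one coordinate of which is nonzero). -/
noncomputable def phi (n : ℕ) (x : Fin n → ℝ) : Fin n → ℝ :=
  ∑ i : Fin n, phiArm n (i + 1) (x i)

/-- The (oriented) edges of `X₀`, as pairs of end points. -/
def edges₀ (n : ℕ) : Set ((Fin n → ℝ) × (Fin n → ℝ)) :=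
  {e | ∃ a b : ℕ, Adj₀ n a b ∧ e = (vertex n a, vertex n b)}

/-- The edges of `X₁`, as pairs of end points, oriented away from the centre. -/
def edges₁ (n : ℕ) : Set ((Fin n → ℝ) × (Fin n → ℝ)) :=
  {e | ∃ (i : Fin n) (k : ℕ), k < armLen n (i + 1) ∧
    e = (armPoint n i k, armPoint n i (k + 1))}

/-- `f` maps every edge in `E₁` linearly onto an edge in `E₀`; that is, `f` is a light simplicial
map between the corresponding graphs. -/
def IsLightSimplicial {V W : Type*} [AddCommGroup V] [Module ℝ V] [AddCommGroup W] [Module ℝ W]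
    (E₁ : Set (V × V)) (E₀ : Set (W × W)) (f : V → W) : Prop :=
  ∀ e ∈ E₁, ∃ e' ∈ E₀, ∀ s : ℝ, 0 ≤ s → s ≤ 1 →
    f (AffineMap.lineMap e.1 e.2 s) = AffineMap.lineMap e'.1 e'.2 s

/-! Helper facts: the bonding map sends `Od n` to itself. -/

theorem phiVertex_even (n : ℕ) (a k : ℕ) (h1 : a ≠ n - 2) (h2 : a ≠ n - 1)
    (hk : k % 2 = 0) (hkn : k < 2 * n) : phiVertex n a k = 0 := by
  unfold phiVertex
  rw [if_neg h1, if_neg h2, if_neg (by omega), if_neg (by omega), if_neg (by omega), if_pos hk]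

theorem phiVertex_odd (n : ℕ) (hn : 3 ≤ n) (a k : ℕ) (h1 : a ≠ n - 2) (h2 : a ≠ n - 1)
    (hk : k % 2 = 1) (hkn : k < 2 * n) : 1 ≤ phiVertex n a k ∧ phiVertex n a k ≤ n := by
  have hmod : (a + (k - 1) / 2 - 2) % (n - 2) < n - 2 := Nat.mod_lt _ (by omega)
  unfold phiVertex
  rw [if_neg h1, if_neg h2]
  generalize (a + (k - 1) / 2 - 2) % (n - 2) = r at *
  by_cases k1 : k = 1
  · rw [if_pos k1]; omega
  rw [if_neg k1]
  by_cases k2 : k = 2 * n - 1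
  · rw [if_pos k2]; omega
  rw [if_neg k2, if_neg (by omega), if_neg (by omega)]
  split_ifs <;> omega

theorem adj_phiVertex (n : ℕ) (hn : 3 ≤ n) (a k : ℕ)
    (hk : k < armLen n a) : Adj₀ n (phiVertex n a k) (phiVertex n a (k + 1)) := by
  unfold armLen at hk
  by_cases h1 : a = n - 2
  · rw [if_pos h1] at hk
    unfold phiVertex Adj₀
    interval_cases k <;> simp [h1]; omega
  by_cases h2 : a = n - 1
  · rw [if_neg h1, if_pos h2] at hk
    unfold phiVertex Adj₀
    rw [if_neg h1, if_neg h1, if_pos h2, if_pos h2]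
    interval_cases k <;> simp <;> omega
  rw [if_neg h1, if_neg h2] at hk
  rcases Nat.mod_two_eq_zero_or_one k with h | h
  · have e := phiVertex_even n a k h1 h2 h hk
    have o := phiVertex_odd n hn a (k + 1) h1 h2 (by omega) (by omega)
    exact Or.inl (Or.inl ⟨e, o⟩)
  · by_cases hl : k + 1 = 2 * n
    · refine Or.inl (Or.inr (Or.inr ?_))
      unfold phiVertex
      rw [if_neg h1, if_neg h2, if_neg h1, if_neg h2, if_neg (by omega), if_pos (by omega),
        if_neg (by omega), if_neg (by omega), if_pos hl]
      exact ⟨rfl, rfl⟩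
    · have o := phiVertex_odd n hn a k h1 h2 h hk
      have e := phiVertex_even n a (k + 1) h1 h2 (by omega) (by omega)
      exact Or.inr (Or.inl ⟨e, o⟩)

theorem phiVertex_zero (n : ℕ) (hn : 3 ≤ n) (a : ℕ) : phiVertex n a 0 = 0 := by
  by_cases h1 : a = n - 2
  · simp [phiVertex, h1]
  by_cases h2 : a = n - 1
  · simp only [phiVertex, if_neg h1, if_pos h2, if_true]
  exact phiVertex_even n a 0 h1 h2 rfl (by omega)

theorem vertex_zero (n : ℕ) : vertex n 0 = 0 := by
  funext i
  simp [vertex, vertexArm]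

theorem phiArm_zero (n : ℕ) (hn : 3 ≤ n) (a : ℕ) : phiArm n a 0 = 0 := by
  simp [phiArm, phiVertex_zero n hn, vertex_zero]

theorem phi_armPoint (n : ℕ) (hn : 3 ≤ n) (i : Fin n) (t : ℝ) :
    phi n (armPoint n i t) = phiArm n (i + 1) t := by
  unfold phi armPoint
  rw [Finset.sum_eq_single i]
  · simp
  · intro j _ hj
    rw [Pi.single_eq_of_ne hj, phiArm_zero n hn]
  · simp

theorem vertex_eq_armPoint (n a : ℕ) (i : Fin n) (h : a = 0 ∨ vertexArm n a = i + 1) :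
    vertex n a = armPoint n i (vertexDist n a) := by
  rcases h with rfl | h
  · simp [vertex_zero, vertexDist, armPoint]
  · funext j
    simp only [vertex, armPoint, h, Pi.single_apply, Fin.ext_iff, Nat.add_right_cancel_iff]

theorem vertexDist_le (n : ℕ) (hn : 3 ≤ n) (a : ℕ) :
    vertexDist n a ≤ armLen n (vertexArm n a) := by
  unfold vertexDist armLen vertexArm
  split_ifs <;> omega

theorem exists_arm_of_adj (n : ℕ) (hn : 3 ≤ n) (a b : ℕ) (h : Adj₀ n a b) :
    ∃ i : Fin n, (a = 0 ∨ vertexArm n a = i + 1) ∧ (b = 0 ∨ vertexArm n b = i + 1) := by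
  have key : ∃ c, 1 ≤ c ∧ c ≤ n ∧ (a = 0 ∨ vertexArm n a = c) ∧ (b = 0 ∨ vertexArm n b = c) := by
    unfold Adj₀ at h
    unfold vertexArm
    rcases h with (h | h | h) | (h | h | h)
    · exact ⟨b, by split_ifs <;> omega⟩
    · exact ⟨n - 1, by split_ifs <;> omega⟩
    · exact ⟨n, by split_ifs <;> omega⟩
    · exact ⟨a, by split_ifs <;> omega⟩
    · exact ⟨n - 1, by split_ifs <;> omega⟩
    · exact ⟨n, by split_ifs <;> omega⟩
  obtain ⟨c, hc1, hcn, h1, h2⟩ := key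
  refine ⟨⟨c - 1, by omega⟩, ?_⟩
  have : c - 1 + 1 = c := by omega
  simpa [this] using ⟨h1, h2⟩

theorem dist_le_of_arm (n : ℕ) (hn : 3 ≤ n) (a : ℕ) (i : Fin n)
    (h : a = 0 ∨ vertexArm n a = i + 1) : (vertexDist n a : ℝ) ≤ armLen n (i + 1) := by
  rcases h with rfl | h
  · simp [vertexDist]
  · rw [← h]
    exact_mod_cast vertexDist_le n hn a

theorem lineMap_mem_Od (n : ℕ) (hn : 3 ≤ n) (a b : ℕ) (h : Adj₀ n a b) (s : ℝ) (h0 : 0 ≤ s)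
    (h1 : s ≤ 1) : AffineMap.lineMap (vertex n a) (vertex n b) s ∈ Od n := by
  obtain ⟨i, ha, hb⟩ := exists_arm_of_adj n hn a b h
  refine ⟨i, (1 - s) * vertexDist n a + s * vertexDist n b, ?_, ?_, ?_⟩
  · have := sub_nonneg.2 h1
    positivity
  · have h3 := dist_le_of_arm n hn a i ha
    have h4 := dist_le_of_arm n hn b i hb
    nlinarith [sub_nonneg.2 h1]
  · rw [vertex_eq_armPoint n a i ha, vertex_eq_armPoint n b i hb, AffineMap.lineMap_apply_module]
    funext j
    by_cases hj : j = i
    · subst hj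
      simp [armPoint]
    · simp [armPoint, Pi.single_eq_of_ne hj]

theorem phiArm_mem_Od (n : ℕ) (hn : 3 ≤ n) (i : Fin n) (t : ℝ) (h0 : 0 ≤ t)
    (h1 : t ≤ armLen n (i + 1)) : phiArm n (i + 1) t ∈ Od n := by
  have hfl := Nat.floor_le h0
  have hlt := Nat.lt_floor_add_one t
  have hle : ⌊t⌋₊ ≤ armLen n (i + 1) := by exact_mod_cast hfl.trans h1
  rcases hle.lt_or_eq with hk | hk
  · exact lineMap_mem_Od n hn _ _
      (adj_phiVertex n hn _ _ hk) _ (by linarith) (by linarith)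
  · have hpos : 0 < armLen n (i + 1) := by
      unfold armLen
      split_ifs <;> omega
    have ht : t - (⌊t⌋₊ : ℝ) = 0 := by
      rw [hk] at hfl ⊢
      linarith
    have hadj := adj_phiVertex n hn (i + 1) (armLen n (i + 1) - 1) (by omega)
    have := lineMap_mem_Od n hn _ _ hadj 1 zero_le_one le_rfl
    rw [AffineMap.lineMap_apply_one, Nat.sub_add_cancel hpos, ← hk] at this
    unfold phiArm
    rw [ht, AffineMap.lineMap_apply_zero]
    exact this

theorem phi_mem_Od (n : ℕ) (hn : 3 ≤ n) (x : Fin n → ℝ) (hx : x ∈ Od n) : phi n x ∈ Od n := by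
  obtain ⟨i, t, h0, h1, rfl⟩ := hx
  rw [phi_armPoint n hn]
  exact phiArm_mem_Od n hn i t h0 h1

/-- The bonding map as a self-map of the simple-`n`-od. -/
noncomputable def bonding (n : ℕ) (hn : 3 ≤ n) (x : Od n) : Od n :=
  ⟨phi n x, phi_mem_Od n hn x x.2⟩

/-- The inverse limit of copies of the simple-`n`-od with the single bonding map `bonding n hn`.

(If the `j`-th copy is given the vertices `phi^{-j} (V(X₀))`, then the first copy is `X₁`, and each
bonding map is simplicial; so this is also the inverse limit of graphs and simplicial maps obtained
from the constant sequence `phi, phi, …` by successive subdivision.) -/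
noncomputable def K (n : ℕ) (hn : 3 ≤ n) : Set (ℕ → Od n) :=
  inverseLimit (fun _ => Od n) (fun _ => bonding n hn)

end NOd

/-! The hard part is that the limit is not simple-$(n-1)$-od-like. If it were, the projection of `K`
to its first factor would factor, up to a small error, through a simple-$(n-1)$-od. Discretizing
that od (`exists_factors`) yields an $N$ for which the $N$-th iterate of `phi`, on the vertices of
the $N$-th subdivision, is constant on the fibres of a simplicial map to a combinatorial od with
$n-1$ arms; this is `Factors n N`. `Factors.of_succ` lowers $N$ by one, and `Factors n 0` is absurd:
the $n$ neighbours of $v_0$ need different images next to one vertex, which has at most $n-1$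
neighbours.

The descent is the point where the special form of the map enters. Let $f$ be the simplicial map to
the small od and let $G$ be the $j$-th iterate, with values in the vertices of $X_1$. Only
$\varphi\circ G$ is known to be constant on the fibres of $f$; wanted is a modified $f$ on whose
fibres $G$ itself is constant, up to collapsing (`col`) the central component of
$\varphi^{-1}[v_0,v_{n-1}]$. On the long arms the labels $1,\dots,n-2$ occur in all cyclic orders,
between a first label $n-1$ and a last label $n$. Hence a label together with the class of a
neighbour determines the class (`col_eq_of_adj`), and vertices labelled $0$ over a point off the
centre have one class (`col_eq_of_zero`). If the centre of the small od has nonzero label, the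
factorization therefore lifts uniquely (`col_eq_of_root_ne`). If its label is $0$, the $n-1$ arms
miss one of the $n$ possible first labels. Cutting $X_1$ at that label separates the vertices
labelled $n$ (`col_eq_first`), so all ambiguity lies within distance one of the centre, and the part
of the od around the centre can be rebuilt with the same number of arms (`conclusion_of_root_eq`).
Contracting the new od where the induced vertex of $X_0$ does not change gives the factorization one
level lower.

For subcontinua, consider the sequence of projections. If they contain the centre and, infinitely
often, an edge of $X_0$ at the centre, then five steps of the map spread that edge over the whole
od, and the subcontinuum is everything. Otherwise the bonding map is eventually injective on the
projections, each of them inside one arm, so that one coordinate embeds the subcontinuum in the line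
(`ConnSeq.dichotomy`). -/

namespace NOd

/-! ### Labels of the vertices of $X_1$ -/

/-- Adjacency of points of a combinatorial od: `(e, s)` is the point at distance `s` from the
centre on arm `e`. -/
def OAdj (x y : ℕ × ℕ) : Prop :=
  (y.2 = x.2 + 1 ∧ (x.2 = 0 ∨ x.1 = y.1)) ∨ (x.2 = y.2 + 1 ∧ (y.2 = 0 ∨ x.1 = y.1))

theorem OAdj.symm {x y : ℕ × ℕ} (h : OAdj x y) : OAdj y x := by
  unfold OAdj at *
  rcases h with ⟨h1, h2⟩ | ⟨h1, h2⟩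
  · exact Or.inr ⟨h1, h2.imp id Eq.symm⟩
  · exact Or.inl ⟨h1, h2.imp id Eq.symm⟩

/-- The vertices of `X₁`, as points of a combinatorial od. -/
def IsPos (n : ℕ) (x : ℕ × ℕ) : Prop :=
  x.2 ≤ armLen n x.1 ∧ (x.2 ≠ 0 → 1 ≤ x.1 ∧ x.1 ≤ n)

/-- The index of the vertex of `X₀` to which a vertex of `X₁` is sent. -/
def lab (n : ℕ) (x : ℕ × ℕ) : ℕ := phiVertex n x.1 x.2

/-- The arms of `X₁` that consist of `2 * n` edges. -/
def Long (n a : ℕ) : Prop := 1 ≤ a ∧ a ≤ n ∧ a ≠ n - 2 ∧ a ≠ n - 1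

/-- The first of the labels `c_s` on a long arm. -/
def start (n a : ℕ) : ℕ := if a = n then n - 2 else a

/-- Collapse the component of `phi ⁻¹ [v_0, v_{n-1}]` around the centre to the centre. -/
def col (n : ℕ) (x : ℕ × ℕ) : ℕ × ℕ :=
  if x.2 ≤ 1 ∨ (x.2 = 2 ∧ x.1 ≠ n - 2) then (0, 0) else x

theorem start_bounds {n a : ℕ} (hn : 3 ≤ n) (h : Long n a) : 1 ≤ start n a ∧ start n a ≤ n - 2 := by
  unfold Long at h; unfold start; split_ifs <;> omega

theorem start_inj {n a b : ℕ} (hn : 3 ≤ n) (ha : Long n a) (hb : Long n b)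
    (h : start n a = start n b) : a = b := by
  unfold Long at ha hb; unfold start at h; split_ifs at h <;> omega

theorem lab_zero {n : ℕ} (hn : 3 ≤ n) (x : ℕ × ℕ) (h : x.2 = 0) : lab n x = 0 := by
  unfold lab; rw [h]; exact phiVertex_zero n hn _

theorem lab_one {n : ℕ} (x : ℕ × ℕ) (h : x.2 = 1) : lab n x = n - 1 := by
  unfold lab phiVertex; rw [h]; simp

/-- The labels $c_s$ run cyclically through $1,\dots,n-2$ from `start`. The sum wraps around at most
once, so the residue becomes a two-way case distinction that linear arithmetic can handle. With
`start n n = n - 2`, arm $n$ fits the same pattern. -/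
theorem lab_long_mid {n : ℕ} (hn : 3 ≤ n) (x : ℕ × ℕ) (hl : Long n x.1) (s : ℕ) (h1 : 1 ≤ s)
    (h2 : s ≤ n - 2) (hs : x.2 = 2 * s + 1) :
    lab n x = if start n x.1 + s < n then start n x.1 + s - 1 else start n x.1 + s + 1 - n := by
  have hb := start_bounds hn hl
  obtain ⟨a, k⟩ := x
  simp only at hs hb hl ⊢
  subst hs
  unfold Long at hl
  unfold lab phiVertex
  simp only
  rw [if_neg hl.2.2.1, if_neg hl.2.2.2, if_neg (by omega), if_neg (by omega), if_neg (by omega),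
    if_neg (by omega)]
  have key : ∀ r, 1 ≤ r → r ≤ n - 2 → (r + (2 * s + 1 - 1) / 2 - 2) % (n - 2) + 1
      = if r + s < n then r + s - 1 else r + s + 1 - n := by
    intro r hr1 hr2
    have : (2 * s + 1 - 1) / 2 = s := by omega
    rw [this]
    split_ifs with h
    · rw [Nat.mod_eq_of_lt (by omega)]; omega
    · rw [Nat.mod_eq_sub_mod (by omega), Nat.mod_eq_of_lt (by omega)]; omega
  unfold start at *
  by_cases han : a = n
  · simp only [if_pos han] at hb ⊢
    split_ifs <;> omega
  · simp only [if_neg han] at hb ⊢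
    exact key a hb.1 hb.2

theorem lab_long_even {n : ℕ} (x : ℕ × ℕ) (hl : Long n x.1) (h : x.2 % 2 = 0)
    (h2 : x.2 < 2 * n) : lab n x = 0 :=
  phiVertex_even n _ _ hl.2.2.1 hl.2.2.2 h h2

theorem lab_long_pre {n : ℕ} (hn : 3 ≤ n) (x : ℕ × ℕ) (hl : Long n x.1) (h : x.2 = 2 * n - 1) :
    lab n x = n := by
  unfold Long at hl
  unfold lab phiVertex
  rw [if_neg hl.2.2.1, if_neg hl.2.2.2, if_neg (by omega), if_pos h]

theorem lab_long_end {n : ℕ} (hn : 3 ≤ n) (x : ℕ × ℕ) (hl : Long n x.1) (h : x.2 = 2 * n) :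
    lab n x = n + 2 := by
  unfold Long at hl
  unfold lab phiVertex
  rw [if_neg hl.2.2.1, if_neg hl.2.2.2, if_neg (by omega), if_neg (by omega), if_pos h]

/-- A classification of the vertices of `X₁` together with their labels. -/
theorem pos_cases {n : ℕ} (hn : 3 ≤ n) (x : ℕ × ℕ) (hx : IsPos n x) :
    (x.2 = 0 ∧ lab n x = 0) ∨ (1 ≤ x.1 ∧ x.1 ≤ n ∧ x.2 = 1 ∧ lab n x = n - 1) ∨
    (x.1 = n - 2 ∧ x.2 = 2 ∧ lab n x = n + 1) ∨
    (x.1 = n - 1 ∧ x.2 = 2 ∧ lab n x = 0) ∨ (x.1 = n - 1 ∧ x.2 = 3 ∧ lab n x = n) ∨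
    (x.1 = n - 1 ∧ x.2 = 4 ∧ lab n x = n + 2) ∨
    (Long n x.1 ∧ ((2 ≤ x.2 ∧ x.2 ≤ 2 * n - 2 ∧ x.2 % 2 = 0 ∧ lab n x = 0) ∨
      (∃ s, 1 ≤ s ∧ s ≤ n - 2 ∧ x.2 = 2 * s + 1 ∧ lab n x =
        if start n x.1 + s < n then start n x.1 + s - 1 else start n x.1 + s + 1 - n) ∨
      (x.2 = 2 * n - 1 ∧ lab n x = n) ∨ (x.2 = 2 * n ∧ lab n x = n + 2))) := by
  obtain ⟨h1, h2⟩ := hx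
  by_cases h0 : x.2 = 0
  · exact Or.inl ⟨h0, lab_zero hn x h0⟩
  have h2 := h2 h0
  by_cases h01 : x.2 = 1
  · exact Or.inr (Or.inl ⟨h2.1, h2.2, h01, lab_one x h01⟩)
  refine Or.inr (Or.inr ?_)
  by_cases hz : x.1 = n - 2
  · left
    have hk : x.2 = 2 := by
      rw [armLen, if_pos hz] at h1; omega
    refine ⟨hz, hk, ?_⟩
    unfold lab phiVertex; rw [if_pos hz, hk]; simp
  right
  by_cases hb : x.1 = n - 1
  · rw [armLen, if_neg hz, if_pos hb] at h1
    have : x.2 = 2 ∨ x.2 = 3 ∨ x.2 = 4 := by omega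
    rcases this with h | h | h
    · left; refine ⟨hb, h, ?_⟩; unfold lab phiVertex; rw [if_neg hz, if_pos hb, h]; simp
    · right; left; refine ⟨hb, h, ?_⟩; unfold lab phiVertex; rw [if_neg hz, if_pos hb, h]; simp
    · right; right; left
      refine ⟨hb, h, ?_⟩; unfold lab phiVertex; rw [if_neg hz, if_pos hb, h]; simp
  rw [armLen, if_neg hz, if_neg hb] at h1
  have hl : Long n x.1 := ⟨h2.1, h2.2, hz, hb⟩
  refine Or.inr (Or.inr (Or.inr ⟨hl, ?_⟩))
  by_cases e1 : x.2 = 2 * n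
  · exact Or.inr (Or.inr (Or.inr ⟨e1, lab_long_end hn x hl e1⟩))
  by_cases e2 : x.2 = 2 * n - 1
  · exact Or.inr (Or.inr (Or.inl ⟨e2, lab_long_pre hn x hl e2⟩))
  by_cases e3 : x.2 % 2 = 0
  · exact Or.inl ⟨by omega, by omega, e3, lab_long_even x hl e3 (by omega)⟩
  · refine Or.inr (Or.inl ⟨x.2 / 2, by omega, by omega, by omega, ?_⟩)
    exact lab_long_mid hn x hl _ (by omega) (by omega) (by omega)

theorem OAdj.snd {x y : ℕ × ℕ} (h : OAdj x y) : y.2 = x.2 + 1 ∨ x.2 = y.2 + 1 :=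
  h.imp And.left And.left

theorem OAdj.fst {x y : ℕ × ℕ} (h : OAdj x y) (hx : x.2 ≠ 0) (hy : y.2 ≠ 0) : x.1 = y.1 := by
  rcases h with ⟨_, h | h⟩ | ⟨_, h | h⟩ <;> first | exact h | omega

/-- The label $n-1$ occurs only at distance $1$ from the centre. -/
theorem col_eq_of_lab_b {n : ℕ} (hn : 3 ≤ n) {x : ℕ × ℕ} (hx : IsPos n x) (h : lab n x = n - 1) :
    col n x = (0, 0) := by
  have : x.2 ≤ 1 := by
    rcases pos_cases hn x hx with h' | h' | h' | h' | h' | h' | ⟨hl, h' | ⟨s, h'⟩ | h' | h'⟩ <;> try omega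
    have := start_bounds hn hl
    obtain ⟨_, _, _, h4⟩ := h'
    split_ifs at h4 <;> omega
  unfold col; rw [if_pos (Or.inl this)]

theorem col_of_snd_ge {n : ℕ} {x : ℕ × ℕ} (h : 3 ≤ x.2) : col n x = x := by
  unfold col; rw [if_neg (by omega)]

theorem col_eq_zero_or {n : ℕ} (hn : 3 ≤ n) (x : ℕ × ℕ) :
    (col n x = (0, 0) ∧ x.2 ≤ 2) ∨ (col n x = x ∧ 2 ≤ x.2 ∧ (x.2 = 2 → x.1 = n - 2)) := by
  unfold col
  split_ifs with h
  · left; exact ⟨rfl, by omega⟩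
  · right; exact ⟨rfl, by omega, by omega⟩

theorem mid_label_bounds {n : ℕ} {st s r : ℕ} (h1 : 1 ≤ st) (h2 : st ≤ n - 2) (h3 : 1 ≤ s)
    (h4 : s ≤ n - 2) (h : r = if st + s < n then st + s - 1 else st + s + 1 - n) :
    1 ≤ r ∧ r ≤ n - 2 := by
  split_ifs at h <;> omega

theorem mid_label_inj {n : ℕ} {st s s' : ℕ} (h1 : 1 ≤ st) (h2 : st ≤ n - 2) (h3 : 1 ≤ s)
    (h4 : s ≤ n - 2) (h5 : 1 ≤ s') (h6 : s' ≤ n - 2)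
    (h : (if st + s < n then st + s - 1 else st + s + 1 - n) =
      if st + s' < n then st + s' - 1 else st + s' + 1 - n) : s = s' := by
  split_ifs at h <;> omega

/-- Together with `mid_label_inj` this says that arms and positions index a Latin square of labels.
-/
theorem mid_start_inj {n : ℕ} {st st' s : ℕ} (h1 : 1 ≤ st) (h2 : st ≤ n - 2) (h3 : 1 ≤ st')
    (h4 : st' ≤ n - 2) (h5 : 1 ≤ s)
    (h : (if st + s < n then st + s - 1 else st + s + 1 - n) =
      if st' + s < n then st' + s - 1 else st' + s + 1 - n) : st = st' := by
  split_ifs at h <;> omega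

/-- On one arm, a nonzero label determines the position, beyond the first edge. -/
theorem snd_eq_of_lab_eq {n : ℕ} (hn : 3 ≤ n) {x y : ℕ × ℕ} (hx : IsPos n x) (hy : IsPos n y)
    (h1 : x.1 = y.1) (h : lab n x = lab n y) (h0 : lab n x ≠ 0) : x.2 = y.2 := by
  rcases pos_cases hn x hx with h' | h' | h' | h' | h' | h' | ⟨hl, h' | ⟨s, h', hs, hs', h'''⟩ | h' | h'⟩ <;>
  rcases pos_cases hn y hy with k' | k' | k' | k' | k' | k' | ⟨kl, k' | ⟨t, k', ht, ht', k'''⟩ | k' | k'⟩ <;>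
  (first
  | omega
  | (have := kl.2.2; omega)
  | (have := hl.2.2; omega)
  | (have hb := start_bounds hn kl
     have := mid_label_bounds hb.1 hb.2 k' ht k'''; omega)
  | (have hb := start_bounds hn hl
     have := mid_label_bounds hb.1 hb.2 h' hs h'''; omega)
  | (have hb := start_bounds hn hl
     rw [h''', k''', ← h1] at h
     have := mid_label_inj hb.1 hb.2 h' hs k' ht h; omega))

/-- The class of a vertex of `X₁` with nonzero label is determined by the label and the class of a
neighbour. -/
theorem col_eq_of_adj {n : ℕ} (hn : 3 ≤ n) {x₁ x₂ x₃ x₄ : ℕ × ℕ} (h1 : IsPos n x₁) (h3 : IsPos n x₃) (a12 : OAdj x₁ x₂) (a34 : OAdj x₃ x₄)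
    (hc : col n x₂ = col n x₄) (hl : lab n x₁ = lab n x₃) (h0 : lab n x₁ ≠ 0) :
    col n x₁ = col n x₃ := by
  by_cases hb : lab n x₁ = n - 1
  · rw [col_eq_of_lab_b hn h1 hb, col_eq_of_lab_b hn h3 (hl ▸ hb)]
  have hs1 : x₁.2 ≠ 0 := fun h => h0 (lab_zero hn _ h)
  have hs1' : x₁.2 ≠ 1 := fun h => hb (lab_one _ h)
  have hs3 : x₃.2 ≠ 0 := fun h => h0 (hl ▸ lab_zero hn _ h)
  have hs3' : x₃.2 ≠ 1 := fun h => hb (hl ▸ lab_one _ h)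
  have e12 := a12.fst hs1 (by have := a12.snd; omega)
  have e34 := a34.fst hs3 (by have := a34.snd; omega)
  have key : x₁.1 = x₃.1 → col n x₁ = col n x₃ := by
    intro h
    have : x₁ = x₃ := Prod.ext h (snd_eq_of_lab_eq hn h1 h3 h hl h0)
    rw [this]
  rcases col_eq_zero_or hn x₂ with ⟨c2, d2⟩ | ⟨c2, d2, d2'⟩ <;>
  rcases col_eq_zero_or hn x₄ with ⟨c4, d4⟩ | ⟨c4, d4, d4'⟩
  -- Both neighbours are collapsed, so both vertices are the first ones outside the central
  -- component. The labels there are $n+1$ on arm $n-2$, $n$ on arm $n-1$ and `start` on the long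
  -- arms: pairwise different, so they determine the arm.
  · apply key
    have s12 := a12.snd
    have s34 := a34.snd
    rcases pos_cases hn x₁ h1 with h' | h' | h' | h' | h' | h' | ⟨kl, h' | ⟨s, h', hs, hs', h'''⟩ | h' | h'⟩ <;>
    rcases pos_cases hn x₃ h3 with k' | k' | k' | k' | k' | k' | ⟨kl', k' | ⟨t, k', ht, ht', k'''⟩ | k' | k'⟩ <;>
    (first
    | omega
    | (have hb := start_bounds hn kl'
       have := mid_label_bounds hb.1 hb.2 k' ht k'''; omega)
    | (have hb := start_bounds hn kl
       have := mid_label_bounds hb.1 hb.2 h' hs h'''; omega)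
    | (have hb := start_bounds hn kl
       have hb' := start_bounds hn kl'
       have e1 : s = 1 := by omega
       have e2 : t = 1 := by omega
       subst e1 e2
       rw [h''', k'''] at hl
       exact start_inj hn kl kl' (mid_start_inj hb.1 hb.2 hb'.1 hb'.2 le_rfl hl)))
  · rw [c2, c4] at hc; rw [← hc] at d4; simp at d4
  · rw [c2, c4] at hc; rw [hc] at d2; simp at d2
  · rw [c2, c4] at hc
    apply key; rw [e12, e34, hc]


/-- The label of the vertex number `2 * s + 1` on arm `a`. -/
def oddLab (n a s : ℕ) : ℕ := lab n (a, 2 * s + 1)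

theorem oddLab_zero {n : ℕ} (a : ℕ) : oddLab n a 0 = n - 1 := lab_one _ rfl

theorem oddLab_mid {n a s : ℕ} (hn : 3 ≤ n) (ha : Long n a) (h1 : 1 ≤ s) (h2 : s ≤ n - 2) :
    oddLab n a s = if start n a + s < n then start n a + s - 1 else start n a + s + 1 - n :=
  lab_long_mid hn (a, 2 * s + 1) ha s h1 h2 rfl

theorem oddLab_last {n a : ℕ} (hn : 3 ≤ n) (ha : Long n a) : oddLab n a (n - 1) = n :=
  lab_long_pre hn _ ha (by simp only; omega)

theorem oddLab_bounds {n a s : ℕ} (hn : 3 ≤ n) (ha : Long n a) (h1 : 1 ≤ s) (h2 : s ≤ n - 2) :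
    1 ≤ oddLab n a s ∧ oddLab n a s ≤ n - 2 :=
  have hb := start_bounds hn ha
  mid_label_bounds hb.1 hb.2 h1 h2 (oddLab_mid hn ha h1 h2)

theorem oddLab_ne_zero {n a s : ℕ} (hn : 3 ≤ n) (ha : Long n a) (h2 : s ≤ n - 1) :
    oddLab n a s ≠ 0 := by
  rcases Nat.eq_zero_or_pos s with rfl | h
  · rw [oddLab_zero]; omega
  rcases h2.eq_or_lt with rfl | h'
  · rw [oddLab_last hn ha]; omega
  · have := oddLab_bounds hn ha h (by omega); omega

theorem oddLab_inj {n a s t : ℕ} (hn : 3 ≤ n) (ha : Long n a) (h1 : s ≤ n - 1) (h2 : t ≤ n - 1)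
    (h : oddLab n a s = oddLab n a t) : s = t := by
  have hp : ∀ r, r ≤ n - 1 → IsPos n (a, 2 * r + 1) := by
    intro r hr
    refine ⟨?_, fun _ => ⟨ha.1, ha.2.1⟩⟩
    simp only [armLen]
    rw [if_neg ha.2.2.1, if_neg ha.2.2.2]; omega
  have := snd_eq_of_lab_eq hn (hp s h1) (hp t h2) rfl h (oddLab_ne_zero hn ha h1)
  simp only at this; omega

theorem oddLab_arm_inj {n a b s : ℕ} (hn : 3 ≤ n) (ha : Long n a) (hb : Long n b) (h1 : 1 ≤ s)
    (h2 : s ≤ n - 2) (h : oddLab n a s = oddLab n b s) : a = b := by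
  rw [oddLab_mid hn ha h1 h2, oddLab_mid hn hb h1 h2] at h
  have sa := start_bounds hn ha
  have sb := start_bounds hn hb
  exact start_inj hn ha hb (mid_start_inj sa.1 sa.2 sb.1 sb.2 h1 h)

/-! ### Factorizations: classes of vertices labelled $0$ -/

/-- The data of a factorization: a connected graph `V` with a simplicial map `G` to `X₁` that
lifts, on the way out from the centre, and a simplicial map `f` to an od with `n - 1` arms such
that the composition of `G` with the bonding map is constant on the fibres of `f`. -/
structure FactorData (n : ℕ) {V : Type*} (E : V → V → Prop) (G f : V → ℕ × ℕ) : Prop where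
  three_le : 3 ≤ n
  symm : ∀ x y, E x y → E y x
  conn : ∀ x y, Relation.ReflTransGen E x y
  pos : ∀ x, IsPos n (G x)
  adjG : ∀ x y, E x y → OAdj (G x) (G y)
  nbr : ∀ x, ∃ y, E x y
  down : ∀ x, (G x).2 ≠ 0 → ∃ y, E x y ∧ (G y).2 + 1 = (G x).2
  up : ∀ x, Long n (G x).1 → 1 ≤ (G x).2 → (G x).2 ≤ 2 * n - 2 →
    ∃ y, E x y ∧ (G y).2 = (G x).2 + 1
  arm : ∀ x, (f x).1 < n - 1
  norm : ∀ x, (f x).2 = 0 → (f x).1 = 0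
  adjf : ∀ x y, E x y → OAdj (f x) (f y)
  fib : ∀ x y, f x = f y → lab n (G x) = lab n (G y)

/-- The point at distance `s` on arm `e`, where the centre is normalized to be `(0, 0)`. -/
def opt (e s : ℕ) : ℕ × ℕ := if s = 0 then (0, 0) else (e, s)

namespace FactorData

variable {n : ℕ} {V : Type*} {E : V → V → Prop} {G f : V → ℕ × ℕ}

theorem f_eq_opt (d : FactorData n E G f) (x : V) : f x = opt (f x).1 (f x).2 := by
  unfold opt
  split_ifs with h
  · exact Prod.ext (d.norm x h) h
  · rfl

theorem f_nbr (d : FactorData n E G f) {x y : V} {e s : ℕ} (hx : f x = (e, s)) (hs : s ≠ 0)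
    (h : E x y) : f y = (e, s + 1) ∨ f y = opt e (s - 1) := by
  have ha := d.adjf x y h
  rw [d.f_eq_opt y]
  unfold OAdj at ha
  rw [hx] at ha
  simp only at ha
  rcases ha with ⟨h1, h2 | h2⟩ | ⟨h1, h2 | h2⟩
  · exact absurd h2 hs
  · left; rw [h1, ← h2]; simp [opt]
  · right; rw [h2, h1, h2]; simp [opt]
  · right; rw [h1, ← h2]; simp

/-- `G x` is the vertex number `2 * m` on the long arm `a`, beyond the central component. -/
def Inner (n : ℕ) (x : ℕ × ℕ) (a m : ℕ) : Prop :=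
  Long n a ∧ 2 ≤ m ∧ m ≤ n - 1 ∧ x = (a, 2 * m)

theorem inner_nbrs (d : FactorData n E G f) {x : V} {a m : ℕ} (h : Inner n (G x) a m) :
    ∃ u v, E x u ∧ E x v ∧ G u = (a, 2 * m + 1) ∧ G v = (a, 2 * (m - 1) + 1) := by
  obtain ⟨ha, h2, hm, hG⟩ := h
  obtain ⟨u, hu, hu'⟩ := d.up x (by rw [hG]; exact ha) (by rw [hG]; simp only; omega)
    (by rw [hG]; simp only; omega)
  obtain ⟨v, hv, hv'⟩ := d.down x (by rw [hG]; simp only; omega)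
  have eu := (d.adjG x u hu).fst (by rw [hG]; simp only; omega) (by omega)
  have ev := (d.adjG x v hv).fst (by rw [hG]; simp only; omega) (by rw [hG] at hv'; omega)
  rw [hG] at hu' hv' eu ev
  refine ⟨u, v, hu, hv, Prod.ext eu.symm hu', Prod.ext ev.symm ?_⟩
  simp only at hv' ⊢
  omega

/-- The two neighbours of an inner vertex go to the two neighbours of its image. -/
theorem inner_split (d : FactorData n E G f) {x : V} {a m e s : ℕ} (h : Inner n (G x) a m)
    (hx : f x = (e, s)) (hs : s ≠ 0) :
    ∃ u v, E x u ∧ E x v ∧ G u = (a, 2 * m + 1) ∧ G v = (a, 2 * (m - 1) + 1) ∧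
      ((f u = (e, s + 1) ∧ f v = opt e (s - 1)) ∨ (f v = (e, s + 1) ∧ f u = opt e (s - 1))) := by
  obtain ⟨u, v, hu, hv, gu, gv⟩ := d.inner_nbrs h
  -- The two neighbours carry different labels of the same arm, and labels are constant on the
  -- fibres of $f$.
  have hne : f u ≠ f v := by
    intro hh
    have := d.fib u v hh
    rw [gu, gv] at this
    have := oddLab_inj d.three_le h.1 h.2.2.1 (by have := h.2.2.1; omega) this
    have := h.2.1
    omega
  refine ⟨u, v, hu, hv, gu, gv, ?_⟩
  rcases d.f_nbr hx hs hu with h1 | h1 <;> rcases d.f_nbr hx hs hv with h2 | h2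
  · exact absurd (h1.trans h2.symm) hne
  · exact Or.inl ⟨h1, h2⟩
  · exact Or.inr ⟨h2, h1⟩
  · exact absurd (h1.trans h2.symm) hne

theorem lab_of_G {a s : ℕ} {x : V} (h : G x = (a, 2 * s + 1)) : lab n (G x) = oddLab n a s := by
  rw [h]; rfl

/-- No vertex adjacent to one with label `n - 1` has the same image as an inner vertex. -/
theorem inner_not_central (d : FactorData n E G f) {x x' y : V} {a m : ℕ} (h : Inner n (G x) a m)
    (hs : (f x).2 ≠ 0) (hf : f x' = f x) (hy : E x' y) (hl : lab n (G y) = n - 1) : False := by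
  have hn := d.three_le
  obtain ⟨u, v, hu, hv, gu, gv, hh⟩ := d.inner_split h (e := (f x).1) (s := (f x).2) rfl hs
  -- Since $f(u)$ and $f(v)$ exhaust the neighbours of $f(x)$, the vertex $y$ lies over one of them;
  -- their labels sit at odd positions beyond the first, so they are not $n-1$.
  have key : ∀ w s, 1 ≤ s → s ≤ n - 1 → G w = (a, 2 * s + 1) → f y = f w → False := by
    intro w s h1 h2 hw hfy
    have h3 := d.fib _ _ hfy
    rw [hl, lab_of_G hw, ← oddLab_zero a] at h3
    have := oddLab_inj hn h.1 (by omega) h2 h3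
    omega
  have k1 := key u m (by have := h.2.1; omega) h.2.2.1 gu
  have k2 := key v (m - 1) (by have := h.2.1; omega) (by have := h.2.2.1; omega) gv
  rcases d.f_nbr (e := (f x).1) (s := (f x).2) (by rw [hf]) hs hy with h1 | h1 <;>
  rcases hh with ⟨h2, h3⟩ | ⟨h2, h3⟩
  · exact k1 (h1.trans h2.symm)
  · exact k2 (h1.trans h2.symm)
  · exact k2 (h1.trans h3.symm)
  · exact k1 (h1.trans h3.symm)

/-- If $f$ goes outward as $G$ goes outward, it cannot turn back before $G$ reaches the label $n$: a
fold would identify two different labels of one long arm. Hence arm $e$ of the od displays the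
labels of arm $a$ in order. -/
theorem inner_outward_inc (d : FactorData n E G f) (j : ℕ) : ∀ {x : V} {a m e s : ℕ},
    Inner n (G x) a m → f x = (e, s) → s ≠ 0 →
    (∃ u, E x u ∧ G u = (a, 2 * m + 1) ∧ f u = (e, s + 1)) → m + j ≤ n - 1 →
    ∃ w, f w = (e, s + 1 + 2 * j) ∧ lab n (G w) = oddLab n a (m + j) := by
  have hn := d.three_le
  induction j with
  | zero =>
    rintro x a m e s hI hx hs ⟨u, hu, gu, fu⟩ _
    exact ⟨u, fu, lab_of_G gu⟩
  | succ j ih =>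
    rintro x a m e s hI hx hs ⟨u, hu, gu, fu⟩ hj
    obtain ⟨y, hy, hy'⟩ := d.up u (by rw [gu]; exact hI.1) (by rw [gu]; simp only; omega)
      (by rw [gu]; simp only; omega)
    have ey := (d.adjG u y hy).fst (by rw [gu]; simp only; omega) (by omega)
    rw [gu] at ey hy'
    have gy : G y = (a, 2 * (m + 1)) := Prod.ext ey.symm (by rw [hy']; simp only; ring)
    have hI' : Inner n (G y) a (m + 1) := ⟨hI.1, by have := hI.2.1; omega, by omega, gy⟩
    obtain ⟨u₀, v₀, -, -, gu₀, gv₀, h0⟩ := d.inner_split hI hx hs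
    have nlab : ∀ {p q : V} {i k : ℕ}, G p = (a, 2 * i + 1) → G q = (a, 2 * k + 1) → i ≤ n - 1 →
        k ≤ n - 1 → i ≠ k → f p ≠ f q := by
      intro p q i k hp hq hi hk hik hpq
      have := d.fib p q hpq
      rw [lab_of_G hp, lab_of_G hq] at this
      exact hik (oddLab_inj hn hI.1 hi hk this)
    have h2 := hI.2.1
    have hv0 : f v₀ = opt e (s - 1) := by
      rcases h0 with h0 | h0
      · exact h0.2
      · exact absurd (fu.trans h0.1.symm) (nlab gu gv₀ (by omega) (by omega) (by omega))
    have fy : f y = (e, s + 1 + 1) := by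
      rcases d.f_nbr fu (by omega) hy with h | h
      · exact h
      · exfalso
        have h : f y = (e, s) := by rw [h]; simp [opt, hs]
        obtain ⟨u₁, v₁, -, -, gu₁, gv₁, h1⟩ := d.inner_split hI' h hs
        rcases h1 with h1 | h1
        · exact nlab gu₁ gu (by omega) (by omega) (by omega) (h1.1.trans fu.symm)
        · exact nlab gu₁ gv₀ (by omega) (by omega) (by omega) (h1.2.trans hv0.symm)
    obtain ⟨u₂, v₂, hu₂, hv₂, gu₂, gv₂, h2⟩ := d.inner_split hI' fy (by omega)
    have fu₂ : f u₂ = (e, s + 1 + 1 + 1) := by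
      rcases h2 with h2 | h2
      · exact h2.1
      · exfalso
        have h3 : f u₂ = f u := by rw [h2.2, fu]; simp [opt]
        exact nlab gu₂ gu (by omega) (by omega) (by omega) h3
    obtain ⟨w, hw, hw'⟩ := ih hI' fy (by omega) ⟨u₂, hu₂, gu₂, fu₂⟩ (by omega)
    refine ⟨w, ?_, ?_⟩
    · rw [hw]; congr 1; ring
    · rw [hw']; congr 1; ring

/-- The mirror image of `inner_outward_inc`: now $G$ moves towards the centre of $X_1$, and the
labels are displayed backwards, down to $n-1$ at position $1$. -/
theorem inner_outward_dec (d : FactorData n E G f) (j : ℕ) : ∀ {x : V} {a m e s : ℕ},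
    Inner n (G x) a m → f x = (e, s) → s ≠ 0 →
    (∃ v, E x v ∧ G v = (a, 2 * (m - 1) + 1) ∧ f v = (e, s + 1)) → j ≤ m - 1 →
    ∃ w, f w = (e, s + 1 + 2 * j) ∧ lab n (G w) = oddLab n a (m - 1 - j) := by
  have hn := d.three_le
  induction j with
  | zero =>
    rintro x a m e s hI hx hs ⟨u, hu, gu, fu⟩ _
    exact ⟨u, fu, lab_of_G gu⟩
  | succ j ih =>
    rintro x a m e s hI hx hs ⟨v, hv, gv, fv⟩ hj
    obtain ⟨y, hy, hy'⟩ := d.down v (by rw [gv]; simp only; omega)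
    have h2 := hI.2.1
    have hm := hI.2.2.1
    rw [gv] at hy'
    simp only at hy'
    have ey := (d.adjG v y hy).fst (by rw [gv]; simp only; omega) (by omega)
    rw [gv] at ey
    have gy : G y = (a, 2 * (m - 1)) := Prod.ext ey.symm (by simp only; omega)
    have nlab : ∀ {p q : V} {i k : ℕ}, G p = (a, 2 * i + 1) → G q = (a, 2 * k + 1) → i ≤ n - 1 →
        k ≤ n - 1 → i ≠ k → f p ≠ f q := by
      intro p q i k hp hq hi hk hik hpq
      have := d.fib p q hpq
      rw [lab_of_G hp, lab_of_G hq] at this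
      exact hik (oddLab_inj hn hI.1 hi hk this)
    obtain ⟨u₀, v₀, -, -, gu₀, gv₀, h0⟩ := d.inner_split hI hx hs
    have hu0 : f u₀ = opt e (s - 1) := by
      rcases h0 with h0 | h0
      · exact absurd (fv.trans h0.1.symm) (nlab gv gu₀ (by omega) (by omega) (by omega))
      · exact h0.2
    by_cases hm2 : m = 2
    · -- the next vertex is central
      subst hm2
      have hj0 : j = 0 := by omega
      subst hj0
      obtain ⟨w, hw, hw'⟩ := d.down y (by rw [gy]; simp)
      have lw : lab n (G w) = n - 1 := lab_one _ (by rw [gy] at hw'; simp only at hw'; omega)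
      have fy : f y = (e, s + 1 + 1) := by
        rcases d.f_nbr fv (by omega) hy with h | h
        · exact h
        · exfalso
          have h : f y = f x := by rw [h, hx]; simp [opt, hs]
          exact d.inner_not_central hI (by rw [hx]; exact hs) h hw lw
      refine ⟨w, ?_, ?_⟩
      · rcases d.f_nbr fy (by omega) hw with h | h
        · rw [h]
        · exfalso
          have h : f w = f v := by rw [h, fv]; simp [opt]
          have := d.fib _ _ h
          rw [lw, lab_of_G gv, ← oddLab_zero a] at this
          have := oddLab_inj hn hI.1 (by omega) (by omega) this
          omega
      · rw [lw]; exact (oddLab_zero a).symm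
    have hI' : Inner n (G y) a (m - 1) := ⟨hI.1, by omega, by omega, gy⟩
    have fy : f y = (e, s + 1 + 1) := by
      rcases d.f_nbr fv (by omega) hy with h | h
      · exact h
      · exfalso
        have h : f y = (e, s) := by rw [h]; simp [opt, hs]
        obtain ⟨u₁, v₁, -, -, gu₁, gv₁, h1⟩ := d.inner_split hI' h hs
        rcases h1 with h1 | h1
        · exact nlab gv₁ gu₀ (by omega) (by omega) (by omega) (h1.2.trans hu0.symm)
        · exact nlab gv₁ gv (by omega) (by omega) (by omega) (h1.1.trans fv.symm)
    obtain ⟨u₂, v₂, hu₂, hv₂, gu₂, gv₂, h2⟩ := d.inner_split hI' fy (by omega)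
    have fv₂ : f v₂ = (e, s + 1 + 1 + 1) := by
      rcases h2 with h2 | h2
      · exfalso
        have h3 : f v₂ = f v := by rw [h2.2, fv]; simp [opt]
        exact nlab gv₂ gv (by omega) (by omega) (by omega) h3
      · exact h2.1
    obtain ⟨w, hw, hw'⟩ := ih hI' fy (by omega) ⟨v₂, hv₂, gv₂, fv₂⟩ (by omega)
    refine ⟨w, ?_, ?_⟩
    · rw [hw]; congr 1; ring
    · rw [hw']; congr 1; omega

/-- Both vertices prescribe the labels on the od outward from their common image. A sequence read in
increasing direction meets $n$ first, one read in decreasing direction meets $n-1$ first, and labels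
in between lie in $1,\dots,n-2$. So the directions agree, the number of steps to the marker gives
$m=m'$, and a single middle label then gives the arm. -/
theorem inner_unique (d : FactorData n E G f) {x x' : V} {a m a' m' : ℕ} (h : Inner n (G x) a m)
    (h' : Inner n (G x') a' m') (hs : (f x).2 ≠ 0) (hf : f x' = f x) : a = a' ∧ m = m' := by
  have hn := d.three_le
  obtain ⟨⟨e, s⟩, hx⟩ : ∃ y, f x = y := ⟨_, rfl⟩
  rw [hx] at hs hf
  have l2 := h.2.1
  have l3 := h.2.2.1
  have l2' := h'.2.1
  have l3' := h'.2.2.1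
  have bd := fun i (hi : 1 ≤ i) (hi' : i ≤ n - 2) => oddLab_bounds hn h.1 hi hi'
  have bd' := fun i (hi : 1 ≤ i) (hi' : i ≤ n - 2) => oddLab_bounds hn h'.1 hi hi'
  obtain ⟨u, v, hu, hv, gu, gv, hh⟩ := d.inner_split h hx hs
  obtain ⟨u', v', hu', hv', gu', gv', hh'⟩ := d.inner_split h' hf hs
  have z := oddLab_zero (n := n) a
  have z' := oddLab_zero (n := n) a'
  have t := oddLab_last hn h.1
  have t' := oddLab_last hn h'.1
  rcases hh with ⟨h1, h2⟩ | ⟨h1, h2⟩ <;> rcases hh' with ⟨h1', h2'⟩ | ⟨h1', h2'⟩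
  · have A := fun j => d.inner_outward_inc j h hx hs ⟨u, hu, gu, h1⟩
    have A' := fun j => d.inner_outward_inc j h' hf hs ⟨u', hu', gu', h1'⟩
    have key : ∀ j, m + j ≤ n - 1 → m' + j ≤ n - 1 → oddLab n a (m + j) = oddLab n a' (m' + j) := by
      intro j hj hj'
      obtain ⟨w, hw, lw⟩ := A j hj
      obtain ⟨w', hw', lw'⟩ := A' j hj'
      rw [← lw, ← lw']; exact d.fib _ _ (hw.trans hw'.symm)
    have hm : m = m' := by
      rcases lt_trichotomy m m' with hlt | heq | hlt
      · have k := key (n - 1 - m') (by omega) (by omega)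
        rw [show m' + (n - 1 - m') = n - 1 by omega, t'] at k
        have := bd (m + (n - 1 - m')) (by omega) (by omega)
        omega
      · exact heq
      · have k := key (n - 1 - m) (by omega) (by omega)
        rw [show m + (n - 1 - m) = n - 1 by omega, t] at k
        have := bd' (m' + (n - 1 - m)) (by omega) (by omega)
        omega
    subst hm
    -- The outward labels may already be the final label $n$, which all long arms share; the inward
    -- neighbours at position $2(m-1)+1$ carry a middle label, which tells the arms apart.
    have k := d.fib _ _ (h2.trans h2'.symm)
    rw [lab_of_G gv, lab_of_G gv'] at k
    exact ⟨oddLab_arm_inj hn h.1 h'.1 (by omega) (by omega) k, rfl⟩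
  · exfalso
    have A := fun j => d.inner_outward_inc j h hx hs ⟨u, hu, gu, h1⟩
    have A' := fun j => d.inner_outward_dec j h' hf hs ⟨v', hv', gv', h1'⟩
    have key : ∀ j, m + j ≤ n - 1 → j ≤ m' - 1 → oddLab n a (m + j) = oddLab n a' (m' - 1 - j) := by
      intro j hj hj'
      obtain ⟨w, hw, lw⟩ := A j hj
      obtain ⟨w', hw', lw'⟩ := A' j hj'
      rw [← lw, ← lw']; exact d.fib _ _ (hw.trans hw'.symm)
    by_cases hc : n - 1 - m ≤ m' - 1
    · have k := key (n - 1 - m) (by omega) hc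
      rw [show m + (n - 1 - m) = n - 1 by omega, t] at k
      by_cases h0 : m' - 1 - (n - 1 - m) = 0
      · rw [h0, z'] at k; omega
      · have := bd' (m' - 1 - (n - 1 - m)) (by omega) (by omega); omega
    · have k := key (m' - 1) (by omega) (by omega)
      rw [show m' - 1 - (m' - 1) = 0 by omega, z'] at k
      have := bd (m + (m' - 1)) (by omega) (by omega); omega
  · exfalso
    have A := fun j => d.inner_outward_dec j h hx hs ⟨v, hv, gv, h1⟩
    have A' := fun j => d.inner_outward_inc j h' hf hs ⟨u', hu', gu', h1'⟩
    have key : ∀ j, m' + j ≤ n - 1 → j ≤ m - 1 → oddLab n a' (m' + j) = oddLab n a (m - 1 - j) := by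
      intro j hj hj'
      obtain ⟨w, hw, lw⟩ := A j hj'
      obtain ⟨w', hw', lw'⟩ := A' j hj
      rw [← lw, ← lw']; exact d.fib _ _ (hw'.trans hw.symm)
    by_cases hc : n - 1 - m' ≤ m - 1
    · have k := key (n - 1 - m') (by omega) hc
      rw [show m' + (n - 1 - m') = n - 1 by omega, t'] at k
      by_cases h0 : m - 1 - (n - 1 - m') = 0
      · rw [h0, z] at k; omega
      · have := bd (m - 1 - (n - 1 - m')) (by omega) (by omega); omega
    · have k := key (m - 1) (by omega) (by omega)
      rw [show m - 1 - (m - 1) = 0 by omega, z] at k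
      have := bd' (m' + (m - 1)) (by omega) (by omega); omega
  · have A := fun j => d.inner_outward_dec j h hx hs ⟨v, hv, gv, h1⟩
    have A' := fun j => d.inner_outward_dec j h' hf hs ⟨v', hv', gv', h1'⟩
    have key : ∀ j, j ≤ m - 1 → j ≤ m' - 1 → oddLab n a (m - 1 - j) = oddLab n a' (m' - 1 - j) := by
      intro j hj hj'
      obtain ⟨w, hw, lw⟩ := A j hj
      obtain ⟨w', hw', lw'⟩ := A' j hj'
      rw [← lw, ← lw']; exact d.fib _ _ (hw.trans hw'.symm)
    have hm : m = m' := by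
      rcases lt_trichotomy m m' with hlt | heq | hlt
      · have k := key (m - 1) (by omega) (by omega)
        rw [show m - 1 - (m - 1) = 0 by omega, z] at k
        have := bd' (m' - 1 - (m - 1)) (by omega) (by omega)
        omega
      · exact heq
      · have k := key (m' - 1) (by omega) (by omega)
        rw [show m' - 1 - (m' - 1) = 0 by omega, z'] at k
        have := bd (m - 1 - (m' - 1)) (by omega) (by omega)
        omega
    subst hm
    have k := key 0 (by omega) (by omega)
    exact ⟨oddLab_arm_inj hn h.1 h'.1 (by omega) (by omega) k, rfl⟩

/-- A vertex with label `0` is either inner, or central and then adjacent to one with label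
`n - 1`. -/
theorem zero_cases (d : FactorData n E G f) {x : V} (h : lab n (G x) = 0) :
    (∃ a m, Inner n (G x) a m) ∨ (col n (G x) = (0, 0) ∧ ∃ y, E x y ∧ lab n (G y) = n - 1) := by
  have hn := d.three_le
  have central : (G x).2 = 0 ∨ (G x).2 = 2 → ∃ y, E x y ∧ lab n (G y) = n - 1 := by
    rintro (h0 | h2)
    · obtain ⟨y, hy⟩ := d.nbr x
      have := (d.adjG x y hy).snd
      exact ⟨y, hy, lab_one _ (by omega)⟩
    · obtain ⟨y, hy, hy'⟩ := d.down x (by omega)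
      exact ⟨y, hy, lab_one _ (by omega)⟩
  rcases pos_cases hn _ (d.pos x) with h' | h' | h' | h' | h' | h' | ⟨hl, h' | ⟨s, h', hs, hs', h'''⟩ | h' | h'⟩ <;> try omega
  · right
    refine ⟨?_, central (Or.inl h'.1)⟩
    unfold col; rw [if_pos (by omega)]
  · right
    refine ⟨?_, central (Or.inr h'.2.1)⟩
    unfold col; rw [if_pos (by omega)]
  · by_cases h2 : (G x).2 = 2
    · right
      refine ⟨?_, central (Or.inr h2)⟩
      have := hl.2.2.1
      unfold col; rw [if_pos (by omega)]
    · left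
      exact ⟨(G x).1, (G x).2 / 2, hl, by omega, by omega, Prod.ext rfl (by simp only; omega)⟩
  · have hb := start_bounds hn hl
    have := mid_label_bounds hb.1 hb.2 h' hs h'''
    omega

/-- Over a point off the centre, inner vertices coincide, central vertices share one class, and the
two kinds do not mix. -/
theorem col_eq_of_zero (d : FactorData n E G f) {x x' : V} (h : lab n (G x) = 0)
    (hs : (f x).2 ≠ 0) (hf : f x = f x') : col n (G x) = col n (G x') := by
  have h' : lab n (G x') = 0 := (d.fib _ _ hf).symm.trans h
  rcases d.zero_cases h with ⟨a, m, hI⟩ | ⟨hc, y, hy, ly⟩ <;>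
  rcases d.zero_cases h' with ⟨a', m', hI'⟩ | ⟨hc', y', hy', ly'⟩
  · obtain ⟨rfl, rfl⟩ := d.inner_unique hI hI' hs hf.symm
    rw [hI.2.2.2, hI'.2.2.2]
  · exact (d.inner_not_central hI hs hf.symm hy' ly').elim
  · exact (d.inner_not_central hI' (hf ▸ hs) hf hy ly).elim
  · rw [hc, hc']

end FactorData

theorem Adj₀.symm {n a b : ℕ} (h : Adj₀ n a b) : Adj₀ n b a := Or.symm h

theorem adj_lab {n : ℕ} (hn : 3 ≤ n) {x y : ℕ × ℕ} (hx : IsPos n x) (hy : IsPos n y)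
    (h : OAdj x y) : Adj₀ n (lab n x) (lab n y) := by
  have key : ∀ {x y : ℕ × ℕ}, IsPos n y → y.2 = x.2 + 1 → (x.2 = 0 ∨ x.1 = y.1) →
      Adj₀ n (lab n x) (lab n y) := by
    rintro ⟨a, k⟩ ⟨b, l⟩ hy h1 h2
    simp only at h1 h2
    subst h1
    have h3 := adj_phiVertex n hn b k (by have := hy.1; simp only at this; omega)
    rcases h2 with rfl | rfl
    · unfold lab
      rw [phiVertex_zero n hn] at h3 ⊢
      exact h3
    · exact h3
  rcases h with ⟨h1, h2⟩ | ⟨h1, h2⟩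
  · exact key hy h1 h2
  · exact (key hx h1 (h2.imp id Eq.symm)).symm

/-- Solves the cyclic shift for the position, without or with one wrap around. -/
theorem exists_oddLab_eq {n a l : ℕ} (hn : 3 ≤ n) (ha : Long n a) (h1 : 1 ≤ l) (h2 : l ≤ n - 2) :
    ∃ s, 1 ≤ s ∧ s ≤ n - 2 ∧ oddLab n a s = l := by
  have hb := start_bounds hn ha
  by_cases h : start n a ≤ l
  · refine ⟨l - start n a + 1, by omega, by omega, ?_⟩
    rw [oddLab_mid hn ha (by omega) (by omega), if_pos (by omega)]; omega
  · refine ⟨l + n - 1 - start n a, by omega, by omega, ?_⟩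
    rw [oddLab_mid hn ha (by omega) (by omega), if_neg (by omega)]; omega

theorem opt_of_ne_zero {e s : ℕ} (h : s ≠ 0) : opt e s = (e, s) := if_neg h

theorem opt_snd (e s : ℕ) : (opt e s).2 = s := by
  unfold opt; split_ifs with h
  · exact h.symm
  · rfl

namespace FactorData

variable {n : ℕ} {V : Type*} {E : V → V → Prop} {G f : V → ℕ × ℕ}

/-! ### Lifts along the arms of the small od -/

/-- Both simplicial maps at once, on an edge. -/
def PairEdge (n : ℕ) (E : V → V → Prop) (G f : V → ℕ × ℕ) (c y c' y' : ℕ × ℕ) : Prop :=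
  ∃ u v, E u v ∧ col n (G u) = c ∧ f u = y ∧ col n (G v) = c' ∧ f v = y'

/-- The local uniqueness behind every lifting argument: a nonzero label is handled by
`col_eq_of_adj`, the label $0$ by `col_eq_of_zero`. The only case left open is a centre with label
$0$. -/
theorem back_unique (d : FactorData n E G f) {c₁ c₃ c₂ y₁ y₂ : ℕ × ℕ}
    (h : PairEdge n E G f c₁ y₁ c₂ y₂) (h' : PairEdge n E G f c₃ y₁ c₂ y₂)
    (h0 : y₁.2 ≠ 0 ∨ ∀ x, f x = y₁ → lab n (G x) ≠ 0) : c₁ = c₃ := by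
  obtain ⟨x₁, x₂, h12, rfl, rfl, rfl, rfl⟩ := h
  obtain ⟨x₃, x₄, h34, rfl, f1, hc, f2⟩ := h'
  by_cases hl : lab n (G x₁) = 0
  · refine d.col_eq_of_zero hl ?_ f1.symm
    rcases h0 with h0 | h0
    · exact h0
    · exact absurd hl (h0 x₁ rfl)
  · exact col_eq_of_adj d.three_le (d.pos _) (d.pos _) (d.adjG _ _ h12) (d.adjG _ _ h34) hc.symm
      (d.fib _ _ f1.symm) hl

theorem PairEdge.symm (d : FactorData n E G f) {c y c' y' : ℕ × ℕ}
    (h : PairEdge n E G f c y c' y') : PairEdge n E G f c' y' c y := by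
  obtain ⟨u, v, h1, h2, h3, h4, h5⟩ := h
  exact ⟨v, u, d.symm _ _ h1, h4, h5, h2, h3⟩

/-- `C` is a lift along arm `e`, between the positions `s₀` and `s`. -/
def IsLift (n : ℕ) (E : V → V → Prop) (G f : V → ℕ × ℕ) (e s₀ s : ℕ) (C : ℕ → ℕ × ℕ) : Prop :=
  ∀ i, s₀ ≤ i → i < s → PairEdge n E G f (C i) (opt e i) (C (i + 1)) (opt e (i + 1))

theorem IsLift.extend {e s₀ s : ℕ} {C : ℕ → ℕ × ℕ} {c : ℕ × ℕ} (h : IsLift n E G f e s₀ s C)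
    (hc : PairEdge n E G f (C s) (opt e s) c (opt e (s + 1))) :
    IsLift n E G f e s₀ (s + 1) (Function.update C (s + 1) c) := by
  intro i h1 h2
  rw [Function.update_of_ne (by omega)]
  rcases Nat.lt_succ_iff_lt_or_eq.1 h2 with h3 | rfl
  · rw [Function.update_of_ne (by omega)]
    exact h i h1 h3
  · rwa [Function.update_self]

theorem IsLift.eq (d : FactorData n E G f) {e s₀ s : ℕ} {C C' : ℕ → ℕ × ℕ}
    (h : IsLift n E G f e s₀ s C) (h' : IsLift n E G f e s₀ s C') (h0 : C s₀ = C' s₀)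
    (hs : s₀ ≤ s) : C s = C' s := by
  suffices ∀ i, s₀ ≤ i → i ≤ s → C i = C' i from this s hs le_rfl
  intro i hi
  induction i, hi using Nat.le_induction with
  | base => exact fun _ => h0
  | succ i hi ih =>
    intro his
    have e1 := ih (by omega)
    have k := (h i hi (by omega)).symm d
    have k' := (h' i hi (by omega)).symm d
    rw [← e1] at k'
    exact d.back_unique k k' (Or.inl (by rw [opt_snd]; omega))

theorem step_cases (d : FactorData n E G f) {x y : V} (h : E x y) :
    (∃ e s, f x = opt e s ∧ f y = opt e (s + 1)) ∨ (∃ e s, f x = opt e (s + 1) ∧ f y = opt e s) := by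
  have key : ∀ {x y : V}, (f y).2 = (f x).2 + 1 → ((f x).2 = 0 ∨ (f x).1 = (f y).1) →
      f x = opt (f y).1 (f x).2 ∧ f y = opt (f y).1 ((f x).2 + 1) := by
    intro x y h1 h2
    constructor
    · rcases h2 with h2 | h2
      · rw [d.f_eq_opt x, h2]; simp [opt]
      · rw [← h2]; exact d.f_eq_opt x
    · rw [← h1]; exact d.f_eq_opt y
  rcases d.adjf x y h with ⟨h1, h2⟩ | ⟨h1, h2⟩
  · exact Or.inl ⟨_, _, key h1 h2⟩
  · exact Or.inr ⟨_, _, (key h1 (h2.imp id Eq.symm)).symm⟩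

/-- If the label of the centre of the od is not `0`, the factorization lifts. -/
theorem col_eq_of_root_ne (d : FactorData n E G f) {r : V} (hr : f r = (0, 0))
    (hl : lab n (G r) ≠ 0) {x x' : V} (hx : f x = f x') : col n (G x) = col n (G x') := by
  have h0 : ∀ y : ℕ × ℕ, y.2 = 0 → ∀ x, f x = y → lab n (G x) ≠ 0 := by
    rintro y hy x rfl
    rwa [d.fib x r (by rw [hr]; exact Prod.ext (d.norm x hy) hy)]
  have key : ∀ x, ∃ C : ℕ → ℕ × ℕ, C 0 = col n (G r) ∧ C (f x).2 = col n (G x) ∧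
      IsLift n E G f (f x).1 0 (f x).2 C := by
    intro x
    induction d.conn r x with
    | refl => exact ⟨fun _ => col n (G r), rfl, rfl, fun i _ h => by rw [hr] at h; simp at h⟩
    | @tail x y _ hxy ih =>
      obtain ⟨C, c0, c1, hC⟩ := ih
      rcases d.step_cases hxy with ⟨e, s, h1, h2⟩ | ⟨e, s, h1, h2⟩
      · have hs : (f x).2 = s := by rw [h1, opt_snd]
        rw [hs] at c1
        have hC' : IsLift n E G f e 0 s C := by
          rw [hs] at hC
          by_cases hs0 : s = 0
          · intro i _ hi; omega
          · rwa [h1, opt_of_ne_zero hs0] at hC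
        have := hC'.extend (c := col n (G y)) ⟨x, y, hxy, c1.symm, h1, rfl, h2⟩
        refine ⟨Function.update C (s + 1) (col n (G y)), ?_, ?_, ?_⟩
        · rw [Function.update_of_ne (by omega)]; exact c0
        · rw [h2, opt_snd, Function.update_self]
        · rw [h2, opt_snd, opt_of_ne_zero (by omega)]
          exact this
      · rw [h1, opt_snd, opt_of_ne_zero (by omega)] at hC
        rw [h1, opt_snd] at c1
        simp only at hC
        have e1 : C s = col n (G y) := by
          refine d.back_unique (hC s (by omega) (by omega)) (y₁ := opt e s)
            ⟨y, x, d.symm _ _ hxy, rfl, h2, c1.symm, h1⟩ ?_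
          by_cases hs : s = 0
          · exact Or.inr (h0 _ (by rw [opt_snd]; exact hs))
          · exact Or.inl (by rw [opt_snd]; exact hs)
        refine ⟨C, c0, by rw [h2, opt_snd, e1], ?_⟩
        rw [h2, opt_snd]
        by_cases hs : s = 0
        · intro i _ hi; omega
        · rw [opt_of_ne_zero hs]
          exact fun i h1 h2 => hC i h1 (by omega)
  obtain ⟨C, c0, c1, hC⟩ := key x
  obtain ⟨C', c0', c1', hC'⟩ := key x'
  rw [← c1, ← c1']
  rw [← hx] at hC' ⊢
  exact hC.eq d hC' (c0.trans c0'.symm) (Nat.zero_le _)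

/-- Every point off the centre is reached from the centre by a path that has a lift. -/
theorem exists_lift (d : FactorData n E G f) {r : V} (hr : f r = (0, 0)) (κ : ℕ × ℕ → ℕ)
    (h1 : ∀ x y, E x y → f x = (0, 0) → κ (G x) = κ (G y))
    (h2 : ∀ x y, f x = f y → (f x).2 = 1 → col n (G x) = col n (G y) → κ (G x) = κ (G y)) (x : V) :
    ((f x).2 = 0 → κ (G x) = κ (G r)) ∧
    ((f x).2 ≠ 0 → ∃ (w : V) (C : ℕ → ℕ × ℕ), f w = ((f x).1, 1) ∧ κ (G w) = κ (G r) ∧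
      C 1 = col n (G w) ∧ C (f x).2 = col n (G x) ∧ IsLift n E G f (f x).1 1 (f x).2 C) := by
  induction d.conn r x with
  | refl => exact ⟨fun _ => rfl, fun h => absurd (by rw [hr]) h⟩
  | @tail x y _ hxy ih =>
    rcases d.step_cases hxy with ⟨e, s, k1, k2⟩ | ⟨e, s, k1, k2⟩
    · refine ⟨fun h => ?_, fun _ => ?_⟩
      · rw [k2, opt_snd] at h; omega
      rw [k2, opt_of_ne_zero (by omega)]
      by_cases hs : s = 0
      · subst hs
        refine ⟨y, fun _ => col n (G y), by rw [k2]; rfl, ?_, rfl, rfl, fun i _ _ => ?_⟩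
        · rw [← h1 x y hxy (by rw [k1]; rfl)]
          exact ih.1 (by rw [k1, opt_snd])
        · simp only at *; omega
      · obtain ⟨w, C, w1, w2, w3, w4, w5⟩ := ih.2 (by rw [k1, opt_snd]; exact hs)
        rw [k1, opt_of_ne_zero hs] at w1 w4 w5
        refine ⟨w, Function.update C (s + 1) (col n (G y)), w1, w2, ?_, ?_, ?_⟩
        · rw [Function.update_of_ne (by omega)]; exact w3
        · exact Function.update_self ..
        · exact IsLift.extend w5 ⟨x, y, hxy, w4.symm, k1, rfl, k2⟩
    -- When the path returns to the centre the lift is lost, since the next arm may be entered from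
    -- a different class. What survives is the value of $\kappa$, which is constant on edges at the
    -- centre and on classes at distance one.
    · obtain ⟨w, C, w1, w2, w3, w4, w5⟩ := ih.2 (by rw [k1, opt_snd]; omega)
      rw [k1, opt_of_ne_zero (by omega)] at w1 w4 w5
      simp only at w1 w4 w5
      refine ⟨fun h => ?_, fun h => ?_⟩
      · rw [k2, opt_snd] at h
        subst h
        rw [h1 y x (d.symm _ _ hxy) (by rw [k2]; rfl), ← w2]
        refine h2 x w ?_ (by rw [k1, opt_snd]) ?_
        · rw [w1, k1]; rfl
        · rw [← w4, ← w3]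
      · rw [k2, opt_snd] at h
        rw [k2, opt_of_ne_zero h]
        refine ⟨w, C, w1, w2, w3, ?_, fun i h1 h2 => w5 i h1 (by simp only at h2; omega)⟩
        exact d.back_unique (w5 s (by omega) (by omega)) (y₁ := opt e s)
            ⟨y, x, d.symm _ _ hxy, rfl, k2, w4.symm, k1⟩ (Or.inl (by rw [opt_snd]; exact h))

/-- A path from $r$ can enter an arm of the od only through its first edge. -/
theorem exists_first_edge (d : FactorData n E G f) {r : V} (hr : f r = (0, 0)) (x : V)
    (hx : (f x).2 ≠ 0) : ∃ u v, E u v ∧ f u = (0, 0) ∧ f v = ((f x).1, 1) := by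
  revert hx
  induction d.conn r x with
  | refl => intro h; exact absurd (by rw [hr]) h
  | @tail x y _ hxy ih =>
    intro hy
    rcases d.step_cases hxy with ⟨e, s, k1, k2⟩ | ⟨e, s, k1, k2⟩
    · by_cases hs : s = 0
      · subst hs
        exact ⟨x, y, hxy, by rw [k1]; rfl, by rw [k2]; rfl⟩
      · have := ih (by rw [k1, opt_snd]; exact hs)
        rw [k1, opt_of_ne_zero hs] at this
        rw [k2, opt_of_ne_zero (by omega)]
        exact this
    · rw [k2, opt_snd] at hy
      have := ih (by rw [k1, opt_snd]; omega)
      rw [k1, opt_of_ne_zero (by omega)] at this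
      rw [k2, opt_of_ne_zero hy]
      exact this

/-! ### A centre with label $0$: the missing first label -/

theorem lab_first (d : FactorData n E G f) {r : V} (hr : f r = (0, 0)) (hl : lab n (G r) = 0)
    {x : V} (hx : (f x).2 = 1) : 1 ≤ lab n (G x) ∧ lab n (G x) ≤ n := by
  obtain ⟨u, v, huv, hu, hv⟩ := d.exists_first_edge hr x (by omega)
  have h1 := adj_lab d.three_le (d.pos _) (d.pos _) (d.adjG _ _ huv)
  rw [d.fib u r (hu.trans hr.symm), hl, d.fib v x (hv.trans (Prod.ext rfl hx.symm))] at h1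
  have := d.three_le
  unfold Adj₀ at h1
  omega

/-- There are too few arms for all the labels. -/
theorem exists_missing_label (d : FactorData n E G f) :
    ∃ l, 1 ≤ l ∧ l ≤ n ∧ ∀ x, (f x).2 = 1 → lab n (G x) ≠ l := by
  by_contra hcon
  push Not at hcon
  have h : ∀ i : Fin n, ∃ x, (f x).2 = 1 ∧ lab n (G x) = i + 1 :=
    fun i => hcon (i + 1) (by omega) (by omega)
  choose x hx hx' using h
  -- At distance one the arm determines the label, so $n$ labels would need $n$ arms.
  have hc := Fintype.card_le_of_injective (fun i => (⟨(f (x i)).1, d.arm _⟩ : Fin (n - 1))) (by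
    intro i j hij
    simp only [Fin.mk.injEq] at hij
    have := d.fib (x i) (x j) (Prod.ext hij ((hx i).trans (hx j).symm))
    rw [hx', hx'] at this
    exact Fin.ext (by omega))
  have := d.three_le
  simp only [Fintype.card_fin] at hc
  omega

theorem pos_of_lab_n {x : ℕ × ℕ} (hn : 3 ≤ n) (hx : IsPos n x) (h : lab n x = n) :
    (Long n x.1 ∧ x.2 = 2 * n - 1) ∨ (x.1 = n - 1 ∧ x.2 = 3) := by
  rcases pos_cases hn x hx with h' | h' | h' | h' | h' | h' | ⟨hl, h' | ⟨s, h', hs, hs', h'''⟩ | h' | h'⟩ <;> try omega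
  · have hb := start_bounds hn hl
    have := mid_label_bounds hb.1 hb.2 h' hs h'''
    omega
  · exact Or.inl ⟨hl, h'.1⟩

/-- Two points with label `n` next to a centre with label `0` have the same class. -/
theorem col_eq_first (d : FactorData n E G f) {r : V} (hr : f r = (0, 0)) (hl : lab n (G r) = 0)
    {x x' : V} (hx : (f x).2 = 1) (hf : f x = f x') (h : lab n (G x) = n) :
    col n (G x) = col n (G x') := by
  have hn := d.three_le
  have h' : lab n (G x') = n := (d.fib _ _ hf).symm.trans h
  obtain ⟨l, l1, l2, hL⟩ := d.exists_missing_label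
  have hroot : ∀ y, (f y).2 = 0 → lab n (G y) = 0 := by
    intro y hy
    rw [d.fib y r (by rw [hr]; exact Prod.ext (d.norm _ hy) hy)]; exact hl
  have hln : l ≠ n := fun hh => hL x hx (h.trans hh.symm)
  suffices harm : (G x).1 = (G x').1 by
    rw [Prod.ext harm (snd_eq_of_lab_eq hn (d.pos _) (d.pos _) harm (h.trans h'.symm) (by omega))]
  have hedge : ∀ x y, E x y → f x = (0, 0) → lab n (G x) = 0 ∧ lab n (G y) ≠ l ∧ lab n (G y) ≠ 0 := by
    intro x y hxy hfx
    have h0 := hroot x (by rw [hfx])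
    have hy : (f y).2 = 1 := by
      have := (d.adjf x y hxy).snd
      rw [hfx] at this; simp only at this; omega
    have := d.lab_first hr hl hy
    exact ⟨h0, hL y hy, by omega⟩
  have px := pos_of_lab_n hn (d.pos x) h
  have px' := pos_of_lab_n hn (d.pos x') h'
  have hlong : ∀ a, Long n a → a ≠ n - 1 := fun a ha => ha.2.2.2
  have hcol : ∀ y, (f y).2 = 1 → col n (G y) = (0, 0) → lab n (G y) = n - 1 := by
    intro y hy hc
    have h1 := d.lab_first hr hl hy
    rcases col_eq_zero_or hn (G y) with ⟨_, h2⟩ | ⟨h2, h3, _⟩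
    · rcases pos_cases hn _ (d.pos y) with h' | h' | h' | h' | h' | h' | ⟨hl, h' | ⟨s, h', hs, hs', h'''⟩ | h' | h'⟩ <;> omega
    · rw [hc] at h2; rw [← h2] at h3; simp at h3
  have hcol' : ∀ y z : V, col n (G y) = col n (G z) → col n (G y) ≠ (0, 0) → G y = G z := by
    intro y z h1 h2
    rcases col_eq_zero_or hn (G y) with ⟨k, _⟩ | ⟨k, _⟩
    · exact absurd k h2
    rcases col_eq_zero_or hn (G z) with ⟨k', _⟩ | ⟨k', _⟩
    · exact absurd (h1.trans k') h2
    rw [← k, ← k', h1]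
  by_cases hlb : l = n - 1
  · -- the components of the complement of the central component
    -- Since no edge over a first edge of the od ends in a vertex labelled $n-1$, i.e. at distance
    -- $1$ in $X_1$, the arm beyond that distance is an invariant. It equals its value at $r$ for
    -- both vertices, so they lie on the same arm.
    have A := fun y => d.exists_lift hr (fun p => if p.2 ≤ 1 then 0 else p.1) ?_ ?_ y
    · obtain ⟨w, C, w1, w2, w3, w4, w5⟩ := (A x).2 (by omega)
      obtain ⟨w', C', w1', w2', w3', w4', w5'⟩ := (A x').2 (by rw [← hf]; omega)
      rw [hx, w3] at w4
      rw [← hf, hx, w3'] at w4'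
      have e1 := hcol' w x w4 (by rw [w4]; intro hc; have := hcol x hx hc; omega)
      have e2 := hcol' w' x' w4' (by
        rw [w4']; intro hc; have := hcol x' (by rw [← hf]; exact hx) hc; omega)
      have := w2.trans w2'.symm
      rw [e1, e2] at this
      rwa [if_neg (by omega), if_neg (by omega)] at this
    · intro x y hxy hfx
      obtain ⟨k1, k2, k3⟩ := hedge x y hxy hfx
      have hy1 : (G y).2 ≠ 1 := fun hh => k2 ((lab_one _ hh).trans hlb.symm)
      have hx1 : (G x).2 ≠ 1 := fun hh => by
        have := lab_one (n := n) _ hh; omega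
      have hy0 : (G y).2 ≠ 0 := fun hh => k3 (lab_zero hn _ hh)
      have hs := (d.adjG x y hxy).snd
      rw [if_neg (by omega), if_neg (by omega)]
      exact (d.adjG x y hxy).fst (by omega) (by omega)
    · intro x y hxy h1 h2
      by_cases hc : col n (G x) = (0, 0)
      · exact absurd (hcol x h1 hc) (by rw [← hlb]; exact hL x h1)
      · rw [hcol' x y h2 hc]
  -- Now the missing label occurs once on each long arm, before the label $n$, and not at all on arm
  -- $n-1$. The invariant $\kappa$ names the long arm if the missing label has been passed and is
  -- $0$ otherwise, so it separates all vertices labelled $n$.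
  · have hl2 : l ≤ n - 2 := by omega
    have A := fun y => d.exists_lift hr (fun p => by
      classical exact if Long n p.1 ∧ ∃ s, 1 ≤ s ∧ s ≤ n - 2 ∧ 2 * s + 1 < p.2 ∧ oddLab n p.1 s = l
        then p.1 else 0) ?_ ?_ y
    · obtain ⟨w, C, w1, w2, w3, w4, w5⟩ := (A x).2 (by omega)
      obtain ⟨w', C', w1', w2', w3', w4', w5'⟩ := (A x').2 (by rw [← hf]; omega)
      rw [hx, w3] at w4
      rw [← hf, hx, w3'] at w4'
      have e1 := hcol' w x w4 (by rw [w4]; intro hc; have := hcol x hx hc; omega)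
      have e2 := hcol' w' x' w4' (by
        rw [w4']; intro hc; have := hcol x' (by rw [← hf]; exact hx) hc; omega)
      have key := w2.trans w2'.symm
      rw [e1, e2] at key
      rcases px with ⟨p1, p2⟩ | ⟨p1, p2⟩ <;> rcases px' with ⟨p1', p2'⟩ | ⟨p1', p2'⟩
      · obtain ⟨s, s1, s2, s3⟩ := exists_oddLab_eq hn p1 l1 hl2
        obtain ⟨s', s1', s2', s3'⟩ := exists_oddLab_eq hn p1' l1 hl2
        rwa [if_pos ⟨p1, s, s1, s2, by omega, s3⟩, if_pos ⟨p1', s', s1', s2', by omega, s3'⟩] at key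
      · obtain ⟨s, s1, s2, s3⟩ := exists_oddLab_eq hn p1 l1 hl2
        rw [if_pos ⟨p1, s, s1, s2, by omega, s3⟩, if_neg (fun hh => hlong _ hh.1 p1')] at key
        have := p1.1; omega
      · obtain ⟨s, s1, s2, s3⟩ := exists_oddLab_eq hn p1' l1 hl2
        rw [if_neg (fun hh => hlong _ hh.1 p1), if_pos ⟨p1', s, s1, s2, by omega, s3⟩] at key
        have := p1'.1; omega
      · rw [p1, p1']
    · intro x y hxy hfx
      obtain ⟨k1, k2, k3⟩ := hedge x y hxy hfx
      have hs := (d.adjG x y hxy).snd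
      by_cases h0 : (G x).2 = 0 ∨ (G y).2 = 0
      · rw [if_neg (by rintro ⟨_, s, _, _, _, _⟩; omega), if_neg (by rintro ⟨_, s, _, _, _, _⟩; omega)]
      · have ha := (d.adjG x y hxy).fst (by omega) (by omega)
        rw [ha]
        congr 1
        apply propext
        apply and_congr_right
        intro _
        refine exists_congr fun s => and_congr_right fun _ => and_congr_right fun _ => ?_
        constructor
        · rintro ⟨q1, q2⟩
          refine ⟨?_, q2⟩
          -- Passing from one side of the cut to the other would make an end point of the edge the
          -- cut vertex itself; but one end has label $0$ and the other avoids $l$.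
          by_contra hcon
          apply k2
          rw [← q2]
          exact congrArg (lab n) (Prod.ext rfl (by simp only; omega))
        · rintro ⟨q1, q2⟩
          refine ⟨?_, q2⟩
          by_contra hcon
          have : lab n (G x) = l := by
            rw [← q2, ← ha]
            exact congrArg (lab n) (Prod.ext rfl (by simp only; omega))
          omega
    · intro x y hxy h1 h2
      by_cases hc : col n (G x) = (0, 0)
      · have b1 : (G x).2 ≤ 2 := by
          rcases col_eq_zero_or hn (G x) with ⟨_, h2⟩ | ⟨h2, h3, _⟩
          · exact h2
          · rw [hc] at h2; rw [← h2] at h3; simp at h3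
        have b2 : (G y).2 ≤ 2 := by
          rcases col_eq_zero_or hn (G y) with ⟨_, h2⟩ | ⟨h4, h3, _⟩
          · exact h2
          · rw [← h2, hc] at h4; rw [← h4] at h3; simp at h3
        rw [if_neg (by rintro ⟨_, s, _, _, _, _⟩; omega), if_neg (by rintro ⟨_, s, _, _, _, _⟩; omega)]
      · rw [hcol' x y h2 hc]

end FactorData

theorem snd_of_lab_eq_n_sub_one {n : ℕ} (hn : 3 ≤ n) {x : ℕ × ℕ} (hx : IsPos n x)
    (h : lab n x = n - 1) : x.2 = 1 := by
  rcases pos_cases hn x hx with h' | h' | h' | h' | h' | h' | ⟨hl, h' | ⟨s, h'⟩ | h' | h'⟩ <;> try omega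
  have := start_bounds hn hl
  obtain ⟨_, _, _, h4⟩ := h'
  split_ifs at h4 <;> omega

theorem eq_of_lab_eq_n_add_one {n : ℕ} (hn : 3 ≤ n) {x : ℕ × ℕ} (hx : IsPos n x)
    (h : lab n x = n + 1) : x = (n - 2, 2) := by
  rcases pos_cases hn x hx with h' | h' | h' | h' | h' | h' | ⟨hl, h' | ⟨s, h'⟩ | h' | h'⟩ <;> try omega
  · exact Prod.ext h'.1 h'.2.1
  · have := start_bounds hn hl
    obtain ⟨_, _, _, h4⟩ := h'
    split_ifs at h4 <;> omega

namespace FactorData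

variable {n : ℕ} {V : Type*} {E : V → V → Prop} {G f : V → ℕ × ℕ}

/-- All points over `y` have the same class. -/
def Uniq (n : ℕ) (G f : V → ℕ × ℕ) (y : ℕ × ℕ) : Prop :=
  ∀ x x', f x = y → f x' = y → col n (G x) = col n (G x')

/-- The lift of `exists_lift` with a trivial invariant. -/
theorem exists_lift_one (d : FactorData n E G f) {r : V} (hr : f r = (0, 0)) {x : V} {e s : ℕ}
    (hx : f x = (e, s)) (hs : s ≠ 0) : ∃ (w : V) (C : ℕ → ℕ × ℕ), f w = (e, 1) ∧
      C 1 = col n (G w) ∧ C s = col n (G x) ∧ IsLift n E G f e 1 s C := by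
  obtain ⟨w, C, w1, _, w3, w4, w5⟩ := (d.exists_lift hr (fun _ => 0) (fun _ _ _ _ => rfl)
    (fun _ _ _ _ _ => rfl) x).2 (by rw [hx]; exact hs)
  rw [hx] at w1 w4 w5
  exact ⟨w, C, w1, w3, w4, w5⟩

/-- The class of a lift at a point of the arm is that of some vertex. -/
theorem IsLift.exists_vertex {w : V} {e s : ℕ} {C : ℕ → ℕ × ℕ} (h1 : f w = (e, 1))
    (h : IsLift n E G f e 1 s C) (hw : C 1 = col n (G w)) {i : ℕ} (hi : 1 ≤ i) (his : i ≤ s) :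
    ∃ u, f u = (e, i) ∧ col n (G u) = C i := by
  rcases hi.eq_or_lt with rfl | hi'
  · exact ⟨w, h1, hw.symm⟩
  · obtain ⟨u, v, _, _, _, k1, k2⟩ := h (i - 1) (by omega) (by omega)
    rw [Nat.sub_add_cancel hi, opt_of_ne_zero (by omega)] at k2
    rw [Nat.sub_add_cancel hi] at k1
    exact ⟨v, k2, k1⟩

/-- Any two vertices over $(e,s+1)$ are ends of lifts along the arm, which agree at $s$; the last
step is then forced by `back_unique`. -/
theorem uniq_succ (d : FactorData n E G f) {r : V} (hr : f r = (0, 0)) {e s : ℕ} (hs : s ≠ 0)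
    (h : Uniq n G f (e, s)) : Uniq n G f (e, s + 1) := by
  intro x x' hx hx'
  obtain ⟨w, C, w1, w3, w4, w5⟩ := d.exists_lift_one hr hx (by omega)
  obtain ⟨w', C', w1', w3', w4', w5'⟩ := d.exists_lift_one hr hx' (by omega)
  have k := w5 s (by omega) (by omega)
  have k' := w5' s (by omega) (by omega)
  have e1 : C s = C' s := by
    obtain ⟨u, v, _, c1, c2, _, _⟩ := k
    obtain ⟨u', v', _, c1', c2', _, _⟩ := k'
    rw [opt_of_ne_zero hs] at c2 c2'
    rw [← c1, ← c1']
    exact h u u' c2 c2'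
  rw [← w4, ← w4']
  rw [← e1] at k'
  exact d.back_unique (k.symm d) (k'.symm d) (Or.inl (by rw [opt_snd]; omega))

/-- A neighbour at distance one has a label in $1,\dots,n$, so the label here is $0$, or it is
$n+1$, which only one vertex of $X_1$ has, or the neighbour has label $n$ and `col_eq_first`
applies. Beyond distance one, classes are thus determined by $f$. -/
theorem uniq_two (d : FactorData n E G f) {r : V} (hr : f r = (0, 0)) (hl : lab n (G r) = 0)
    (e : ℕ) : Uniq n G f (e, 2) := by
  have hn := d.three_le
  intro x x' hx hx'
  obtain ⟨w, C, w1, w3, w4, w5⟩ := d.exists_lift_one hr hx (by omega)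
  obtain ⟨u, v, huv, c1, c2, c3, c4⟩ := w5 1 (by omega) (by omega)
  rw [opt_of_ne_zero (by omega)] at c2 c4
  have h1 := adj_lab hn (d.pos _) (d.pos _) (d.adjG _ _ huv)
  have h2 := d.lab_first hr hl (x := u) (by rw [c2])
  rw [d.fib v x (c4.trans hx.symm)] at h1
  have h3 : lab n (G x) = 0 ∨ lab n (G x) = n + 1 ∨ lab n (G u) = n := by
    unfold Adj₀ at h1; omega
  rcases h3 with h3 | h3 | h3
  · exact d.col_eq_of_zero h3 (by rw [hx]; simp) (hx.trans hx'.symm)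
  · rw [eq_of_lab_eq_n_add_one hn (d.pos _) h3, eq_of_lab_eq_n_add_one hn (d.pos _)
      ((d.fib _ _ (hx'.trans hx.symm)).trans h3)]
  · refine d.uniq_succ hr one_ne_zero ?_ x x' hx hx'
    intro y y' hy hy'
    refine d.col_eq_first hr hl (by rw [hy]) (hy.trans hy'.symm) ?_
    rw [d.fib y u (hy.trans c2.symm), h3]

theorem uniq_of_two_le (d : FactorData n E G f) {r : V} (hr : f r = (0, 0)) (hl : lab n (G r) = 0)
    (e s : ℕ) (hs : 2 ≤ s) : Uniq n G f (e, s) := by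
  induction s, hs using Nat.le_induction with
  | base => exact d.uniq_two hr hl e
  | succ s hs ih => exact d.uniq_succ hr (by omega) ih

/-! ### The core around the centre and its farthest points -/

/-- There is a point with label `n - 1` off the centre, on arm `e`, up to distance `s`. -/
def Passed (n : ℕ) (G f : V → ℕ × ℕ) (e s : ℕ) : Prop :=
  ∃ w t, f w = (e, t) ∧ 1 ≤ t ∧ t ≤ s ∧ lab n (G w) = n - 1

/-- The component of the centre in the complement of the points with label `n - 1`. -/
def Core (n : ℕ) (G f : V → ℕ × ℕ) (x : V) : Prop := ¬ Passed n G f (f x).1 (f x).2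

/-- On every arm the core is an initial interval that ends just before the first vertex labelled
$n-1$. -/
theorem passed_boundary (d : FactorData n E G f) {x y : V} (h : E x y) (hx : ¬ Core n G f x)
    (hy : Core n G f y) : lab n (G x) = n - 1 ∧ (f x).2 ≠ 0 ∧
      sInf {s | Passed n G f (f x).1 s} = (f x).2 := by
  rw [Core, not_not] at hx
  obtain ⟨w, t, w1, w2, w3, w4⟩ := hx
  have h0 : (f x).2 ≠ 0 := by omega
  have key : ∀ t, Passed n G f (f x).1 t → (f x).2 ≤ t := by
    rintro t ⟨w, t', w1, w2, w3, w4⟩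
    by_contra hlt
    refine hy ?_
    rcases d.f_nbr (e := (f x).1) (s := (f x).2) rfl h0 h with k | k
    · rw [k]; exact ⟨w, t', w1, w2, by simp only; omega, w4⟩
    · rw [k, opt_of_ne_zero (by omega)]; exact ⟨w, t', w1, w2, by simp only; omega, w4⟩
  have hP : Passed n G f (f x).1 (f x).2 := ⟨w, t, w1, w2, w3, w4⟩
  have ht : t = (f x).2 := le_antisymm w3 (key t ⟨w, t, w1, w2, le_rfl, w4⟩)
  refine ⟨?_, h0, le_antisymm (Nat.sInf_le hP) (key _ (Nat.sInf_mem (s := {s | Passed n G f (f x).1 s}) ⟨_, hP⟩))⟩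
  rw [← w4]
  exact d.fib _ _ (by rw [w1, ht])

theorem core_lab_ne (d : FactorData n E G f) (h0 : ∀ x, f x = (0, 0) → lab n (G x) = 0) {x : V}
    (h : Core n G f x) : lab n (G x) ≠ n - 1 := by
  intro hl
  by_cases hs : (f x).2 = 0
  · have := h0 x (by rw [d.f_eq_opt x, hs]; rfl)
    have := d.three_le
    omega
  · exact h ⟨x, (f x).2, rfl, by omega, le_rfl, hl⟩

theorem Core.mono {e s t : ℕ} {x y : V} (h : Core n G f x) (hx : f x = (e, s)) (hy : f y = (e, t))
    (hts : t ≤ s) : Core n G f y := by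
  rintro ⟨w, t', w1, w2, w3, w4⟩
  rw [hy] at w1 w3
  exact h ⟨w, t', by rw [hx]; exact w1, w2, by rw [hx]; exact w3.trans hts, w4⟩

/-- The tip of arm $n-2$ has label $n+1$, whose only neighbour in $X_0$ is $v_{n-1}$. So the
preceding point of the od has label $n-1$ and ends the core. -/
theorem core_ne_z (d : FactorData n E G f) {r : V} (hr : f r = (0, 0)) (hl : lab n (G r) = 0)
    {x : V} (h : Core n G f x) : G x ≠ (n - 2, 2) := by
  have hn := d.three_le
  intro hG
  have hlx : lab n (G x) = n + 1 := by
    rw [hG]; simp [lab, phiVertex]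
  obtain ⟨e, s, hx⟩ : ∃ e s, f x = (e, s) := ⟨_, _, rfl⟩
  have hs0 : s ≠ 0 := by
    rintro rfl
    have := d.fib x r (by rw [hr]; exact Prod.ext (d.norm x (by rw [hx])) (by rw [hx]))
    omega
  have hs1 : s ≠ 1 := by
    rintro rfl
    have := d.lab_first hr hl (x := x) (by rw [hx])
    omega
  obtain ⟨w, C, w1, w3, w4, w5⟩ := d.exists_lift_one hr hx hs0
  obtain ⟨u, v, huv, c1, c2, c3, c4⟩ := w5 (s - 1) (by omega) (by omega)
  rw [opt_of_ne_zero (by omega)] at c2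
  rw [Nat.sub_add_cancel (by omega), opt_of_ne_zero hs0] at c4
  have h1 := adj_lab hn (d.pos _) (d.pos _) (d.adjG _ _ huv)
  rw [d.fib v x (c4.trans hx.symm), hlx] at h1
  refine h ⟨u, s - 1, ?_, by omega, ?_, ?_⟩
  · rw [c2, hx]
  · rw [hx]; simp
  · unfold Adj₀ at h1; omega

end FactorData

namespace FactorData

variable {n : ℕ} {V : Type*} {E : V → V → Prop} {G f : V → ℕ × ℕ}

theorem core_col (d : FactorData n E G f) {r : V} (hr : f r = (0, 0)) (hl : lab n (G r) = 0)
    {x : V} (h : Core n G f x) (h3 : ¬ 3 ≤ (G x).2) : col n (G x) = (0, 0) := by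
  rcases col_eq_zero_or d.three_le (G x) with ⟨k, _⟩ | ⟨_, k, k'⟩
  · exact k
  · exact absurd (Prod.ext (k' (by omega)) (by simp only; omega)) (d.core_ne_z hr hl h)

/-- A core point that lies farthest on its arm. -/
def Far (n : ℕ) (G f : V → ℕ × ℕ) (b : ℕ) (x : V) : Prop :=
  Core n G f x ∧ (G x).1 = b ∧ 3 ≤ (G x).2 ∧
    ∀ y, Core n G f y → (G y).1 = b → 3 ≤ (G y).2 → (G y).2 ≤ (G x).2

theorem exists_far (d : FactorData n E G f) {x : V} (h : Core n G f x) (h3 : 3 ≤ (G x).2) :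
    ∃ y, Far n G f (G x).1 y := by
  -- Positions are bounded by the arm length; the induction is on the remaining distance to the tip.
  have hfin : ∀ N, (∃ y, Core n G f y ∧ (G y).1 = (G x).1 ∧ 3 ≤ (G y).2 ∧
      armLen n (G x).1 ≤ (G y).2 + N) → ∃ y, Far n G f (G x).1 y := by
    intro N
    induction N with
    | zero =>
      rintro ⟨y, y1, y2, y3, y4⟩
      refine ⟨y, y1, y2, y3, fun z _ hz _ => ?_⟩
      have := (d.pos z).1
      rw [hz] at this
      omega
    | succ N ih =>
      rintro ⟨y, y1, y2, y3, y4⟩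
      by_cases hm : ∀ z, Core n G f z → (G z).1 = (G x).1 → 3 ≤ (G z).2 → (G z).2 ≤ (G y).2
      · exact ⟨y, y1, y2, y3, hm⟩
      · push Not at hm
        obtain ⟨z, z1, z2, z3, z4⟩ := hm
        exact ih ⟨z, z1, z2, z3, by omega⟩
  exact hfin (armLen n (G x).1) ⟨x, h, rfl, h3, by omega⟩

theorem core_of_nbr (d : FactorData n E G f) {x y : V}
    (h : Core n G f x) (hxy : E x y) (hl : (G y).2 ≠ 1) : Core n G f y := by
  by_contra hy
  exact hl (snd_of_lab_eq_n_sub_one d.three_le (d.pos y)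
    (d.passed_boundary (d.symm _ _ hxy) hy h).1)

/-- Core points can be pushed outward along an arm of $X_1$ as long as lifts exist, so a farthest
one has label $n$ or $n+2$. It is therefore off the centre, and its class is unique by
`col_eq_first` at distance one and by `uniq_of_two_le` beyond. -/
theorem far_uniq (d : FactorData n E G f) {r : V} (hr : f r = (0, 0)) (hl : lab n (G r) = 0)
    {b : ℕ} {x : V} (h : Far n G f b x) : (f x).2 ≠ 0 ∧ Uniq n G f (f x) := by
  have hn := d.three_le
  obtain ⟨h1, h2, h3, h4⟩ := h
  have hroot : ∀ x, f x = (0, 0) → lab n (G x) = 0 := fun x hx => by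
    rw [d.fib x r (hx.trans hr.symm), hl]
  have hlab : lab n (G x) = n ∨ lab n (G x) = n + 2 := by
    have hup : Long n (G x).1 → ¬ (G x).2 ≤ 2 * n - 2 := by
      intro hL hk
      obtain ⟨y, hy, hy'⟩ := d.up x hL (by omega) hk
      have hc := d.core_of_nbr h1 hy (by omega)
      have := h4 y hc ((d.adjG x y hy).fst (by omega) (by omega) ▸ h2) (by omega)
      omega
    rcases pos_cases hn _ (d.pos x) with h' | h' | h' | h' | h' | h' | ⟨hl, h' | ⟨s, h'⟩ | h' | h'⟩ <;> try omega
    · exact absurd (by omega) (hup hl)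
    · exact absurd (by omega) (hup hl)
  have hs : (f x).2 ≠ 0 := by
    intro hs
    have := hroot x (by rw [d.f_eq_opt x, hs]; rfl)
    omega
  refine ⟨hs, ?_⟩
  by_cases h1 : (f x).2 = 1
  · have := d.lab_first hr hl h1
    intro y y' hy hy'
    exact d.col_eq_first hr hl (by rw [hy]; exact h1) (hy.trans hy'.symm)
      (by rw [d.fib y x hy]; omega)
  · exact d.uniq_of_two_le hr hl _ _ (by omega)

/-- Different arms of $X_1$ that the core enters have their farthest points on different arms of the
od. This is why rebuilding the core needs no additional arm. -/
theorem far_arm_eq (d : FactorData n E G f) {r : V} (hr : f r = (0, 0)) (hl : lab n (G r) = 0)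
    {b b' : ℕ} {x x' : V} (h : Far n G f b x) (h' : Far n G f b' x') (he : (f x).1 = (f x').1)
    (hle : (f x).2 ≤ (f x').2) : b = b' := by
  have hn := d.three_le
  obtain ⟨hs0, hU⟩ := d.far_uniq hr hl h
  obtain ⟨hs0', hU'⟩ := d.far_uniq hr hl h'
  have hroot : ∀ x, f x = (0, 0) → lab n (G x) = 0 := fun x hx => by
    rw [d.fib x r (hx.trans hr.symm), hl]
  obtain ⟨e, t, hx⟩ : ∃ e s, f x = (e, s) := ⟨_, _, rfl⟩
  obtain ⟨e', t', hx'⟩ : ∃ e s, f x' = (e, s) := ⟨_, _, rfl⟩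
  rw [hx] at hs0 hU
  rw [hx'] at hs0' hU'
  rw [hx, hx'] at he hle
  simp only at hs0 hs0' he hle
  subst he
  obtain ⟨w, C, w1, w3, w4, w5⟩ := d.exists_lift_one hr hx' hs0'
  have hv := fun i (hi : 1 ≤ i) (his : i ≤ t') => w5.exists_vertex w1 w3 hi his
  have hCt : C t = G x := by
    obtain ⟨u, u1, u2⟩ := hv t (by omega) hle
    rw [← u2, hU u x u1 hx, col_of_snd_ge h.2.2.1]
  have hCt' : C t' = G x' := by rw [w4, col_of_snd_ge h'.2.2.1]
  -- Between the two points the lift avoids the central class: a central vertex labelled $0$ has a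
  -- neighbour labelled $n-1$, and that neighbour would lie in the core of $x'$. Hence the lift
  -- cannot change its arm of $X_1$.
  have hnc : ∀ i, t ≤ i → i ≤ t' → 3 ≤ (C i).2 := by
    intro i hi hi'
    rcases hi.eq_or_lt with rfl | hi
    · rw [hCt]; exact h.2.2.1
    rcases hi'.eq_or_lt with rfl | hi'
    · rw [hCt']; exact h'.2.2.1
    by_contra hlt
    obtain ⟨u, u1, u2⟩ := hv i (by omega) (by omega)
    have hcu : Core n G f u := h'.1.mono hx' u1 (by omega)
    have hlu : lab n (G u) = 0 := by
      have h3 : ¬ 3 ≤ (G u).2 := fun hh => hlt (by rw [← u2, col_of_snd_ge hh]; exact hh)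
      have := d.core_lab_ne hroot hcu
      have := d.core_ne_z hr hl hcu
      rcases pos_cases hn _ (d.pos u) with h' | h' | h' | h' | h' | h' | ⟨hl, h' | ⟨s, h'⟩ | h' | h'⟩ <;>
      first | omega | exact absurd (Prod.ext h'.1 h'.2.1) this
    rcases d.zero_cases hlu with ⟨a, m, hI⟩ | ⟨_, y, hy, hly⟩
    · have := hI.2.1
      rw [← u2, col_of_snd_ge (by rw [hI.2.2.2]; simp only; omega), hI.2.2.2] at hlt
      simp only at hlt; omega
    · refine d.core_lab_ne hroot (x := y) ?_ hly
      rcases d.f_nbr u1 (by omega) hy with k | k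
      · exact h'.1.mono hx' k (by omega)
      · rw [opt_of_ne_zero (by omega)] at k
        exact h'.1.mono hx' k (by omega)
  have harm : ∀ i, t ≤ i → i ≤ t' → (C i).1 = b := by
    intro i hi
    induction i, hi using Nat.le_induction with
    | base => intro _; rw [hCt]; exact h.2.1
    | succ i hi ih =>
      intro hi'
      obtain ⟨u, v, huv, c1, _, c3, _⟩ := w5 i (by omega) (by omega)
      have k := hnc i hi (by omega)
      have k' := hnc (i + 1) (by omega) hi'
      have big : ∀ y : V, 3 ≤ (col n (G y)).2 → col n (G y) = G y := by
        intro y hy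
        rcases col_eq_zero_or hn (G y) with ⟨q, _⟩ | ⟨q, _⟩
        · rw [q] at hy; simp at hy
        · exact q
      rw [← c1] at k
      rw [← c3] at k'
      have e1 := big u k
      have e2 := big v k'
      rw [e1] at k c1
      rw [e2] at k' c3
      rw [← ih (by omega), ← c3, ← c1]
      exact ((d.adjG u v huv).fst (by omega) (by omega)).symm
  rw [← harm t' hle le_rfl, hCt']
  exact h'.2.1

/-! ### Rebuilding the small od -/

/-- The conclusion of the factorization step. -/
def Conclusion (n : ℕ) (E : V → V → Prop) (G : V → ℕ × ℕ) : Prop :=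
  ∃ f' : V → ℕ × ℕ, (∀ x, (f' x).1 < n - 1) ∧ (∀ x, (f' x).2 = 0 → (f' x).1 = 0) ∧
    (∀ x y, E x y → OAdj (f' x) (f' y) ∨ f' x = f' y) ∧
    ∀ x y, f' x = f' y → col n (G x) = col n (G y)

theorem opt_inj {e e' s s' : ℕ} (h : opt e s = opt e' s') : s = s' ∧ (s ≠ 0 → e = e') := by
  have hs : s = s' := by simpa only [opt_snd] using congrArg Prod.snd h
  subst hs
  refine ⟨rfl, fun h0 => ?_⟩
  rw [opt_of_ne_zero h0, opt_of_ne_zero h0] at h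
  exact congrArg Prod.fst h

theorem opt_adj (e s : ℕ) : OAdj (opt e s) (opt e (s + 1)) := by
  left
  rw [opt_snd, opt_snd]
  refine ⟨rfl, ?_⟩
  by_cases h : s = 0
  · exact Or.inl h
  · right; rw [opt_of_ne_zero h, opt_of_ne_zero (by omega)]

/-- The core of the od is replaced by its image under `col` after $G$. Each arm $b$ of this image is
laid on the od arm that contains the farthest core point `X b`, and the rest of that od arm, from `X
b` on, is attached at its end. An od arm without such a point is cut at its first vertex labelled
$n-1$, which belongs to the central class, and reattached at the centre. -/
theorem conclusion_of_root_eq (d : FactorData n E G f) {r : V} (hr : f r = (0, 0))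
    (hl : lab n (G r) = 0) : Conclusion n E G := by
  classical
  have hn := d.three_le
  have hroot : ∀ x, f x = (0, 0) → lab n (G x) = 0 := fun x hx => by
    rw [d.fib x r (hx.trans hr.symm), hl]
  let X : ℕ → V := fun b => if h : ∃ x, Far n G f b x then h.choose else r
  have hX : ∀ b, (∃ x, Far n G f b x) → Far n G f b (X b) := fun b h => by
    simp only [X]; rw [dif_pos h]; exact h.choose_spec
  -- The points at or beyond a farthest core point on their od arm. The default `r` in `X` never
  -- matters: `X b` is used only when a farthest point exists, or at distance $0$, where `opt`
  -- forgets the arm.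
  let P : V → Prop := fun x => ∃ b, Far n G f b (X b) ∧ (f (X b)).1 = (f x).1 ∧ (f (X b)).2 ≤ (f x).2
  have binj : ∀ b b', Far n G f b (X b) → Far n G f b' (X b') → (f (X b)).1 = (f (X b')).1 → b = b' := by
    intro b b' h h' he
    rcases le_total (f (X b)).2 (f (X b')).2 with hle | hle
    · exact d.far_arm_eq hr hl h h' he hle
    · exact (d.far_arm_eq hr hl h' h he.symm hle).symm
  -- the three rules
  let B : V → ℕ := fun x => if h : P x then h.choose else 0
  have hB : ∀ x b, Far n G f b (X b) → (f (X b)).1 = (f x).1 → (f (X b)).2 ≤ (f x).2 → B x = b := by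
    intro x b h1 h2 h3
    have hP : P x := ⟨b, h1, h2, h3⟩
    have : B x = hP.choose := dif_pos hP
    rw [this]
    have hs := hP.choose_spec
    exact binj _ _ hs.1 h1 (hs.2.1.trans h2.symm)
  -- Distances in the core are counted from the collapsed component, which has radius $2$; hence the
  -- subtraction of $2$. The first rule is the translation of the old arm that gives `X b` the
  -- position assigned by the second.
  let F : V → ℕ × ℕ := fun x =>
    if P x then opt (f x).1 ((G (X (B x))).2 - 2 + ((f x).2 - (f (X (B x))).2))
    else if Core n G f x then
      opt (f (X (G x).1)).1 (if 3 ≤ (G x).2 then (G x).2 - 2 else 0)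
    else opt (f x).1 ((f x).2 - sInf {s | Passed n G f (f x).1 s})
  have F1 : ∀ x b, Far n G f b (X b) → (f (X b)).1 = (f x).1 → (f (X b)).2 ≤ (f x).2 →
      F x = opt (f x).1 ((G (X b)).2 - 2 + ((f x).2 - (f (X b)).2)) := by
    intro x b h1 h2 h3
    have hP : P x := ⟨b, h1, h2, h3⟩
    simp only [F]
    rw [if_pos hP, hB x b h1 h2 h3]
  have F3 : ∀ x, ¬ P x → Core n G f x → 3 ≤ (G x).2 →
      F x = opt (f (X (G x).1)).1 ((G x).2 - 2) ∧ Far n G f (G x).1 (X (G x).1) := by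
    intro x h1 h2 h3
    refine ⟨?_, hX _ (d.exists_far h2 h3)⟩
    simp only [F]; rw [if_neg h1, if_pos h2, if_pos h3]
  have F0 : ∀ x, ¬ P x → Core n G f x → ¬ 3 ≤ (G x).2 → F x = (0, 0) := by
    intro x h1 h2 h3
    simp only [F]; rw [if_neg h1, if_pos h2, if_neg h3]; rfl
  have F2 : ∀ x, ¬ P x → ¬ Core n G f x →
      F x = opt (f x).1 ((f x).2 - sInf {s | Passed n G f (f x).1 s}) := by
    intro x h1 h2
    simp only [F]; rw [if_neg h1, if_neg h2]
  have hpass : ∀ x, ¬ Core n G f x → sInf {s | Passed n G f (f x).1 s} ≤ (f x).2 ∧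
      1 ≤ sInf {s | Passed n G f (f x).1 s} ∧
      ((f x).2 = sInf {s | Passed n G f (f x).1 s} → lab n (G x) = n - 1) := by
    intro x hx
    rw [Core, not_not] at hx
    have hm := Nat.sInf_mem (s := {s | Passed n G f (f x).1 s}) ⟨_, hx⟩
    refine ⟨Nat.sInf_le hx, ?_, fun he => ?_⟩
    · obtain ⟨w, t, w1, w2, w3, w4⟩ := hm; omega
    · obtain ⟨w, t, w1, w2, w3, w4⟩ := hm
      have : sInf {s | Passed n G f (f x).1 s} ≤ t := Nat.sInf_le ⟨w, t, w1, w2, le_rfl, w4⟩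
      rw [← w4]
      refine d.fib _ _ ?_
      rw [w1]
      exact Prod.ext rfl (by simp only; omega)
  have harmlt : ∀ x, (F x).1 < n - 1 := by
    intro x
    have ho : ∀ e s, e < n - 1 → (opt e s).1 < n - 1 := by
      intro e s he
      unfold opt; split_ifs
      · simp only; omega
      · exact he
    simp only [F]
    split_ifs <;> exact ho _ _ (d.arm _)
  have hnorm : ∀ x, (F x).2 = 0 → (F x).1 = 0 := by
    have ho : ∀ e s, (opt e s).2 = 0 → (opt e s).1 = 0 := by
      intro e s; rw [opt_snd]; rintro rfl; rfl
    intro x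
    simp only [F]
    split_ifs <;> exact ho _ _
  -- values on both sides of an edge
  have adj13 : ∀ x y, E x y → P x → ¬ P y → OAdj (F y) (F x) := by
    rintro x y hxy ⟨b, hb, hb1, hb2⟩ hy
    have hU := d.far_uniq hr hl hb
    have hs0 : (f x).2 ≠ 0 := by omega
    have hlt : (f x).2 = (f (X b)).2 ∧ f y = opt (f x).1 ((f x).2 - 1) := by
      rcases d.f_nbr (e := (f x).1) (s := (f x).2) rfl hs0 hxy with k | k
      · exact absurd ⟨b, hb, by rw [k]; exact hb1, by rw [k]; simp only; omega⟩ hy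
      · refine ⟨?_, k⟩
        by_contra hne
        refine hy ⟨b, hb, ?_, ?_⟩
        · rw [k, opt_of_ne_zero (by omega)]; exact hb1
        · rw [k, opt_snd]; omega
    have hfx : f x = f (X b) := Prod.ext hb1.symm hlt.1
    have hcx : Core n G f x := hb.1.mono (e := (f x).1) (s := (f (X b)).2) (Prod.ext hb1 rfl) rfl (by omega)
    have hcy : Core n G f y := by
      by_cases hz : (f x).2 - 1 = 0
      · rintro ⟨w, t, w1, w2, w3, _⟩
        rw [hlt.2, hz] at w3; simp only [opt] at w3; simp at w3; omega
      · rw [opt_of_ne_zero hz] at hlt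
        exact hcx.mono rfl hlt.2 (by omega)
    have hcol := hU.2 x (X b) hfx rfl
    rw [col_of_snd_ge hb.2.2.1] at hcol
    have hGx : G x = G (X b) := by
      rcases col_eq_zero_or hn (G x) with ⟨q, _⟩ | ⟨q, _⟩
      · have := hb.2.2.1
        rw [← hcol, q] at this; simp at this
      · rw [← q, hcol]
    have h3 := hb.2.2.1
    rw [← hGx] at h3
    have hGy : (G y).2 + 1 = (G x).2 := by
      rcases (d.adjG x y hxy).snd with q | q
      · have := hb.2.2.2 y hcy (by
          rw [← (d.adjG x y hxy).fst (by omega) (by omega), hGx]; exact hb.2.1) (by omega)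
        rw [hGx] at q; omega
      · omega
    have hFx : F x = opt (f x).1 ((G x).2 - 2) := by
      rw [F1 x b hb hb1 hb2, hlt.1, hGx]; simp
    by_cases hk : 3 ≤ (G y).2
    · obtain ⟨q1, q2⟩ := F3 y hy hcy hk
      have : (G y).1 = b := by
        rw [← (d.adjG x y hxy).fst (by omega) (by omega), hGx]; exact hb.2.1
      rw [q1, hFx, this, hb1, show (G x).2 - 2 = (G y).2 - 2 + 1 by omega]
      exact opt_adj _ _
    · rw [F0 y hy hcy hk, hFx, show (G x).2 - 2 = 0 + 1 by omega]
      exact opt_adj _ 0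
  have adj11 : ∀ x y, E x y → P x → P y → OAdj (F x) (F y) := by
    have key : ∀ x y, E x y → P x → P y → (f y).2 = (f x).2 + 1 → OAdj (F x) (F y) := by
      rintro x y hxy ⟨b, hb, hb1, hb2⟩ ⟨b', hb', hb1', hb2'⟩ h
      have hU := d.far_uniq hr hl hb
      have he : (f x).1 = (f y).1 := (d.adjf x y hxy).fst (by omega) (by omega)
      rw [F1 x b hb hb1 hb2, F1 y b hb (hb1.trans he) (by omega), ← he, h,
        show (G (X b)).2 - 2 + ((f x).2 + 1 - (f (X b)).2)
          = (G (X b)).2 - 2 + ((f x).2 - (f (X b)).2) + 1 by omega]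
      exact opt_adj _ _
    intro x y hxy hx hy
    rcases (d.adjf x y hxy).snd with h | h
    · exact key x y hxy hx hy h
    · exact (key y x (d.symm _ _ hxy) hy hx h).symm
  have adj23 : ∀ x y, E x y → ¬ P x → ¬ P y → ¬ Core n G f x → Core n G f y → F x = F y := by
    intro x y hxy hx hy hcx hcy
    obtain ⟨q1, q2, q3⟩ := d.passed_boundary hxy hcx hcy
    have k := snd_of_lab_eq_n_sub_one hn (d.pos x) q1
    have k' := (d.adjG x y hxy).snd
    rw [F2 x hx hcx, q3, F0 y hy hcy (by omega)]
    simp [opt]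
  have adj22 : ∀ x y, E x y → ¬ P x → ¬ P y → ¬ Core n G f x → ¬ Core n G f y →
      OAdj (F x) (F y) := by
    have key : ∀ x y, E x y → ¬ P x → ¬ P y → ¬ Core n G f x → ¬ Core n G f y →
        (f y).2 = (f x).2 + 1 → OAdj (F x) (F y) := by
      intro x y hxy hx hy hcx hcy h
      have p := hpass x hcx
      have he : (f x).1 = (f y).1 := (d.adjf x y hxy).fst (by omega) (by omega)
      rw [F2 x hx hcx, F2 y hy hcy, ← he, h, Nat.succ_sub (by omega)]
      exact opt_adj _ _
    intro x y hxy hx hy hcx hcy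
    rcases (d.adjf x y hxy).snd with h | h
    · exact key x y hxy hx hy hcx hcy h
    · exact (key y x (d.symm _ _ hxy) hy hx hcy hcx h).symm
  have adj33 : ∀ x y, E x y → ¬ P x → ¬ P y → Core n G f x → Core n G f y →
      OAdj (F x) (F y) ∨ F x = F y := by
    have key : ∀ x y, E x y → ¬ P x → ¬ P y → Core n G f x → Core n G f y →
        (G y).2 = (G x).2 + 1 → OAdj (F x) (F y) ∨ F x = F y := by
      intro x y hxy hx hy hcx hcy h
      by_cases h1 : 3 ≤ (G x).2
      · left
        rw [(F3 x hx hcx h1).1, (F3 y hy hcy (by omega)).1,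
          (d.adjG x y hxy).fst (by omega) (by omega),
          show (G y).2 - 2 = (G x).2 - 2 + 1 by omega]
        exact opt_adj _ _
      · by_cases h2 : 3 ≤ (G y).2
        · left
          rw [F0 x hx hcx h1, (F3 y hy hcy h2).1, show (G y).2 - 2 = 0 + 1 by omega]
          exact opt_adj _ 0
        · right
          rw [F0 x hx hcx h1, F0 y hy hcy h2]
    intro x y hxy hx hy hcx hcy
    rcases (d.adjG x y hxy).snd with h | h
    · exact key x y hxy hx hy hcx hcy h
    · exact (key y x (d.symm _ _ hxy) hy hx hcy hcx h).imp OAdj.symm Eq.symm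
  refine ⟨F, harmlt, hnorm, fun x y hxy => ?_, ?_⟩
  · by_cases hx : P x <;> by_cases hy : P y
    · exact Or.inl (adj11 x y hxy hx hy)
    · exact Or.inl (adj13 x y hxy hx hy).symm
    · exact Or.inl (adj13 y x (d.symm _ _ hxy) hy hx)
    · by_cases hcx : Core n G f x <;> by_cases hcy : Core n G f y
      · exact adj33 x y hxy hx hy hcx hcy
      · exact Or.inr (adj23 y x (d.symm _ _ hxy) hy hx hcy hcx).symm
      · exact Or.inr (adj23 x y hxy hx hy hcx hcy)
      · exact Or.inl (adj22 x y hxy hx hy hcx hcy)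
  · -- the fibres
    have fpos : ∀ b, Far n G f b (X b) → (f (X b)).2 ≠ 0 := fun b hb => (d.far_uniq hr hl hb).1
    have ctr : ∀ x, ¬ P x → F x = (0, 0) → col n (G x) = (0, 0) := by
      intro x hx h0
      have hz : (F x).2 = 0 := by rw [h0]
      by_cases hc : Core n G f x
      · refine d.core_col hr hl hc fun h3 => ?_
        rw [(F3 x hx hc h3).1, opt_snd] at hz
        omega
      · rw [F2 x hx hc, opt_snd] at hz
        have := hpass x hc
        exact col_eq_of_lab_b hn (d.pos x) (this.2.2 (by omega))
    have P0 : ∀ x, P x → F x ≠ (0, 0) := by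
      rintro x ⟨b, hb, hb1, hb2⟩ h0
      have hz : (F x).2 = 0 := by rw [h0]
      rw [F1 x b hb hb1 hb2, opt_snd] at hz
      have := hb.2.2.1
      omega
    -- Positions given by the first rule are at least that of the farthest point, core positions on
    -- the same arm at most that; they meet only over `X b`. A point outside the core cannot precede
    -- `X b`, since the core is an initial interval.
    have PN : ∀ x y, P x → ¬ P y → F x = F y → col n (G x) = col n (G y) := by
      rintro x y hx hy he
      have hy0 : F y ≠ (0, 0) := he ▸ P0 x hx
      obtain ⟨b, hb, hb1, hb2⟩ := hx
      rw [F1 x b hb hb1 hb2] at he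
      have h3 := hb.2.2.1
      by_cases hc : Core n G f y
      · have k3 : 3 ≤ (G y).2 := by
          by_contra k3
          exact hy0 (F0 y hy hc k3)
        obtain ⟨q1, q2⟩ := F3 y hy hc k3
        rw [q1] at he
        obtain ⟨e1, e2⟩ := opt_inj he
        have e3 := e2 (by omega)
        have hbb := binj b (G y).1 hb q2 (hb1.trans e3)
        have hk := hb.2.2.2 y hc hbb.symm k3
        have hfx : f x = f (X b) := Prod.ext hb1.symm (by omega)
        rw [(d.far_uniq hr hl hb).2 x (X b) hfx rfl]
        congr 1
        exact Prod.ext (by rw [hb.2.1, hbb]) (by omega)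
      · exfalso
        rw [F2 y hy hc] at he
        obtain ⟨e1, e2⟩ := opt_inj he
        have e3 := e2 (by omega)
        have hyc : (f y).2 < (f (X b)).2 := by
          by_contra hh
          exact hy ⟨b, hb, hb1.trans e3, by omega⟩
        exact hc (hb.1.mono (e := (f y).1) (s := (f (X b)).2) (Prod.ext (hb1.trans e3) rfl) rfl (by omega))
    intro x y he
    by_cases hx : P x <;> by_cases hy : P y
    · obtain ⟨b, hb, hb1, hb2⟩ := hx
      obtain ⟨b', hb', hb1', hb2'⟩ := hy
      have hb0 := fpos b hb
      have h3 := hb.2.2.1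
      have h3' := hb'.2.2.1
      rw [F1 x b hb hb1 hb2, F1 y b' hb' hb1' hb2'] at he
      obtain ⟨e1, e2⟩ := opt_inj he
      have e3 := e2 (by omega)
      obtain rfl := binj b b' hb hb' (hb1.trans (e3.trans hb1'.symm))
      have hf : f x = f y := Prod.ext e3 (by omega)
      by_cases hs : (f x).2 = (f (X b)).2
      · have : f x = f (X b) := Prod.ext hb1.symm hs
        exact (d.far_uniq hr hl hb).2 x y this (hf.symm.trans this)
      · exact d.uniq_of_two_le hr hl (f x).1 (f x).2 (by omega) x y rfl hf.symm
    · exact PN x y hx hy he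
    · exact (PN y x hy hx he.symm).symm
    · by_cases h0 : F x = (0, 0)
      · rw [ctr x hx h0, ctr y hy (he ▸ h0)]
      have h0' : F y ≠ (0, 0) := he ▸ h0
      have hfar : ∀ x, ¬ P x → Core n G f x → F x ≠ (0, 0) → 3 ≤ (G x).2 := by
        intro x hx hc h0
        by_contra h3
        exact h0 (F0 x hx hc h3)
      have mixed : ∀ x y, ¬ P x → ¬ P y → Core n G f x → ¬ Core n G f y → F x = F y →
          F x ≠ (0, 0) → False := by
        intro x y hx hy hc hc' he h0
        have h3 := hfar x hx hc h0
        obtain ⟨q1, q2⟩ := F3 x hx hc h3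
        rw [q1, F2 y hy hc'] at he
        obtain ⟨e1, e2⟩ := opt_inj he
        have e3 := e2 (by omega)
        have hyc : (f y).2 < (f (X (G x).1)).2 := by
          by_contra hh
          exact hy ⟨_, q2, e3, by omega⟩
        exact hc' (q2.1.mono (e := (f y).1) (s := (f (X (G x).1)).2) (Prod.ext e3 rfl) rfl (by omega))
      by_cases hcx : Core n G f x <;> by_cases hcy : Core n G f y
      · have h3 := hfar x hx hcx h0
        have h3' := hfar y hy hcy h0'
        obtain ⟨q1, q2⟩ := F3 x hx hcx h3
        obtain ⟨q1', q2'⟩ := F3 y hy hcy h3'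
        rw [q1, q1'] at he
        obtain ⟨e1, e2⟩ := opt_inj he
        have e3 := binj _ _ q2 q2' (e2 (by omega))
        congr 1
        exact Prod.ext e3 (by omega)
      · exact (mixed x y hx hy hcx hcy he h0).elim
      · exact (mixed y x hy hx hcy hcx he.symm h0').elim
      · rw [F2 x hx hcx, F2 y hy hcy] at he
        have p := hpass x hcx
        have p' := hpass y hcy
        obtain ⟨e1, e2⟩ := opt_inj he
        have hne : (f x).2 - sInf {s | Passed n G f (f x).1 s} ≠ 0 := by
          intro hz
          exact h0 (by rw [F2 x hx hcx, hz]; rfl)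
        have e3 := e2 hne
        rw [← e3] at e1 p'
        exact d.uniq_of_two_le hr hl (f x).1 (f x).2 (by omega) x y rfl
          (Prod.ext e3.symm (by omega))

/-- The factorization step. -/
theorem conclusion (d : FactorData n E G f) [Nonempty V] : Conclusion n E G := by
  have hn := d.three_le
  have main : ∀ {f : V → ℕ × ℕ}, FactorData n E G f → (∃ r, f r = (0, 0)) → Conclusion n E G := by
    rintro f d ⟨r, hr⟩
    by_cases hl : lab n (G r) = 0
    · exact d.conclusion_of_root_eq hr hl
    · exact ⟨f, d.arm, d.norm, fun x y h => Or.inl (d.adjf x y h),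
        fun x y h => d.col_eq_of_root_ne hr hl h⟩
  by_cases h : ∃ r, f r = (0, 0)
  · exact main d h
  have hpos : ∀ x, (f x).2 ≠ 0 := fun x hx => h ⟨x, by rw [d.f_eq_opt x, hx]; rfl⟩
  obtain ⟨x₀⟩ := ‹Nonempty V›
  have harm : ∀ x, (f x).1 = (f x₀).1 := by
    intro x
    induction d.conn x₀ x with
    | refl => rfl
    | tail _ hxy ih => rw [← ih]; exact ((d.adjf _ _ hxy).fst (hpos _) (hpos _)).symm
  have hm := Nat.sInf_mem (s := Set.range fun x => (f x).2) ⟨_, x₀, rfl⟩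
  obtain ⟨r, hr⟩ := hm
  have hle : ∀ x, (f r).2 ≤ (f x).2 := fun x => by
    simp only at hr
    rw [hr]; exact Nat.sInf_le ⟨x, rfl⟩
  -- If the centre is not attained, the image lies in a single arm and can be translated until its
  -- lowest point is the centre.
  refine main (f := fun x => opt (f x).1 ((f x).2 - (f r).2)) { d with
    arm := ?_, norm := ?_, adjf := ?_, fib := ?_ } ⟨r, by simp [opt]⟩
  · intro x
    have := d.arm x
    simp only [opt]; split_ifs
    · simp only; omega
    · exact this
  · intro x
    simp only [opt_snd]
    intro h; rw [h]; rfl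
  · have key : ∀ x y, (f y).2 = (f x).2 + 1 →
        OAdj (opt (f x).1 ((f x).2 - (f r).2)) (opt (f y).1 ((f y).2 - (f r).2)) := by
      intro x y h
      have := hle x
      rw [harm x, harm y, h, Nat.succ_sub this]
      exact opt_adj _ _
    intro x y hxy
    rcases (d.adjf x y hxy).snd with h | h
    · exact key x y h
    · exact (key y x h).symm
  · intro x y he
    have e1 := (opt_inj he).1
    have := hle x
    have := hle y
    exact d.fib x y (Prod.ext ((harm x).trans (harm y).symm) (by omega))

end FactorData

/-! ### Contraction of the od along the fibres of a labelling -/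

/-- The number of changes of the label on arm `e`, up to distance `s`. -/
def changes (h : ℕ × ℕ → ℕ) (e : ℕ) : ℕ → ℕ
  | 0 => 0
  | s + 1 => changes h e s + if h (opt e s) = h (opt e (s + 1)) then 0 else 1

/-- Contraction of the intervals on which the label is constant. -/
def contract (h : ℕ × ℕ → ℕ) (y : ℕ × ℕ) : ℕ × ℕ := opt y.1 (changes h y.1 y.2)

theorem changes_mono (h : ℕ × ℕ → ℕ) (e : ℕ) : Monotone (changes h e) :=
  monotone_nat_of_le_succ fun s => by rw [changes]; omega

theorem label_eq_of_changes_eq {h : ℕ × ℕ → ℕ} {e s t : ℕ} (hst : s ≤ t)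
    (he : changes h e s = changes h e t) : h (opt e s) = h (opt e t) := by
  induction t, hst using Nat.le_induction with
  | base => rfl
  | succ t hst ih =>
    have h1 := changes_mono h e hst
    have h2 : changes h e (t + 1) =
      changes h e t + if h (opt e t) = h (opt e (t + 1)) then 0 else 1 := rfl
    split_ifs at h2 with h3
    · rw [ih (by omega), h3]
    · omega

theorem contract_step {h : ℕ × ℕ → ℕ} (e s : ℕ) :
    (h (opt e s) = h (opt e (s + 1)) → contract h (opt e s) = contract h (opt e (s + 1))) ∧
    (h (opt e s) ≠ h (opt e (s + 1)) → OAdj (contract h (opt e s)) (contract h (opt e (s + 1)))) := by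
  have h1 : contract h (opt e s) = opt e (changes h e s) := by
    by_cases hs : s = 0
    · subst hs; rfl
    · rw [opt_of_ne_zero hs]; rfl
  have h2 : contract h (opt e (s + 1)) = opt e (changes h e (s + 1)) := by
    rw [opt_of_ne_zero (by omega)]; rfl
  rw [h1, h2, changes]
  refine ⟨fun hh => ?_, fun hh => ?_⟩
  · rw [if_pos hh, Nat.add_zero]
  · rw [if_neg hh]; exact FactorData.opt_adj _ _

/-- With no change of label both points have the label of the centre. Otherwise they lie on one arm
with equal numbers of changes, so no change occurs between them. -/
theorem label_eq_of_contract_eq {h : ℕ × ℕ → ℕ} {y y' : ℕ × ℕ} (hy : y.2 = 0 → y.1 = 0)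
    (hy' : y'.2 = 0 → y'.1 = 0) (he : contract h y = contract h y') : h y = h y' := by
  have key : ∀ y : ℕ × ℕ, (y.2 = 0 → y.1 = 0) → y = opt y.1 y.2 := by
    intro y hy
    unfold opt; split_ifs with k
    · exact Prod.ext (hy k) k
    · rfl
  obtain ⟨h1, h2⟩ := FactorData.opt_inj he
  rw [key y hy, key y' hy']
  by_cases h0 : changes h y.1 y.2 = 0
  · rw [← label_eq_of_changes_eq (h := h) (e := y.1) (Nat.zero_le y.2) (by rw [h0]; rfl),
      ← label_eq_of_changes_eq (h := h) (e := y'.1) (Nat.zero_le y'.2) (by rw [← h1, h0]; rfl)]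
    simp [opt]
  · rw [← h2 h0] at h1 ⊢
    rcases le_total y.2 y'.2 with k | k
    · exact label_eq_of_changes_eq k h1
    · exact (label_eq_of_changes_eq k h1.symm).symm

theorem norm_opt (e s : ℕ) : (opt e s).2 = 0 → (opt e s).1 = 0 := by
  rw [opt_snd]; rintro rfl; rfl

theorem opt_fst_lt {e s N : ℕ} (h : e < N) : (opt e s).1 < N := by
  unfold opt; split_ifs
  · exact Nat.zero_lt_of_lt h
  · exact h

theorem oadj_cases {x y : ℕ × ℕ} (hx : x.2 = 0 → x.1 = 0) (hy : y.2 = 0 → y.1 = 0)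
    (h : OAdj x y) :
    (∃ e s, x = opt e s ∧ y = opt e (s + 1)) ∨ (∃ e s, x = opt e (s + 1) ∧ y = opt e s) := by
  have key : ∀ {x y : ℕ × ℕ}, (x.2 = 0 → x.1 = 0) → y.2 = x.2 + 1 → (x.2 = 0 ∨ x.1 = y.1) →
      ∃ e s, x = opt e s ∧ y = opt e (s + 1) := by
    intro x y hx h1 h2
    refine ⟨y.1, x.2, ?_, ?_⟩
    · by_cases h0 : x.2 = 0
      · rw [h0]; exact Prod.ext (hx h0) h0
      · rw [opt_of_ne_zero h0]; exact Prod.ext (h2.resolve_left h0) rfl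
    · rw [opt_of_ne_zero (by omega)]; exact Prod.ext rfl h1
  rcases h with ⟨h1, h2⟩ | ⟨h1, h2⟩
  · exact Or.inl (key hx h1 h2)
  · obtain ⟨e, s, k1, k2⟩ := key hy h1 (h2.imp id Eq.symm)
    exact Or.inr ⟨e, s, k2, k1⟩

theorem contract_adj {h : ℕ × ℕ → ℕ} {x y : ℕ × ℕ} (hx : x.2 = 0 → x.1 = 0)
    (hy : y.2 = 0 → y.1 = 0) (hxy : OAdj x y) :
    (h x = h y → contract h x = contract h y) ∧
    (h x ≠ h y → OAdj (contract h x) (contract h y)) := by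
  rcases oadj_cases hx hy hxy with ⟨e, s, rfl, rfl⟩ | ⟨e, s, rfl, rfl⟩
  · exact contract_step e s
  · have := contract_step (h := h) e s
    exact ⟨fun k => (this.1 k.symm).symm, fun k => (this.2 (Ne.symm k)).symm⟩

/-! ### Vertices of `X₁` as points -/

/-- The point with given arm and distance from the centre. -/
def pt (n : ℕ) (x : ℕ × ℕ) : Fin n → ℝ := fun i => if (i : ℕ) + 1 = x.1 then (x.2 : ℝ) else 0

theorem vertex_eq_pt (n a : ℕ) : vertex n a = pt n (vertexArm n a, vertexDist n a) := rfl

theorem pt_eq_armPoint (n : ℕ) (i : Fin n) (k : ℕ) : pt n (i + 1, k) = armPoint n i k := by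
  funext j
  simp [pt, armPoint, Pi.single_apply, Fin.ext_iff]

theorem pt_zero {n : ℕ} {x : ℕ × ℕ} (h : x.2 = 0) : pt n x = 0 := by
  funext j
  simp [pt, h]

theorem pt_inj {n : ℕ} {x y : ℕ × ℕ} (hx : IsPos n x) (hy : IsPos n y) (h : pt n x = pt n y) :
    x.2 = y.2 ∧ (x.2 ≠ 0 → x.1 = y.1) := by
  have key : ∀ {x y : ℕ × ℕ}, IsPos n x → pt n x = pt n y → x.2 ≠ 0 → x.1 = y.1 ∧ x.2 = y.2 := by
    intro x y hx h h0
    have h1 := hx.2 h0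
    have := congrFun h ⟨x.1 - 1, by omega⟩
    simp only [pt] at this
    rw [if_pos (by omega)] at this
    split_ifs at this with h2
    · exact ⟨by omega, by exact_mod_cast this⟩
    · exact absurd (by exact_mod_cast this) h0
  by_cases h0 : x.2 = 0
  · refine ⟨?_, fun h => absurd h0 h⟩
    by_contra hne
    have := (key hy h.symm (by omega)).2
    omega
  · exact ⟨(key hx h h0).2, fun _ => (key hx h h0).1⟩

/-- At $t=1$ the floor jumps to $k+1$, and both descriptions give the common end vertex. -/
theorem phiArm_add {n a k : ℕ} {t : ℝ} (h0 : 0 ≤ t) (h1 : t ≤ 1) :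
    phiArm n a (k + t) =
      AffineMap.lineMap (vertex n (phiVertex n a k)) (vertex n (phiVertex n a (k + 1))) t := by
  rcases h1.lt_or_eq with h1 | rfl
  · have : ⌊(k : ℝ) + t⌋₊ = k := by
      rw [Nat.floor_eq_iff (by positivity)]
      constructor <;> linarith
    unfold phiArm
    rw [this, add_sub_cancel_left]
  · have : ⌊(k : ℝ) + 1⌋₊ = k + 1 := by exact_mod_cast Nat.floor_natCast (R := ℝ) (k + 1)
    unfold phiArm
    rw [this]
    simp

theorem lineMap_armPoint {n : ℕ} (i : Fin n) (s s' t : ℝ) :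
    AffineMap.lineMap (armPoint n i s) (armPoint n i s') t =
      armPoint n i (AffineMap.lineMap s s' t) := by
  funext j
  by_cases h : j = i
  · subst h; simp [AffineMap.lineMap_apply_module, armPoint]
  · simp [AffineMap.lineMap_apply_module, armPoint, Pi.single_eq_of_ne h]

theorem phi_lineMap_pt {n : ℕ} (hn : 3 ≤ n) {p q : ℕ × ℕ} (hp : IsPos n p) (hq : IsPos n q)
    (h : OAdj p q) {t : ℝ} (h0 : 0 ≤ t) (h1 : t ≤ 1) :
    phi n (AffineMap.lineMap (pt n p) (pt n q) t) =
      AffineMap.lineMap (vertex n (lab n p)) (vertex n (lab n q)) t := by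
  have key : ∀ {p q : ℕ × ℕ}, IsPos n q → q.2 = p.2 + 1 → (p.2 = 0 ∨ p.1 = q.1) →
      ∀ {t : ℝ}, 0 ≤ t → t ≤ 1 → phi n (AffineMap.lineMap (pt n p) (pt n q) t) =
      AffineMap.lineMap (vertex n (lab n p)) (vertex n (lab n q)) t := by
    intro p q hq hpq hpq' t h0 h1
    have hb := hq.2 (by omega)
    obtain ⟨i, hi⟩ : ∃ i : Fin n, (i : ℕ) + 1 = q.1 := ⟨⟨q.1 - 1, by omega⟩, by simp only; omega⟩
    have e1 : pt n p = armPoint n i p.2 := by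
      rw [← pt_eq_armPoint]
      rcases hpq' with h | h
      · rw [pt_zero h, pt_zero (x := ((i : ℕ) + 1, p.2)) h]
      · rw [hi, ← h]
    have e2 : pt n q = armPoint n i (p.2 + 1 : ℕ) := by
      rw [← pt_eq_armPoint, hi, ← hpq]
    have e3 : lab n p = phiVertex n (i + 1) p.2 := by
      rcases hpq' with h | h
      · rw [lab_zero hn p h, h, phiVertex_zero n hn]
      · rw [hi, ← h]; rfl
    have e4 : lab n q = phiVertex n (i + 1) (p.2 + 1) := by
      rw [hi, ← hpq]; rfl
    rw [e1, e2, e3, e4, lineMap_armPoint, phi_armPoint n hn, ← phiArm_add h0 h1]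
    congr 1
    rw [AffineMap.lineMap_apply_module]
    push_cast; simp only [smul_eq_mul]; ring
  rcases h with ⟨h2, h3⟩ | ⟨h2, h3⟩
  · exact key hq h2 h3 h0 h1
  · rw [← AffineMap.lineMap_apply_one_sub (pt n q), ← AffineMap.lineMap_apply_one_sub (vertex n (lab n q))]
    exact key hp h2 (h3.imp id Eq.symm) (by linarith) (by linarith)

theorem phi_pt {n : ℕ} (hn : 3 ≤ n) {p : ℕ × ℕ} (hp : IsPos n p) :
    phi n (pt n p) = vertex n (lab n p) := by
  by_cases h0 : p.2 = 0
  · have hq : IsPos n (1, 1) := ⟨by simp only [armLen]; split_ifs <;> omega, fun _ => by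
      simp only; omega⟩
    have := phi_lineMap_pt hn hp hq (Or.inl ⟨by simp only; omega, Or.inl h0⟩) le_rfl zero_le_one
    simpa using this
  · have hq : IsPos n (p.1, p.2 - 1) := ⟨by have := hp.1; simp only; omega, fun _ => hp.2 h0⟩
    have := phi_lineMap_pt hn hp hq (Or.inr ⟨by simp only; omega, Or.inr rfl⟩) le_rfl zero_le_one
    simpa using this

theorem isPos_vertex {n : ℕ} (hn : 3 ≤ n) {a : ℕ} (ha : a ≤ n + 2) :
    IsPos n (vertexArm n a, vertexDist n a) := by
  refine ⟨vertexDist_le n hn a, fun h => ?_⟩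
  simp only at h ⊢
  have : a ≠ 0 := by rintro rfl; simp [vertexDist] at h
  unfold vertexArm
  split_ifs <;> omega

theorem vertex_inj {n : ℕ} (hn : 3 ≤ n) {a b : ℕ} (ha : a ≤ n + 2) (hb : b ≤ n + 2)
    (h : vertex n a = vertex n b) : a = b := by
  obtain ⟨h1, h2⟩ := pt_inj (isPos_vertex hn ha) (isPos_vertex hn hb) h
  simp only [vertexDist, vertexArm, armLen] at h1 h2
  split_ifs at h1 h2 <;> omega

theorem Adj₀.le {n a b : ℕ} (hn : 3 ≤ n) (h : Adj₀ n a b) : a ≤ n + 2 ∧ b ≤ n + 2 := by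
  unfold Adj₀ at h; omega

theorem lab_le {n : ℕ} (hn : 3 ≤ n) {x : ℕ × ℕ} (hx : IsPos n x) : lab n x ≤ n + 2 := by
  rcases pos_cases hn x hx with h' | h' | h' | h' | h' | h' | ⟨hl, h' | ⟨s, h'⟩ | h' | h'⟩ <;> try omega
  have := start_bounds hn hl
  obtain ⟨_, _, _, h4⟩ := h'
  split_ifs at h4 <;> omega


/-! ### Iterated subdivisions -/

/-- The edges of the `j`-th subdivision, the preimage of the graph structure `X₀` under the `j`-th
iterate of the bonding map. -/
def SubEdge (n : ℕ) : ℕ → (Fin n → ℝ) → (Fin n → ℝ) → Prop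
  | 0, x, y => ∃ a b, Adj₀ n a b ∧ x = vertex n a ∧ y = vertex n b
  | j + 1, z, z' => ∃ x x', SubEdge n j x x' ∧ z ∈ segment ℝ x x' ∧ z' ∈ segment ℝ x x' ∧
      ∃ p q, IsPos n p ∧ IsPos n q ∧ OAdj p q ∧ (phi n)^[j] z = pt n p ∧ (phi n)^[j] z' = pt n q

theorem SubEdge.symm {n j : ℕ} {x y : Fin n → ℝ} (h : SubEdge n j x y) : SubEdge n j y x := by
  cases j with
  | zero =>
    obtain ⟨a, b, h1, h2, h3⟩ := h
    exact ⟨b, a, h1.symm, h3, h2⟩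
  | succ j =>
    obtain ⟨u, v, h1, h2, h3, p, q, hp, hq, hpq, h4, h5⟩ := h
    exact ⟨u, v, h1, h3, h2, q, p, hq, hp, hpq.symm, h5, h4⟩

theorem segment_eq_image_lineMap' {n : ℕ} {x y z : Fin n → ℝ} (h : z ∈ segment ℝ x y) :
    ∃ t : ℝ, 0 ≤ t ∧ t ≤ 1 ∧ z = AffineMap.lineMap x y t := by
  rw [segment_eq_image_lineMap] at h
  obtain ⟨t, ht, rfl⟩ := h
  exact ⟨t, ht.1, ht.2, rfl⟩

theorem lineMap_lineMap {n : ℕ} (x y : Fin n → ℝ) (s s' t : ℝ) :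
    AffineMap.lineMap (AffineMap.lineMap x y s) (AffineMap.lineMap x y s') t =
      AffineMap.lineMap x y (AffineMap.lineMap s s' t) :=
  ((AffineMap.lineMap x y).apply_lineMap s s' t).symm

theorem lineMap_bounds {s s' t : ℝ} (h0 : 0 ≤ s) (h1 : s ≤ 1) (h0' : 0 ≤ s') (h1' : s' ≤ 1)
    (ht : 0 ≤ t) (ht' : t ≤ 1) : 0 ≤ AffineMap.lineMap s s' t ∧ AffineMap.lineMap s s' t ≤ 1 := by
  rw [AffineMap.lineMap_apply_module]
  simp only [smul_eq_mul]
  constructor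
  · have := mul_nonneg (sub_nonneg.2 ht') h0
    have := mul_nonneg ht h0'
    linarith
  · nlinarith [mul_nonneg (sub_nonneg.2 ht') (sub_nonneg.2 h1), mul_nonneg ht (sub_nonneg.2 h1')]

/-- The iterate of the bonding map is linear on the edges, and maps them onto edges of `X₀`. -/
theorem SubEdge.linear {n j : ℕ} (hn : 3 ≤ n) {x y : Fin n → ℝ} (h : SubEdge n j x y) :
    ∃ a b, Adj₀ n a b ∧ ∀ t : ℝ, 0 ≤ t → t ≤ 1 → (phi n)^[j] (AffineMap.lineMap x y t) =
      AffineMap.lineMap (vertex n a) (vertex n b) t := by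
  induction j generalizing x y with
  | zero =>
    obtain ⟨a, b, h1, rfl, rfl⟩ := h
    exact ⟨a, b, h1, fun t _ _ => rfl⟩
  | succ j ih =>
    obtain ⟨u, v, h1, h2, h3, p, q, hp, hq, hpq, h4, h5⟩ := h
    obtain ⟨a, b, _, hl⟩ := ih h1
    obtain ⟨s, s0, s1, rfl⟩ := segment_eq_image_lineMap' h2
    obtain ⟨s', s0', s1', rfl⟩ := segment_eq_image_lineMap' h3
    refine ⟨lab n p, lab n q, adj_lab hn hp hq hpq, fun t t0 t1 => ?_⟩
    have hb := lineMap_bounds s0 s1 s0' s1' t0 t1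
    rw [hl s s0 s1] at h4
    rw [hl s' s0' s1'] at h5
    rw [lineMap_lineMap, Function.iterate_succ_apply', hl _ hb.1 hb.2, ← lineMap_lineMap, h4, h5,
      phi_lineMap_pt hn hp hq hpq t0 t1]

/-- The vertex of `X₀` towards which a class of vertices of `X₁` is pushed. -/
def cellVertex (n : ℕ) (x : ℕ × ℕ) : ℕ :=
  if x.2 = 0 then 0
  else if x.1 = n - 1 then (if x.2 ≤ 3 then n - 1 else n + 1)
  else if x.1 = n then (if x.2 ≤ 2 * n - 1 then n else n + 2)
  else x.1

/-- The edge of `X₀` between `v_a` and `v_b` is the part of arm `A` between the positions `k`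
and `l`. -/
structure OutEdge₀ (n a b A k l : ℕ) : Prop where
  one_le : 1 ≤ A
  le : A ≤ n
  lt : k < l
  le_len : l ≤ armLen n A
  adj : Adj₀ n a b
  fst : vertex n a = pt n (A, k)
  snd : vertex n b = pt n (A, l)
  cell : ∃ c, k < c ∧ c ≤ l ∧ ∀ m, k ≤ m → m ≤ l →
    cellVertex n (col n (A, m)) = if m < c then a else b
  inner : k ≠ 0 → a = n - 1 ∨ a = n
  outer : Long n A → 2 * n - 1 ≤ l

theorem exists_outEdge₀ {n a b : ℕ} (hn : 3 ≤ n) (h : Adj₀ n a b) :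
    ∃ A k l, OutEdge₀ n a b A k l ∨ OutEdge₀ n b a A k l := by
  have key : ∀ a b : ℕ, ((a = 0 ∧ 1 ≤ b ∧ b ≤ n) ∨ (a = n - 1 ∧ b = n + 1) ∨ (a = n ∧ b = n + 2)) →
      ∃ A k l, OutEdge₀ n a b A k l := by
    intro a b h
    have mk : ∀ A k l c, A = vertexArm n b → l = vertexDist n b → k = vertexDist n a →
        (a = 0 ∨ A = vertexArm n a) → 1 ≤ A → A ≤ n → k < l → l ≤ armLen n A → k < c → c ≤ l →
        (∀ m, k ≤ m → m ≤ l → cellVertex n (col n (A, m)) = if m < c then a else b) →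
        (k ≠ 0 → a = n - 1 ∨ a = n) → (Long n A → 2 * n - 1 ≤ l) → OutEdge₀ n a b A k l := by
      intro A k l c h1 h2 h3 h4 h5 h6 h7 h8 h9 h10 h11 h12 h13
      refine ⟨h5, h6, h7, h8, Or.inl h, ?_, ?_, ⟨c, h9, h10, h11⟩, h12, h13⟩
      · rw [vertex_eq_pt, ← h3]
        rcases h4 with h4 | h4
        · have : k = 0 := by rw [h3, h4]; rfl
          rw [pt_zero (by exact this), pt_zero (by exact this)]
        · rw [h4]
      · rw [vertex_eq_pt, ← h1, ← h2]
    have cell : ∀ m A, cellVertex n (col n (A, m)) =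
        if m ≤ 1 ∨ (m = 2 ∧ A ≠ n - 2) then 0 else cellVertex n (A, m) := by
      intro m A
      by_cases hm : m ≤ 1 ∨ (m = 2 ∧ A ≠ n - 2)
      · rw [if_pos hm]; unfold col; rw [if_pos hm]; rfl
      · rw [if_neg hm]; unfold col; rw [if_neg hm]
    rcases h with ⟨rfl, h1, h2⟩ | ⟨rfl, rfl⟩ | ⟨rfl, rfl⟩
    -- The switch position is the first one that `col` does not collapse: $2$ on arm $n-2$, and $3$
    -- on the other arms. On the two outer edges it is the end point.
    · by_cases hz : b = n - 2
      · refine ⟨n - 2, 0, 2, mk _ _ _ 2 ?_ ?_ rfl (Or.inl rfl) ?_ ?_ ?_ ?_ ?_ ?_ ?_ ?_ ?_⟩ <;>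
          try (intro m h1 h2; rw [cell]; unfold cellVertex)
        all_goals (try simp only [vertexArm, vertexDist, armLen, Long])
        all_goals (try split_ifs) <;> omega
      by_cases hb : b = n - 1
      · refine ⟨n - 1, 0, 3, mk _ _ _ 3 ?_ ?_ rfl (Or.inl rfl) ?_ ?_ ?_ ?_ ?_ ?_ ?_ ?_ ?_⟩ <;>
          try (intro m h1 h2; rw [cell]; unfold cellVertex)
        all_goals (try simp only [vertexArm, vertexDist, armLen, Long])
        all_goals (try split_ifs) <;> omega
      by_cases ha : b = n
      · refine ⟨n, 0, 2 * n - 1, mk _ _ _ 3 ?_ ?_ rfl (Or.inl rfl) ?_ ?_ ?_ ?_ ?_ ?_ ?_ ?_ ?_⟩ <;>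
          try (intro m h1 h2; rw [cell]; unfold cellVertex)
        all_goals (try simp only [vertexArm, vertexDist, armLen, Long])
        all_goals (try split_ifs) <;> omega
      · refine ⟨b, 0, 2 * n, mk _ _ _ 3 ?_ ?_ rfl (Or.inl rfl) ?_ ?_ ?_ ?_ ?_ ?_ ?_ ?_ ?_⟩ <;>
          try (intro m h1 h2; rw [cell]; unfold cellVertex)
        all_goals (try simp only [vertexArm, vertexDist, armLen, Long])
        all_goals (try split_ifs) <;> omega
    · refine ⟨n - 1, 3, 4, mk _ _ _ 4 ?_ ?_ ?_ (Or.inr ?_) ?_ ?_ ?_ ?_ ?_ ?_ ?_ ?_ ?_⟩ <;>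
          try (intro m h1 h2; rw [cell]; unfold cellVertex)
      all_goals (try simp only [vertexArm, vertexDist, armLen, Long])
      all_goals (try split_ifs) <;> first | omega | (intro _; simp)
    · refine ⟨a, 2 * a - 1, 2 * a, mk _ _ _ (2 * a) ?_ ?_ ?_ (Or.inr ?_) ?_ ?_ ?_ ?_ ?_ ?_ ?_ ?_ ?_⟩ <;>
          try (intro m h1 h2; rw [cell]; unfold cellVertex)
      all_goals (try simp only [vertexArm, vertexDist, armLen, Long])
      all_goals (try split_ifs) <;> first | omega | (intro _; simp) | contradiction
  rcases h with h | h
  · obtain ⟨A, k, l, h⟩ := key a b h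
    exact ⟨A, k, l, Or.inl h⟩
  · obtain ⟨A, k, l, h⟩ := key b a h
    exact ⟨A, k, l, Or.inr h⟩

theorem lineMap_pt {n A k l : ℕ} (t : ℝ) (i : Fin n) :
    (AffineMap.lineMap (pt n (A, k)) (pt n (A, l)) t : Fin n → ℝ) i =
      if (i : ℕ) + 1 = A then k + t * (l - k) else 0 := by
  simp only [AffineMap.lineMap_apply_module, pt, Pi.add_apply, Pi.smul_apply, smul_eq_mul]
  split_ifs <;> ring

/-- An edge of the `j`-th subdivision, oriented away from the centre in the image. -/
structure OutEdge (n j : ℕ) (u v : Fin n → ℝ) (a b A k l : ℕ) : Prop where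
  out : OutEdge₀ n a b A k l
  edge : SubEdge n j u v
  lin : ∀ t : ℝ, 0 ≤ t → t ≤ 1 → (phi n)^[j] (AffineMap.lineMap u v t) =
      AffineMap.lineMap (pt n (A, k)) (pt n (A, l)) t

theorem SubEdge.exists_outEdge {n j : ℕ} (hn : 3 ≤ n) {x y : Fin n → ℝ} (h : SubEdge n j x y) :
    ∃ a b A k l, OutEdge n j x y a b A k l ∨ OutEdge n j y x a b A k l := by
  obtain ⟨a, b, hab, hl⟩ := h.linear hn
  obtain ⟨A, k, l, ho | ho⟩ := exists_outEdge₀ hn hab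
  · exact ⟨a, b, A, k, l, Or.inl ⟨ho, h, by rw [← ho.fst, ← ho.snd]; exact hl⟩⟩
  · refine ⟨b, a, A, k, l, Or.inr ⟨ho, h.symm, fun t t0 t1 => ?_⟩⟩
    rw [← ho.fst, ← ho.snd, ← AffineMap.lineMap_apply_one_sub, hl _ (by linarith) (by linarith),
      AffineMap.lineMap_apply_one_sub]

/-- The points of the next subdivision on the edge from `u` to `v`. -/
noncomputable def edgePt {n : ℕ} (u v : Fin n → ℝ) (k l m : ℕ) : Fin n → ℝ :=
  AffineMap.lineMap u v (((m : ℝ) - k) / (l - k))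

namespace OutEdge

variable {n j : ℕ} {u v : Fin n → ℝ} {a b A k l : ℕ}

theorem sub_pos (h : OutEdge n j u v a b A k l) : (0 : ℝ) < l - k := by
  have : (k : ℝ) < l := by exact_mod_cast h.out.lt
  linarith

theorem param (h : OutEdge n j u v a b A k l) {m : ℕ} (h1 : k ≤ m) (h2 : m ≤ l) :
    0 ≤ ((m : ℝ) - k) / (l - k) ∧ ((m : ℝ) - k) / (l - k) ≤ 1 := by
  have h1 : (k : ℝ) ≤ m := by exact_mod_cast h1
  have h2 : (m : ℝ) ≤ l := by exact_mod_cast h2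
  refine ⟨div_nonneg (by linarith) h.sub_pos.le, ?_⟩
  rw [div_le_one h.sub_pos]; linarith

theorem edgePt_mem (h : OutEdge n j u v a b A k l) {m : ℕ} (h1 : k ≤ m) (h2 : m ≤ l) :
    edgePt u v k l m ∈ segment ℝ u v := by
  rw [segment_eq_image_lineMap]
  exact ⟨_, h.param h1 h2, rfl⟩

theorem iterate_edgePt (h : OutEdge n j u v a b A k l) {m : ℕ} (h1 : k ≤ m) (h2 : m ≤ l) :
    (phi n)^[j] (edgePt u v k l m) = pt n (A, m) := by
  have hp := h.param h1 h2
  rw [edgePt, h.lin _ hp.1 hp.2]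
  funext i
  rw [lineMap_pt, div_mul_cancel₀ _ h.sub_pos.ne']
  simp [pt]

theorem isPos (h : OutEdge n j u v a b A k l) {m : ℕ} (h2 : m ≤ l) : IsPos n (A, m) :=
  ⟨h2.trans h.out.le_len, fun _ => ⟨h.out.one_le, h.out.le⟩⟩

theorem edgePt_fst (_ : OutEdge n j u v a b A k l) : edgePt u v k l k = u := by
  simp [edgePt]

theorem edgePt_snd (h : OutEdge n j u v a b A k l) : edgePt u v k l l = v := by
  rw [edgePt, div_self h.sub_pos.ne', AffineMap.lineMap_apply_one]

theorem subEdge_edgePt (h : OutEdge n j u v a b A k l) {m : ℕ} (h1 : k ≤ m) (h2 : m < l) :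
    SubEdge n (j + 1) (edgePt u v k l m) (edgePt u v k l (m + 1)) :=
  ⟨u, v, h.edge, h.edgePt_mem h1 h2.le, h.edgePt_mem (by omega) h2, (A, m), (A, m + 1),
    h.isPos h2.le, h.isPos h2, Or.inl ⟨rfl, Or.inr rfl⟩, h.iterate_edgePt h1 h2.le,
    h.iterate_edgePt (by omega) h2⟩

/-- On the edge the iterate is affine and injective, so the vertices of the next subdivision on it
are exactly the points `edgePt`. -/
theorem eq_edgePt (h : OutEdge n j u v a b A k l) {z : Fin n → ℝ} {p : ℕ × ℕ} (hp : IsPos n p)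
    (hz : z ∈ segment ℝ u v) (hzp : (phi n)^[j] z = pt n p) :
    k ≤ p.2 ∧ p.2 ≤ l ∧ z = edgePt u v k l p.2 ∧ (p.2 ≠ 0 → p.1 = A) := by
  obtain ⟨t, t0, t1, rfl⟩ := segment_eq_image_lineMap' hz
  have hA := h.out.one_le
  have hA' := h.out.le
  rw [h.lin t t0 t1] at hzp
  have e1 := congrFun hzp ⟨A - 1, by omega⟩
  rw [lineMap_pt, if_pos (by simp only; omega)] at e1
  simp only [pt] at e1
  have hpos := h.sub_pos
  have hk : (0 : ℝ) ≤ k := by positivity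
  have htn : 0 ≤ t * ((l : ℝ) - k) := by positivity
  have e2 : (k : ℝ) + t * (l - k) = p.2 ∧ (p.2 ≠ 0 → p.1 = A) := by
    split_ifs at e1 with h3
    · exact ⟨e1, fun _ => by omega⟩
    · have hp0 : p.2 = 0 := by
        by_contra h0
        have hb := hp.2 h0
        have e3 := congrFun hzp ⟨p.1 - 1, by omega⟩
        rw [lineMap_pt, if_neg (by simp only; omega)] at e3
        simp only [pt] at e3
        rw [if_pos (by omega)] at e3
        exact h0 (by exact_mod_cast e3.symm)
      refine ⟨by rw [hp0]; simpa using e1, fun h => absurd hp0 h⟩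
  have e3 : t * ((l : ℝ) - k) ≤ l - k := by nlinarith
  refine ⟨?_, ?_, ?_, e2.2⟩
  · have : (k : ℝ) ≤ p.2 := by linarith [e2.1]
    exact_mod_cast this
  · have : (p.2 : ℝ) ≤ l := by linarith [e2.1]
    exact_mod_cast this
  · rw [edgePt, ← e2.1]
    congr 1
    field_simp
    ring

theorem reflTransGen (h : OutEdge n j u v a b A k l) {m : ℕ} (h1 : k ≤ m) (h2 : m ≤ l) :
    Relation.ReflTransGen (SubEdge n (j + 1)) u (edgePt u v k l m) := by
  induction m, h1 using Nat.le_induction with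
  | base => rw [h.edgePt_fst]
  | succ m hm ih => exact (ih (by omega)).tail (h.subEdge_edgePt hm (by omega))

end OutEdge

/-- The vertices of the `j`-th subdivision. -/
def IsVert (n j : ℕ) (x : Fin n → ℝ) : Prop := ∃ y, SubEdge n j x y

theorem IsVert.exists_outEdge {n j : ℕ} (hn : 3 ≤ n) {z : Fin n → ℝ} (h : IsVert n (j + 1) z) :
    ∃ u v a b A k l m, OutEdge n j u v a b A k l ∧ k ≤ m ∧ m ≤ l ∧ z = edgePt u v k l m := by
  obtain ⟨z', x, x', h1, h2, h3, p, q, hp, hq, hpq, h4, h5⟩ := h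
  obtain ⟨a, b, A, k, l, ho | ho⟩ := h1.exists_outEdge hn
  · have := ho.eq_edgePt hp h2 h4
    exact ⟨x, x', a, b, A, k, l, p.2, ho, this.1, this.2.1, this.2.2.1⟩
  · have := ho.eq_edgePt hp (segment_symm ℝ x x' ▸ h2) h4
    exact ⟨x', x, a, b, A, k, l, p.2, ho, this.1, this.2.1, this.2.2.1⟩

theorem SubEdge.symm_reflTransGen {n j : ℕ} {x y : Fin n → ℝ}
    (h : Relation.ReflTransGen (SubEdge n j) x y) : Relation.ReflTransGen (SubEdge n j) y x := by
  induction h with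
  | refl => exact .refl
  | tail _ h ih => exact .head h.symm ih

theorem SubEdge.refine {n j : ℕ} (hn : 3 ≤ n) {x y : Fin n → ℝ} (h : SubEdge n j x y) :
    Relation.ReflTransGen (SubEdge n (j + 1)) x y := by
  obtain ⟨a, b, A, k, l, ho | ho⟩ := h.exists_outEdge hn
  · have := ho.reflTransGen ho.out.lt.le le_rfl
    rwa [ho.edgePt_snd] at this
  · have := ho.reflTransGen ho.out.lt.le le_rfl
    rw [ho.edgePt_snd] at this
    exact SubEdge.symm_reflTransGen this

theorem IsVert.connected {n : ℕ} (hn : 3 ≤ n) (j : ℕ) : ∀ {x y : Fin n → ℝ}, IsVert n j x →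
    IsVert n j y → Relation.ReflTransGen (SubEdge n j) x y := by
  induction j with
  | zero =>
    have key : ∀ x, IsVert n 0 x → Relation.ReflTransGen (SubEdge n 0) (vertex n 0) x := by
      rintro x ⟨y, a, b, hab, rfl, rfl⟩
      have e0 : ∀ i, 1 ≤ i → i ≤ n → SubEdge n 0 (vertex n 0) (vertex n i) := fun i h1 h2 =>
        ⟨0, i, Or.inl (Or.inl ⟨rfl, h1, h2⟩), rfl, rfl⟩
      have : a = 0 ∨ (1 ≤ a ∧ a ≤ n) ∨ a = n + 1 ∨ a = n + 2 := by unfold Adj₀ at hab; omega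
      rcases this with rfl | ⟨h1, h2⟩ | rfl | rfl
      · exact .refl
      · exact .single (e0 a h1 h2)
      · exact (Relation.ReflTransGen.single (e0 (n - 1) (by omega) (by omega))).tail
          ⟨n - 1, n + 1, Or.inl (Or.inr (Or.inl ⟨rfl, rfl⟩)), rfl, rfl⟩
      · exact (Relation.ReflTransGen.single (e0 n (by omega) (by omega))).tail
          ⟨n, n + 2, Or.inl (Or.inr (Or.inr ⟨rfl, rfl⟩)), rfl, rfl⟩
    exact fun {x y} hx hy => (SubEdge.symm_reflTransGen (key x hx)).trans (key y hy)
  | succ j ih =>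
    intro x y hx hy
    obtain ⟨u, v, a, b, A, k, l, m, ho, h1, h2, rfl⟩ := hx.exists_outEdge hn
    obtain ⟨u', v', a', b', A', k', l', m', ho', h1', h2', rfl⟩ := hy.exists_outEdge hn
    refine (SubEdge.symm_reflTransGen (ho.reflTransGen h1 h2)).trans (.trans ?_
      (ho'.reflTransGen h1' h2'))
    exact (ih ⟨v, ho.edge⟩ ⟨v', ho'.edge⟩).lift' id fun _ _ h => h.refine hn


theorem eq_of_lab_eq_n_add_two {n : ℕ} (hn : 3 ≤ n) {x : ℕ × ℕ} (hx : IsPos n x)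
    (h : lab n x = n + 2) : x.2 = armLen n x.1 := by
  have e : armLen n x.1 = if x.1 = n - 2 then 2 else if x.1 = n - 1 then 4 else 2 * n := rfl
  rcases pos_cases hn x hx with h' | h' | h' | h' | h' | h' | ⟨hl, h' | ⟨s, h'⟩ | h' | h'⟩ <;> try omega
  · rw [e, if_neg (by omega), if_pos h'.1]; omega
  · have := start_bounds hn hl
    obtain ⟨_, _, _, h4⟩ := h'
    split_ifs at h4 <;> omega
  · have := hl.2.2
    rw [e, if_neg this.1, if_neg this.2]; omega

/-- The labels $n+1$ and $n+2$ occur only at tips of arms, so they cannot precede a vertex; $0$ is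
the only other neighbour in $X_0$ of a label between $1$ and $n$. -/
theorem lab_pred_eq_zero {n : ℕ} (hn : 3 ≤ n) {p : ℕ × ℕ} (hp : IsPos n p) (h1 : 1 ≤ lab n p)
    (h2 : lab n p ≤ n) : p.2 ≠ 0 ∧ lab n (p.1, p.2 - 1) = 0 := by
  have h0 : p.2 ≠ 0 := fun h => by rw [lab_zero hn p h] at h1; omega
  refine ⟨h0, ?_⟩
  have hq : IsPos n (p.1, p.2 - 1) := ⟨by have := hp.1; simp only; omega, fun _ => hp.2 h0⟩
  have ha := adj_lab hn hp hq (Or.inr ⟨by simp only; omega, Or.inr rfl⟩)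
  have e1 : lab n (p.1, p.2 - 1) ≠ n + 1 := by
    intro h
    have h3 := eq_of_lab_eq_n_add_one hn hq h
    have h4 := congrArg Prod.fst h3
    have h5 := congrArg Prod.snd h3
    have := hp.1
    simp only at h4 h5
    rw [h4] at this
    simp only [armLen, if_true] at this
    omega
  have e2 : lab n (p.1, p.2 - 1) ≠ n + 2 := by
    intro h
    have h3 := eq_of_lab_eq_n_add_two hn hq h
    have := hp.1
    simp only at h3
    omega
  unfold Adj₀ at ha
  omega

theorem IsVert.exists_pos {n j : ℕ} {z : Fin n → ℝ} (h : IsVert n (j + 1) z) :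
    ∃ p, IsPos n p ∧ (phi n)^[j] z = pt n p := by
  obtain ⟨z', x, x', h1, h2, h3, p, q, hp, hq, hpq, h4, h5⟩ := h
  exact ⟨p, hp, h4⟩

theorem IsVert.exists_label {n j : ℕ} (hn : 3 ≤ n) {z : Fin n → ℝ} (h : IsVert n j z) :
    ∃ a, a ≤ n + 2 ∧ (phi n)^[j] z = vertex n a := by
  obtain ⟨z', h⟩ := h
  obtain ⟨a, b, hab, hl⟩ := h.linear hn
  have := hl 0 le_rfl zero_le_one
  rw [AffineMap.lineMap_apply_zero, AffineMap.lineMap_apply_zero] at this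
  exact ⟨a, (hab.le hn).1, this⟩

namespace OutEdge
variable {n j : ℕ} {u v : Fin n → ℝ} {a b A k l : ℕ}

theorem iterate_fst (h : OutEdge n j u v a b A k l) : (phi n)^[j] u = pt n (A, k) := by
  simpa using h.lin 0 le_rfl zero_le_one

theorem iterate_snd (h : OutEdge n j u v a b A k l) : (phi n)^[j] v = pt n (A, l) := by
  simpa using h.lin 1 zero_le_one le_rfl

end OutEdge

theorem eq_pt_of_eq {n : ℕ} {p q : ℕ × ℕ} (h2 : p.2 = q.2) (h1 : p.2 ≠ 0 → p.1 = q.1) :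
    pt n p = pt n q := by
  by_cases h0 : p.2 = 0
  · rw [pt_zero h0, pt_zero (h2 ▸ h0)]
  · rw [Prod.ext (h1 h0) h2]

theorem exists_down_of {n j : ℕ} (hn : 3 ≤ n)
    (hD : ∀ x a, IsVert n j x → 1 ≤ a → a ≤ n → (phi n)^[j] x = vertex n a →
      ∃ y, SubEdge n j x y ∧ (phi n)^[j] y = 0)
    {z : Fin n → ℝ} {p : ℕ × ℕ} (hz : IsVert n (j + 1) z) (hp : IsPos n p)
    (hzp : (phi n)^[j] z = pt n p) (h0 : p.2 ≠ 0) :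
    ∃ z', SubEdge n (j + 1) z z' ∧ (phi n)^[j] z' = pt n (p.1, p.2 - 1) := by
  obtain ⟨u, v, a, b, A, k, l, m, ho, h1, h2, rfl⟩ := hz.exists_outEdge hn
  rw [ho.iterate_edgePt h1 h2] at hzp
  have hm : m ≠ 0 ∧ (A, m) = p := by
    have := pt_inj (ho.isPos h2) hp hzp
    simp only at this
    exact ⟨by omega, Prod.ext (this.2 (by omega)) this.1⟩
  obtain ⟨hm, rfl⟩ := hm
  -- If $m=k\ne 0$, the vertex is the inner end of an outer edge, and its inward neighbour lies on
  -- another edge of the $j$-th subdivision; the hypothesis `hD` supplies that edge.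
  rcases h1.eq_or_lt with rfl | h1
  · obtain ⟨y, hy, hy0⟩ := hD u a ⟨v, ho.edge⟩ (by have := ho.out.inner hm; omega)
      (by have := ho.out.inner hm; omega) (by rw [ho.iterate_fst, ho.out.fst])
    obtain ⟨a', b', A', k', l', ho' | ho'⟩ := hy.exists_outEdge hn
    · exfalso
      have e := ho'.iterate_snd
      rw [hy0, ← pt_zero (n := n) (x := (0, 0)) rfl] at e
      have := (pt_inj ⟨Nat.zero_le _, fun h => absurd rfl h⟩ (ho'.isPos le_rfl) e).1
      have := ho'.out.lt
      omega
    · have e := pt_inj (ho.isPos ho.out.lt.le) (ho'.isPos le_rfl)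
        (ho.iterate_fst.symm.trans ho'.iterate_snd)
      simp only at e
      obtain ⟨rfl, e2⟩ := e
      have e2 := e2 hm
      have hlt := ho'.out.lt
      refine ⟨edgePt y u k' k (k - 1), ?_, ?_⟩
      · rw [ho.edgePt_fst]
        have := ho'.subEdge_edgePt (m := k - 1) (by omega) (by omega)
        rw [Nat.sub_add_cancel (by omega), ho'.edgePt_snd] at this
        exact this.symm
      · rw [ho'.iterate_edgePt (by omega) (by omega), e2]
  · refine ⟨edgePt u v k l (m - 1), ?_, ?_⟩
    · have := ho.subEdge_edgePt (m := m - 1) (by omega) (by omega)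
      rw [Nat.sub_add_cancel (by omega)] at this
      exact this.symm
    · exact ho.iterate_edgePt (by omega) (by omega)

/-- Inward steps lift through all levels: the label before one in $1,\dots,n$ is $0$, and
`exists_down_of` turns the statement at level $j$ into the step needed at level $j+1$. -/
theorem exists_inner_nbr {n : ℕ} (hn : 3 ≤ n) (j : ℕ) : ∀ x a, IsVert n j x → 1 ≤ a → a ≤ n →
    (phi n)^[j] x = vertex n a → ∃ y, SubEdge n j x y ∧ (phi n)^[j] y = 0 := by
  induction j with
  | zero =>
    rintro x a - h1 h2 (rfl : x = _)
    exact ⟨vertex n 0, ⟨a, 0, Or.inr (Or.inl ⟨rfl, h1, h2⟩), rfl, rfl⟩, vertex_zero n⟩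
  | succ j ih =>
    intro x a hx h1 h2 hxa
    obtain ⟨p, hp, hxp⟩ := hx.exists_pos
    rw [Function.iterate_succ_apply', hxp, phi_pt hn hp] at hxa
    obtain rfl := vertex_inj hn (lab_le hn hp) (by omega) hxa
    obtain ⟨h0, hl⟩ := lab_pred_eq_zero hn hp h1 h2
    obtain ⟨z', hz, hz'⟩ := exists_down_of hn ih hx hp hxp h0
    refine ⟨z', hz, ?_⟩
    rw [Function.iterate_succ_apply', hz', phi_pt hn, hl, vertex_zero]
    exact ⟨by have := hp.1; simp only; omega, fun _ => hp.2 h0⟩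

/-- On a long arm, positions up to $2n-2$ lie before the outer end of the edge of $X_0$ that
contains them, so the next vertex lies on the same edge. -/
theorem exists_up {n j : ℕ} (hn : 3 ≤ n) {z : Fin n → ℝ} {p : ℕ × ℕ} (hz : IsVert n (j + 1) z)
    (hp : IsPos n p) (hzp : (phi n)^[j] z = pt n p) (h0 : 1 ≤ p.2) (hL : Long n p.1)
    (h3 : p.2 ≤ 2 * n - 2) :
    ∃ z', SubEdge n (j + 1) z z' ∧ (phi n)^[j] z' = pt n (p.1, p.2 + 1) := by
  obtain ⟨u, v, a, b, A, k, l, m, ho, h1, h2, rfl⟩ := hz.exists_outEdge hn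
  rw [ho.iterate_edgePt h1 h2] at hzp
  have hm : (A, m) = p := by
    have := pt_inj (ho.isPos h2) hp hzp
    simp only at this
    exact Prod.ext (this.2 (by omega)) this.1
  subst hm
  have := ho.out.outer hL
  simp only at h3
  exact ⟨edgePt u v k l (m + 1), ho.subEdge_edgePt h1 (by omega),
    ho.iterate_edgePt (by omega) (by omega)⟩

/-! ### The descent from level $j+1$ to level $j$ -/

/-- The composition of the `j`-th iterate of the bonding map with the projection to the set of
vertices factors, on the `j`-th subdivision, through an od with `n - 1` arms. -/
def Factors (n j : ℕ) : Prop :=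
  ∃ f : (Fin n → ℝ) → ℕ × ℕ, (∀ x, (f x).1 < n - 1) ∧ (∀ x, (f x).2 = 0 → (f x).1 = 0) ∧
    (∀ x y, SubEdge n j x y → OAdj (f x) (f y)) ∧
    ∀ x y, IsVert n j x → IsVert n j y → f x = f y → (phi n)^[j] x = (phi n)^[j] y

/-- Subdividing $v_0v_{n-1}$ into three edges keeps $v_{n-1}$ outside the collapsed component, so
collapsing does not merge vertices of $X_0$. -/
theorem cellVertex_vertex {n a : ℕ} (hn : 3 ≤ n) (ha : a ≤ n + 2) :
    cellVertex n (col n (vertexArm n a, vertexDist n a)) = a := by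
  by_cases h0 : a = 0
  · subst h0; simp [vertexDist, col, cellVertex]
  have h2 : ¬ (vertexDist n a ≤ 1 ∨ (vertexDist n a = 2 ∧ vertexArm n a ≠ n - 2)) := by
    simp only [vertexArm, vertexDist, armLen]
    split_ifs <;> omega
  unfold col
  rw [if_neg h2]
  clear h2
  have hA : vertexArm n a = if a ≤ n then a else a - 2 := rfl
  have hl : vertexDist n a = if a = 0 then 0 else if a = n - 1 then 3 else if a = n then 2 * n - 1
    else armLen n (vertexArm n a) := rfl
  unfold armLen at hl
  generalize vertexArm n a = A at *
  generalize vertexDist n a = l at *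
  unfold cellVertex
  split_ifs at hl hA ⊢ <;> simp only at * <;> omega

/-- `FactorData.conclusion` gives a map whose fibres determine the class of $G$, hence its cell
vertex in $X_0$. Along an edge of the $j$-th subdivision this vertex changes exactly once, so
contracting the od along constant cell vertices sends that whole edge to a single edge. -/
theorem Factors.of_succ {n j : ℕ} (hn : 3 ≤ n) (h : Factors n (j + 1)) : Factors n j := by
  obtain ⟨f, f1, f2, f3, f4⟩ := h
  let V := {x // IsVert n (j + 1) x}
  have hG : ∀ z : V, ∃ p, IsPos n p ∧ (phi n)^[j] z = pt n p := fun z => z.2.exists_pos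
  choose G G1 G2 using hG
  have hGeq : ∀ z p, IsPos n p → (phi n)^[j] z.1 = pt n p →
      (G z).2 = p.2 ∧ ((G z).2 ≠ 0 → (G z).1 = p.1) := fun z p hp hz =>
    pt_inj (G1 z) hp ((G2 z).symm.trans hz)
  have hnb : ∀ {z z'}, SubEdge n (j + 1) z z' → IsVert n (j + 1) z' := fun h => ⟨_, h.symm⟩
  have d : FactorData n (fun x y : V => SubEdge n (j + 1) x y) G (fun x => f x) := by
    refine ⟨hn, fun x y => SubEdge.symm, ?_, G1, ?_, ?_, ?_, ?_, fun x => f1 x, fun x => f2 x,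
      fun x y => f3 x y, ?_⟩
    · rintro ⟨x, hx⟩ ⟨y, hy⟩
      have key : ∀ y, Relation.ReflTransGen (SubEdge n (j + 1)) x y → ∀ hy : IsVert n (j + 1) y,
          Relation.ReflTransGen (fun x y : V => SubEdge n (j + 1) x y) ⟨x, hx⟩ ⟨y, hy⟩ := by
        intro y h
        induction h with
        | refl => exact fun _ => .refl
        | tail _ h ih => exact fun hy => (ih ⟨_, h⟩).tail h
      exact key y (hx.connected hn (j + 1) hy) hy
    · rintro ⟨x, hx⟩ ⟨y, hy⟩ hxy
      obtain ⟨u, v, h1, h2, h3, p, q, hp, hq, hpq, h4, h5⟩ := id hxy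
      have e1 := hGeq ⟨x, hx⟩ p hp h4
      have e2 := hGeq ⟨y, hy⟩ q hq h5
      rcases hpq with ⟨k1, k2⟩ | ⟨k1, k2⟩
      · refine Or.inl ⟨by omega, ?_⟩
        rcases k2 with k2 | k2
        · exact Or.inl (by omega)
        · by_cases h0 : (G ⟨x, hx⟩).2 = 0
          · exact Or.inl h0
          · exact Or.inr (by rw [e1.2 h0, e2.2 (by omega), k2])
      · refine Or.inr ⟨by omega, ?_⟩
        rcases k2 with k2 | k2
        · exact Or.inl (by omega)
        · by_cases h0 : (G ⟨y, hy⟩).2 = 0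
          · exact Or.inl h0
          · exact Or.inr (by rw [e1.2 (by omega), e2.2 h0, k2])
    · rintro ⟨x, y, hxy⟩
      exact ⟨⟨y, hnb hxy⟩, hxy⟩
    · intro x h0
      obtain ⟨z, h1, h2⟩ := exists_down_of hn (exists_inner_nbr hn j) x.2 (G1 x) (G2 x) h0
      refine ⟨⟨z, hnb h1⟩, h1, ?_⟩
      have := (hGeq ⟨z, hnb h1⟩ ((G x).1, (G x).2 - 1) ⟨by have := (G1 x).1; simp only; omega,
        fun _ => (G1 x).2 h0⟩ h2).1
      simp only at this
      omega
    · intro x hL h1 h2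
      obtain ⟨z, h3, h4⟩ := exists_up hn x.2 (G1 x) (G2 x) h1 hL h2
      refine ⟨⟨z, hnb h3⟩, h3, ?_⟩
      refine (hGeq ⟨z, hnb h3⟩ ((G x).1, (G x).2 + 1) ⟨?_, fun _ => ⟨hL.1, hL.2.1⟩⟩ h4).1
      have := hL.2.2
      simp only [armLen]
      rw [if_neg this.1, if_neg this.2]
      omega
    · intro x y hxy
      have h := f4 x y x.2 y.2 hxy
      rw [Function.iterate_succ_apply', Function.iterate_succ_apply', G2, G2, phi_pt hn (G1 x),
        phi_pt hn (G1 y)] at h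
      exact vertex_inj hn (lab_le hn (G1 x)) (lab_le hn (G1 y)) h
  have hne : Nonempty V := by
    have hE : SubEdge n 0 (vertex n 0) (vertex n 1) :=
      ⟨0, 1, Or.inl (Or.inl ⟨rfl, by omega, by omega⟩), rfl, rfl⟩
    have : ∀ i, ∃ x y, SubEdge n i x y := by
      intro i
      induction i with
      | zero => exact ⟨_, _, hE⟩
      | succ i ih =>
        obtain ⟨x, y, h⟩ := ih
        obtain ⟨a, b, A, k, l, ho | ho⟩ := h.exists_outEdge hn <;>
        exact ⟨_, _, ho.subEdge_edgePt le_rfl ho.out.lt⟩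
    obtain ⟨x, y, h⟩ := this (j + 1)
    exact ⟨⟨x, y, h⟩⟩
  obtain ⟨F, F1, F2, F3, F4⟩ := d.conclusion
  classical
  -- the label that has to be preserved
  let L : V → ℕ := fun z => cellVertex n (col n (G z))
  -- The label becomes a function on the small od because it is constant on the fibres of `F`;
  -- outside the image its value is arbitrary.
  let H : ℕ × ℕ → ℕ := fun y => if h : ∃ z, F z = y then L h.choose else 0
  have hH : ∀ z, H (F z) = L z := by
    intro z
    have h : ∃ z', F z' = F z := ⟨z, rfl⟩
    have e : H (F z) = L h.choose := dif_pos h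
    rw [e]
    exact congrArg (cellVertex n) (F4 _ _ h.choose_spec)
  have hvert : ∀ {x}, IsVert n j x → IsVert n (j + 1) x := by
    rintro x ⟨y, h⟩
    obtain ⟨a, b, A, k, l, ho | ho⟩ := h.exists_outEdge hn
    · have := ho.subEdge_edgePt le_rfl ho.out.lt
      rw [ho.edgePt_fst] at this
      exact ⟨_, this⟩
    · have hlt := ho.out.lt
      have := ho.subEdge_edgePt (m := l - 1) (by omega) (by omega)
      rw [Nat.sub_add_cancel (by omega), ho.edgePt_snd] at this
      exact ⟨_, this.symm⟩
  let g : (Fin n → ℝ) → ℕ × ℕ := fun x => if h : IsVert n (j + 1) x then contract H (F ⟨x, h⟩) else (0, 0)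
  have hg : ∀ x (h : IsVert n (j + 1) x), g x = contract H (F ⟨x, h⟩) := fun x h => dif_pos h
  refine ⟨g, ?_, ?_, ?_, ?_⟩
  · intro x
    simp only [g]
    split_ifs
    · exact opt_fst_lt (F1 _)
    · simp only; omega
  · intro x
    simp only [g]
    split_ifs
    · exact norm_opt _ _
    · exact fun _ => rfl
  · have key : ∀ u v a b A k l, OutEdge n j u v a b A k l → OAdj (g u) (g v) := by
      intro u v a b A k l ho
      obtain ⟨c, c1, c2, c3⟩ := ho.out.cell
      have hlt := ho.out.lt
      have hab : a ≠ b := by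
        have := ho.out.adj
        unfold Adj₀ at this
        omega
      have hV : ∀ m, k ≤ m → m ≤ l → IsVert n (j + 1) (edgePt u v k l m) := by
        intro m h1 h2
        rcases h2.lt_or_eq with h2 | rfl
        · exact ⟨_, ho.subEdge_edgePt h1 h2⟩
        · have := ho.subEdge_edgePt (m := m - 1) (by omega) (by omega)
          rw [Nat.sub_add_cancel (by omega)] at this
          exact ⟨_, this.symm⟩
      have hL : ∀ m (h1 : k ≤ m) (h2 : m ≤ l), L ⟨_, hV m h1 h2⟩ = if m < c then a else b := by
        intro m h1 h2
        rw [← c3 m h1 h2]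
        have := hGeq ⟨_, hV m h1 h2⟩ (A, m) (ho.isPos h2) (ho.iterate_edgePt h1 h2)
        refine congrArg (cellVertex n) ?_
        by_cases h0 : m = 0
        · rw [col, col, if_pos (Or.inl (by rw [this.1]; simp only; omega)), if_pos (Or.inl (by
            simp only; omega))]
        · rw [Prod.ext (this.2 (by rw [this.1]; exact h0)) this.1]
      have step : ∀ m, k ≤ m → m < l →
          (m + 1 ≠ c → g (edgePt u v k l m) = g (edgePt u v k l (m + 1))) ∧
          (m + 1 = c → OAdj (g (edgePt u v k l m)) (g (edgePt u v k l (m + 1)))) := by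
        intro m h1 h2
        rw [hg _ (hV m h1 h2.le), hg _ (hV (m + 1) (by omega) h2)]
        have e1 := hL m h1 h2.le
        have e2 := hL (m + 1) (by omega) h2
        rw [← hH] at e1 e2
        have hF := F3 ⟨_, hV m h1 h2.le⟩ ⟨_, hV (m + 1) (by omega) h2⟩ (ho.subEdge_edgePt h1 h2)
        constructor
        · intro hne
          have hEq : H (F ⟨_, hV m h1 h2.le⟩) = H (F ⟨_, hV (m + 1) (by omega) h2⟩) := by
            rw [e1, e2]; split_ifs <;> first | rfl | omega
          rcases hF with hF | hF
          · exact (contract_adj (F2 _) (F2 _) hF).1 hEq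
          · rw [hF]
        · intro hc
          have hNe : H (F ⟨_, hV m h1 h2.le⟩) ≠ H (F ⟨_, hV (m + 1) (by omega) h2⟩) := by
            rw [e1, e2, if_pos (by omega), if_neg (by omega)]; exact hab
          rcases hF with hF | hF
          · exact (contract_adj (F2 _) (F2 _) hF).2 hNe
          · exact absurd (by rw [hF]) hNe
      have low : ∀ m, k ≤ m → m < c → g (edgePt u v k l m) = g u := by
        intro m h1
        induction m, h1 using Nat.le_induction with
        | base => intro _; rw [ho.edgePt_fst]
        | succ m hm ih =>
          intro h2
          rw [← (step m hm (by omega)).1 (by omega)]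
          exact ih (by omega)
      have high : ∀ m, c ≤ m → m ≤ l → g (edgePt u v k l m) = g (edgePt u v k l c) := by
        intro m h1
        induction m, h1 using Nat.le_induction with
        | base => intro _; rfl
        | succ m hm ih =>
          intro h2
          rw [← (step m (by omega) (by omega)).1 (by omega)]
          exact ih (by omega)
      have h1 := low (c - 1) (by omega) (by omega)
      have h2 := high l c2 le_rfl
      rw [ho.edgePt_snd] at h2
      have := (step (c - 1) (by omega) (by omega)).2 (by omega)
      rw [Nat.sub_add_cancel (by omega), h1, ← h2] at this
      exact this
    intro x y hxy
    obtain ⟨a, b, A, k, l, ho | ho⟩ := hxy.exists_outEdge hn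
    · exact key _ _ _ _ _ _ _ ho
    · exact (key _ _ _ _ _ _ _ ho).symm
  · have hlab : ∀ x (h : IsVert n j x), (phi n)^[j] x = vertex n (L ⟨x, hvert h⟩) := by
      intro x h
      obtain ⟨a, ha, hx⟩ := h.exists_label hn
      rw [hx]
      congr 1
      have := hGeq ⟨x, hvert h⟩ _ (isPos_vertex hn ha) hx
      simp only [L]
      rw [← cellVertex_vertex hn ha]
      refine congrArg (cellVertex n) ?_
      by_cases h0 : (G ⟨x, hvert h⟩).2 = 0
      · rw [col, col, if_pos (Or.inl (by omega)), if_pos (Or.inl (by rw [h0] at this; omega))]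
      · rw [Prod.ext (this.2 h0) this.1]
    intro x y hx hy hxy
    rw [hg x (hvert hx), hg y (hvert hy)] at hxy
    have := label_eq_of_contract_eq (F2 _) (F2 _) hxy
    rw [hH, hH] at this
    rw [hlab x hx, hlab y hy, this]

theorem not_factors_zero {n : ℕ} (hn : 3 ≤ n) : ¬ Factors n 0 := by
  rintro ⟨f, f1, f2, f3, f4⟩
  have he : ∀ i : Fin n, SubEdge n 0 (vertex n 0) (vertex n (i + 1)) := fun i =>
    ⟨0, i + 1, Or.inl (Or.inl ⟨rfl, by omega, by omega⟩), rfl, rfl⟩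
  have inj : ∀ i i' : Fin n, f (vertex n (i + 1)) = f (vertex n (i' + 1)) → i = i' := by
    intro i i' h
    have := f4 _ _ ⟨_, (he i).symm⟩ ⟨_, (he i').symm⟩ h
    have := vertex_inj hn (by omega) (by omega) this
    exact Fin.ext (by omega)
  -- Numbers the neighbours of $f(v_0)$ by fewer than $n-1$ values: by arm at the centre, and
  -- otherwise by the two directions, where $2\le n-1$.
  let N : ℕ × ℕ → ℕ := fun y => if (f (vertex n 0)).2 = 0 then y.1 else
    if y.2 = (f (vertex n 0)).2 + 1 then 0 else 1
  have hN : ∀ i : Fin n, N (f (vertex n (i + 1))) < n - 1 := by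
    intro i
    simp only [N]
    split_ifs
    · exact f1 _
    · omega
    · omega
  have hc := Fintype.card_le_of_injective
    (fun i : Fin n => (⟨N (f (vertex n (i + 1))), hN i⟩ : Fin (n - 1))) (by
    intro i i' h
    simp only [Fin.mk.injEq] at h
    apply inj
    rcases oadj_cases (f2 _) (f2 _) (f3 _ _ (he i)) with ⟨e, s, h1, h2⟩ | ⟨e, s, h1, h2⟩ <;>
    rcases oadj_cases (f2 _) (f2 _) (f3 _ _ (he i')) with ⟨e', s', h1', h2'⟩ | ⟨e', s', h1', h2'⟩
    all_goals
      have := FactorData.opt_inj (h1.symm.trans h1')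
      simp only [N, h1, h2, h2', opt_snd] at h
      rw [h2, h2']
    · by_cases h0 : s = 0
      · obtain ⟨rfl, _⟩ := this
        subst h0
        simp only [if_true, zero_add, opt_of_ne_zero one_ne_zero] at h
        rw [h]
      · rw [this.2 h0, this.1]
    · split_ifs at h <;> omega
    · split_ifs at h <;> first | omega | contradiction
    · obtain ⟨h3, h4⟩ := this
      obtain rfl := h4 (by omega)
      obtain rfl : s = s' := by omega
      rfl)
  simp only [Fintype.card_fin] at hc
  omega

theorem not_factors {n : ℕ} (hn : 3 ≤ n) (j : ℕ) : ¬ Factors n j := by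
  induction j with
  | zero => exact not_factors_zero hn
  | succ j ih => exact fun h => ih (h.of_succ hn)


/-! ### From approximate to exact factorization: labels with hysteresis -/

section Hysteresis

variable (B : ℕ × ℕ → ℕ → ℝ) (T : ℕ × ℕ → ℕ)

/-- The labels on arm `e`: the label changes on the way out only when its weight gets small. -/
noncomputable def hys (e : ℕ) : ℕ → ℕ
  | 0 => T (0, 0)
  | s + 1 => if B (opt e (s + 1)) (hys e s) < 1 / 3 then T (opt e (s + 1)) else hys e s

noncomputable def hysLabel (y : ℕ × ℕ) : ℕ := hys B T y.1 y.2

variable {B T}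

theorem hysLabel_opt (e s : ℕ) : hysLabel B T (opt e s) = hys B T e s := by
  by_cases h : s = 0
  · subst h; rfl
  · rw [opt_of_ne_zero h]; rfl

theorem hysLabel_succ (e s : ℕ) :
    (¬ B (opt e (s + 1)) (hysLabel B T (opt e s)) < 1 / 3 ∧
      hysLabel B T (opt e (s + 1)) = hysLabel B T (opt e s)) ∨
    (B (opt e (s + 1)) (hysLabel B T (opt e s)) < 1 / 3 ∧
      hysLabel B T (opt e (s + 1)) = T (opt e (s + 1))) := by
  rw [hysLabel_opt, hysLabel_opt, hys]
  split_ifs with h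
  · exact Or.inr ⟨h, rfl⟩
  · exact Or.inl ⟨h, rfl⟩

theorem weight_hysLabel (hT : ∀ y, 1 / 2 ≤ B y (T y)) {y : ℕ × ℕ} (hy : y.2 = 0 → y.1 = 0) :
    1 / 3 ≤ B y (hysLabel B T y) := by
  have key : ∀ e s, 1 / 3 ≤ B (opt e s) (hysLabel B T (opt e s)) := by
    intro e s
    cases s with
    | zero => exact le_trans (by norm_num) (hT (0, 0))
    | succ s =>
      rcases hysLabel_succ (B := B) (T := T) e s with ⟨h1, h2⟩ | ⟨h1, h2⟩
      · rw [h2]; exact not_lt.1 h1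
      · rw [h2]; exact le_trans (by norm_num) (hT _)
  by_cases h : y.2 = 0
  · have e : y = (0, 0) := Prod.ext (hy h) h
    rw [e]; exact key 0 0
  · have := key y.1 y.2
    rwa [opt_of_ne_zero h] at this

theorem contract_opt (h : ℕ × ℕ → ℕ) (e s : ℕ) : contract h (opt e s) = opt e (changes h e s) := by
  by_cases hs : s = 0
  · subst hs; rfl
  · rw [opt_of_ne_zero hs]; rfl

/-- The position of `y` after the contraction, relative to the initial position `c`. -/
def HysInv (h : ℕ × ℕ → ℕ) (a b : ℕ) (c y : ℕ × ℕ) (τ : ℝ) : Prop :=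
  (h y = a ∧ contract h y = c) ∨
  (h y = b ∧ ∃ e r, c = opt e (r + 1) ∧ contract h y = opt e r ∧ ((y.1 = e ∧ y.2 ≠ 0) ∨ 2 / 5 < τ))

/-- During the first half of the way from $a$ to $b$ the weight of $a$ stays well above $1/3$, so an
outward step never gives up the label $a$. The label can become $b$ only by moving inward, across
one change of label, and moving out again undoes it. -/
theorem HysInv.step (hT : ∀ y, 1 / 2 ≤ B y (T y)) {a b : ℕ} (hab : a ≠ b) {c y y' : ℕ × ℕ}
    {τ τ' : ℝ} (hy : y.2 = 0 → y.1 = 0) (hy' : y'.2 = 0 → y'.1 = 0) (hadj : OAdj y y' ∨ y = y')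
    (hτ : τ ≤ τ') (hτ' : τ' ≤ 1 / 2)
    (ha : 1 - τ - 1 / 100 < B y a) (ha' : 1 - τ' - 1 / 100 < B y' a)
    (hb' : |B y' b - τ'| < 1 / 100)
    (hc' : ∀ d, d ≠ a → d ≠ b → B y' d < 1 / 100)
    (hI : HysInv (hysLabel B T) a b c y τ) : HysInv (hysLabel B T) a b c y' τ' := by
  have hb1 := (abs_lt.1 hb').1
  have hb2 := (abs_lt.1 hb').2
  have hlab : ∀ d, 1 / 3 ≤ B y' d → d = a ∨ d = b := by
    intro d hd
    by_contra hne
    rw [not_or] at hne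
    have := hc' d hne.1 hne.2
    linarith
  rcases hadj with hadj | rfl
  swap
  · rcases hI with hI | ⟨h1, e, r, h2, h3, h4⟩
    · exact Or.inl hI
    · exact Or.inr ⟨h1, e, r, h2, h3, h4.imp id fun h => by linarith⟩
  rcases oadj_cases hy hy' hadj with ⟨e1, s, rfl, rfl⟩ | ⟨e1, s, rfl, rfl⟩
  · -- outward
    have hst := contract_step (h := hysLabel B T) e1 s
    rcases hI with ⟨h1, h2⟩ | ⟨h1, e, r, h2, h3, h4⟩
    · rcases hysLabel_succ (B := B) (T := T) e1 s with ⟨k1, k2⟩ | ⟨k1, k2⟩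
      · exact Or.inl ⟨k2.trans h1, (hst.1 k2.symm).symm.trans h2⟩
      · rw [h1] at k1; linarith
    · rcases hysLabel_succ (B := B) (T := T) e1 s with ⟨k1, k2⟩ | ⟨k1, k2⟩
      · refine Or.inr ⟨k2.trans h1, e, r, h2, (hst.1 k2.symm).symm.trans h3, ?_⟩
        rcases h4 with ⟨h4, h5⟩ | h4
        · left
          rw [opt_snd] at h5
          rw [opt_of_ne_zero h5] at h4
          rw [opt_of_ne_zero (by omega)]
          exact ⟨h4, by simp⟩
        · right; linarith
      · rw [h1] at k1
        -- For $\tau>2/5$ the weight of $b$ exceeds $2/5-1/100>1/3$, and the label $b$ would have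
        -- been kept.
        have hlt : τ ≤ 2 / 5 := by
          by_contra hlt
          linarith
        obtain ⟨h4, h5⟩ := h4.resolve_right (by linarith)
        rw [opt_snd] at h5
        rw [opt_of_ne_zero h5] at h4
        simp only at h4
        subst h4
        have k3 : hysLabel B T (opt e1 (s + 1)) = a := by
          refine (hlab _ (weight_hysLabel hT (norm_opt _ _))).resolve_right fun k => ?_
          have := hT (opt e1 (s + 1))
          rw [← k2, k] at this
          linarith
        refine Or.inl ⟨k3, ?_⟩
        rw [contract_opt] at h3
        rw [contract_opt, h2, changes, if_neg (by rw [h1, k3]; exact Ne.symm hab),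
          (FactorData.opt_inj h3).1]
  · -- inward
    have hst := contract_step (h := hysLabel B T) e1 s
    -- At the centre the path may switch arms, so the record of the arm is lost. There the label is
    -- `T (0, 0)`, of weight at least $1/2$; if it is $b$, then $\tau'$ is so large that $b$ is not
    -- given up again.
    have hextra : hysLabel B T (opt e1 s) = b → s = 0 → 2 / 5 < τ' := by
      rintro k rfl
      have := hT (0, 0)
      have k' : T (0, 0) = b := k
      rw [k'] at this
      have : 1 / 2 ≤ B (opt e1 0) b := this
      linarith
    rcases hI with ⟨h1, h2⟩ | ⟨h1, e, r, h2, h3, h4⟩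
    · rcases hlab _ (weight_hysLabel hT (norm_opt e1 s)) with k | k
      · exact Or.inl ⟨k, (hst.1 (k.trans h1.symm)).trans h2⟩
      · refine Or.inr ⟨k, e1, changes (hysLabel B T) e1 s, ?_, contract_opt _ _ _, ?_⟩
        · rw [← h2, contract_opt, changes, if_neg (by rw [h1, k]; exact Ne.symm hab)]
        · by_cases hs : s = 0
          · exact Or.inr (hextra k hs)
          · rw [opt_of_ne_zero hs]; exact Or.inl ⟨rfl, hs⟩
    · rcases hlab _ (weight_hysLabel hT (norm_opt e1 s)) with k | k
      · exfalso
        rcases hysLabel_succ (B := B) (T := T) e1 s with ⟨k1, k2⟩ | ⟨k1, k2⟩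
        · exact hab (k.symm.trans (k2.symm.trans h1))
        · rw [k] at k1; linarith
      · refine Or.inr ⟨k, e, r, h2, (hst.1 (k.trans h1.symm)).trans h3, ?_⟩
        by_cases hs : s = 0
        · exact Or.inr (hextra k hs)
        · rcases h4 with ⟨h4, h5⟩ | h4
          · left
            rw [opt_of_ne_zero (by omega)] at h4
            rw [opt_of_ne_zero hs]
            exact ⟨h4, hs⟩
          · right; linarith

theorem hysInv_of_path (hT : ∀ y, 1 / 2 ≤ B y (T y)) {a b : ℕ} (hab : a ≠ b) {y : ℕ → ℕ × ℕ}
    {J : ℕ} (hJ : 0 < J) (hy : ∀ j ≤ J, (y j).2 = 0 → (y j).1 = 0)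
    (hadj : ∀ j < J, OAdj (y j) (y (j + 1)) ∨ y j = y (j + 1))
    (ha : ∀ j ≤ J, |B (y j) a - (1 - (j : ℝ) / (2 * J))| < 1 / 100)
    (hb : ∀ j ≤ J, |B (y j) b - (j : ℝ) / (2 * J)| < 1 / 100)
    (hc : ∀ j ≤ J, ∀ d, d ≠ a → d ≠ b → B (y j) d < 1 / 100) :
    hysLabel B T (y 0) = a ∧ ∀ j ≤ J, HysInv (hysLabel B T) a b (contract (hysLabel B T) (y 0)) (y j)
      ((j : ℝ) / (2 * J)) := by
  have hJ' : (0 : ℝ) < J := by exact_mod_cast hJ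
  have h0 : hysLabel B T (y 0) = a := by
    have hw := weight_hysLabel hT (hy 0 (Nat.zero_le _))
    have h1 := (abs_lt.1 (hb 0 (Nat.zero_le _))).2
    have h2 := hc 0 (Nat.zero_le _) (hysLabel B T (y 0))
    simp only [Nat.cast_zero, zero_div] at h1
    by_contra hne
    by_cases hb : hysLabel B T (y 0) = b
    · rw [hb] at hw; linarith
    · linarith [h2 hne hb]
  refine ⟨h0, fun j => ?_⟩
  induction j with
  | zero => exact fun _ => Or.inl ⟨h0, rfl⟩
  | succ j ih =>
    intro hj
    refine HysInv.step hT hab (hy j (by omega)) (hy _ hj) (hadj j hj) ?_ ?_ ?_ ?_ (hb _ hj) (hc _ hj)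
      (ih (by omega))
    · gcongr; simp
    · rw [div_le_div_iff₀ (by positivity) (by norm_num)]
      have : ((j + 1 : ℕ) : ℝ) ≤ J := by exact_mod_cast hj
      linarith
    · linarith [(abs_lt.1 (ha j (by omega))).1]
    · linarith [(abs_lt.1 (ha _ hj)).1]

/-- A path along which the weight passes from `a` to `b` goes to an edge. -/
theorem contract_adj_of_path (hT : ∀ y, 1 / 2 ≤ B y (T y)) {a b : ℕ} (hab : a ≠ b)
    {y : ℕ → ℕ × ℕ} {J : ℕ} (hJ : 0 < J) (hy : ∀ j ≤ 2 * J, (y j).2 = 0 → (y j).1 = 0)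
    (hadj : ∀ j < 2 * J, OAdj (y j) (y (j + 1)) ∨ y j = y (j + 1))
    (ha : ∀ j ≤ 2 * J, |B (y j) a - (1 - (j : ℝ) / (2 * J))| < 1 / 100)
    (hb : ∀ j ≤ 2 * J, |B (y j) b - (j : ℝ) / (2 * J)| < 1 / 100)
    (hc : ∀ j ≤ 2 * J, ∀ d, d ≠ a → d ≠ b → B (y j) d < 1 / 100) :
    hysLabel B T (y 0) = a ∧ 
    OAdj (contract (hysLabel B T) (y 0)) (contract (hysLabel B T) (y (2 * J))) := by
  have hJ' : (0 : ℝ) < J := by exact_mod_cast hJ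
  obtain ⟨h0, h1⟩ := hysInv_of_path hT hab hJ (fun j hj => hy j (by omega))
    (fun j hj => hadj j (by omega)) (fun j hj => ha j (by omega)) (fun j hj => hb j (by omega))
    (fun j hj => hc j (by omega))
  have hrev : ∀ j ≤ J, ((2 * J - j : ℕ) : ℝ) / (2 * J) = 1 - (j : ℝ) / (2 * J) := by
    intro j hj
    rw [Nat.cast_sub (by omega)]
    push_cast
    field_simp
  -- The second half is the first half of the reversed path with $a$ and $b$ exchanged. At the
  -- midpoint the label is $a$ or $b$, so exactly one of the two halves crosses the single change of
  -- label.
  obtain ⟨h0', h1'⟩ := hysInv_of_path (y := fun j => y (2 * J - j)) hT hab.symm hJ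
    (fun j hj => hy _ (by omega))
    (fun j hj => by
      have := hadj (2 * J - (j + 1)) (by omega)
      rw [show 2 * J - (j + 1) + 1 = 2 * J - j by omega] at this
      exact this.imp OAdj.symm Eq.symm)
    (fun j hj => by rw [← hrev j hj]; exact hb _ (by omega))
    (fun j hj => by
      have := ha (2 * J - j) (by omega)
      rwa [hrev j hj, sub_sub_cancel] at this)
    (fun j hj d hd hd' => hc _ (by omega) d hd' hd)
  refine ⟨h0, ?_⟩
  have m := h1 J le_rfl
  have m' := h1' J le_rfl
  simp only [show 2 * J - J = J by omega, Nat.sub_zero] at m'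
  rcases m with ⟨m1, m2⟩ | ⟨m1, e, r, m2, m3, _⟩ <;>
  rcases m' with ⟨m1', m2'⟩ | ⟨m1', e', r', m2', m3', _⟩
  · exact absurd (m1.symm.trans m1') hab
  · rw [m2', ← m2, m3']; exact FactorData.opt_adj _ _
  · rw [m2, ← m2', m3]; exact (FactorData.opt_adj _ _).symm
  · exact absurd (m1'.symm.trans m1) hab

end Hysteresis


/-! ### Barycentric coordinates on the graph `X₀` -/

/-- The barycentric coordinate on `X₀` belonging to the vertex `v_c`. -/
noncomputable def bary (n c : ℕ) (x : Fin n → ℝ) : ℝ :=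
  if c = 0 then 1 - ∑ i : Fin n, min 1 (x i / vertexDist n (i + 1))
  else ∑ i : Fin n, if (i : ℕ) + 1 = vertexArm n c then
    (if c ≤ n then min (x i / vertexDist n (i + 1)) (1 + vertexDist n (i + 1) - x i)
      else max 0 (x i - vertexDist n (i + 1))) else 0

theorem continuous_bary (n c : ℕ) : Continuous (bary n c) := by
  unfold bary
  by_cases h0 : c = 0
  · simp only [if_pos h0]
    fun_prop
  · simp only [if_neg h0]
    refine continuous_finsetSum _ fun i _ => ?_
    split_ifs <;> fun_prop

theorem vertexDist_pos {n a : ℕ} (hn : 3 ≤ n) (h : a ≠ 0) : 0 < vertexDist n a := by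
  unfold vertexDist armLen
  split_ifs <;> omega

theorem bary_armPoint {n : ℕ} (hn : 3 ≤ n) (i : Fin n) (s : ℝ) (c : ℕ) :
    bary n c (armPoint n i s) = if c = 0 then 1 - min 1 (s / vertexDist n (i + 1))
      else if (i : ℕ) + 1 = vertexArm n c then
    (if c ≤ n then min (s / vertexDist n (i + 1)) (1 + vertexDist n (i + 1) - s)
      else max 0 (s - vertexDist n (i + 1))) else 0 := by
  have hD : ∀ j : Fin n, (0 : ℝ) < vertexDist n (j + 1) := fun j => by
    exact_mod_cast vertexDist_pos hn (Nat.succ_ne_zero _)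
  unfold bary
  by_cases h0 : c = 0
  · rw [if_pos h0, if_pos h0, Finset.sum_eq_single i]
    · simp [armPoint]
    · intro j _ hj
      simp [armPoint, Pi.single_eq_of_ne hj]
    · simp
  · rw [if_neg h0, if_neg h0, Finset.sum_eq_single i]
    · simp only [armPoint, Pi.single_eq_same]
    · intro j _ hj
      have := hD j
      simp only [armPoint, Pi.single_eq_of_ne hj]
      split_ifs
      · rw [zero_div, min_eq_left]; linarith
      · rw [max_eq_left]; linarith
      · rfl
    · simp

theorem armLen_eq {n : ℕ} (hn : 3 ≤ n) (i : Fin n) :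
    (n ≤ i + 2 ∧ armLen n (i + 1) = vertexDist n (i + 1) + 1) ∨
      armLen n (i + 1) = vertexDist n (i + 1) := by
  have hi := i.2
  have : vertexArm n (i + 1) = i + 1 := by unfold vertexArm; rw [if_pos (by omega)]
  have hv : vertexDist n (i + 1) = if (i : ℕ) + 1 = 0 then 0 else if (i : ℕ) + 1 = n - 1 then 3
    else if (i : ℕ) + 1 = n then 2 * n - 1 else armLen n (vertexArm n (i + 1)) := rfl
  rw [this] at hv
  have ha : armLen n (i + 1) = if (i : ℕ) + 1 = n - 2 then 2 else if (i : ℕ) + 1 = n - 1 then 4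
    else 2 * n := rfl
  generalize armLen n (i + 1) = A at *
  generalize vertexDist n (i + 1) = D at *
  clear this
  generalize (i : ℕ) = I at *
  split_ifs at hv ha <;> first | contradiction | omega

/-- An inner or an outer edge of `X₀`, on an arm. -/
theorem adj₀_cases {n a b : ℕ} (hn : 3 ≤ n) (h : Adj₀ n a b) :
    ∃ (i : Fin n) (c d : ℕ), ((a = c ∧ b = d) ∨ (a = d ∧ b = c)) ∧
      ((c = 0 ∧ d = i + 1 ∧ vertex n c = armPoint n i 0 ∧
        vertex n d = armPoint n i (vertexDist n (i + 1))) ∨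
       (c = i + 1 ∧ d = i + 3 ∧ n ≤ i + 2 ∧ vertex n c = armPoint n i (vertexDist n (i + 1)) ∧
        vertex n d = armPoint n i (vertexDist n (i + 1) + 1))) := by
  have key : ∀ a b : ℕ, ((a = 0 ∧ 1 ≤ b ∧ b ≤ n) ∨ (a = n - 1 ∧ b = n + 1) ∨ (a = n ∧ b = n + 2)) →
      ∃ i : Fin n, ((a = 0 ∧ b = i + 1 ∧ vertex n a = armPoint n i 0 ∧
        vertex n b = armPoint n i (vertexDist n (i + 1))) ∨
       (a = i + 1 ∧ b = i + 3 ∧ n ≤ i + 2 ∧ vertex n a = armPoint n i (vertexDist n (i + 1)) ∧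
        vertex n b = armPoint n i (vertexDist n (i + 1) + 1))) := by
    have e1 : ∀ i : Fin n, vertex n (i + 1) = armPoint n i (vertexDist n (i + 1)) := fun i =>
      vertex_eq_armPoint n _ i (Or.inr (by unfold vertexArm; rw [if_pos (by omega)]))
    have e2 : ∀ i : Fin n, n ≤ i + 2 → vertex n (i + 3) = armPoint n i (vertexDist n (i + 1) + 1) := by
      intro i hi
      have : vertexDist n (i + 3) = vertexDist n (i + 1) + 1 := by
        unfold vertexDist vertexArm armLen
        have := i.2
        split_ifs <;> omega
      rw [vertex_eq_armPoint n _ i (Or.inr (by unfold vertexArm; rw [if_neg (by omega)]; omega)), this]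
      push_cast; rfl
    rintro a b (⟨rfl, h1, h2⟩ | ⟨rfl, rfl⟩ | ⟨rfl, rfl⟩)
    · obtain ⟨i, rfl⟩ : ∃ i : Fin n, b = i + 1 := ⟨⟨b - 1, by omega⟩, by simp only; omega⟩
      exact ⟨i, Or.inl ⟨rfl, rfl, by rw [vertex_zero]; simp [armPoint], e1 i⟩⟩
    · refine ⟨⟨n - 2, by omega⟩, Or.inr ⟨by simp only; omega, by simp only; omega, by simp only; omega, ?_, ?_⟩⟩
      · rw [← e1]; congr 1; simp only; omega
      · rw [← e2 _ (by simp only; omega)]; congr 1; simp only; omega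
    · refine ⟨⟨a - 1, by omega⟩, Or.inr ⟨by simp only; omega, by simp only; omega, by simp only; omega, ?_, ?_⟩⟩
      · rw [← e1]; congr 1; simp only; omega
      · rw [← e2 _ (by simp only; omega)]; congr 1; simp only; omega
  rcases h with h | h
  · obtain ⟨i, h⟩ := key a b h
    exact ⟨i, a, b, Or.inl ⟨rfl, rfl⟩, h⟩
  · obtain ⟨i, h⟩ := key b a h
    exact ⟨i, b, a, Or.inr ⟨rfl, rfl⟩, h⟩

/-- On an arm the inner edge has length `vertexDist` and a possible outer edge has length $1$; the
minima and maxima in `bary` switch exactly at the vertex between them. -/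
theorem bary_lineMap {n a b : ℕ} (hn : 3 ≤ n) (h : Adj₀ n a b) {t : ℝ} (h0 : 0 ≤ t) (h1 : t ≤ 1) :
    bary n a (AffineMap.lineMap (vertex n a) (vertex n b) t) = 1 - t ∧
    bary n b (AffineMap.lineMap (vertex n a) (vertex n b) t) = t ∧
    ∀ d, d ≠ a → d ≠ b → bary n d (AffineMap.lineMap (vertex n a) (vertex n b) t) = 0 := by
  have key : ∀ (i : Fin n) (c d : ℕ), ((c = 0 ∧ d = i + 1 ∧ vertex n c = armPoint n i 0 ∧
        vertex n d = armPoint n i (vertexDist n (i + 1))) ∨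
       (c = i + 1 ∧ d = i + 3 ∧ n ≤ i + 2 ∧ vertex n c = armPoint n i (vertexDist n (i + 1)) ∧
        vertex n d = armPoint n i (vertexDist n (i + 1) + 1))) → ∀ {t : ℝ}, 0 ≤ t → t ≤ 1 →
      bary n c (AffineMap.lineMap (vertex n c) (vertex n d) t) = 1 - t ∧
      bary n d (AffineMap.lineMap (vertex n c) (vertex n d) t) = t ∧
      ∀ f, f ≠ c → f ≠ d → bary n f (AffineMap.lineMap (vertex n c) (vertex n d) t) = 0 := by
    intro i c d h t h0 h1
    have hD : (1 : ℝ) ≤ vertexDist n (i + 1) := by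
      exact_mod_cast vertexDist_pos hn (Nat.succ_ne_zero _)
    have hi := i.2
    rcases h with ⟨rfl, rfl, h3, h4⟩ | ⟨rfl, rfl, h2, h3, h4⟩
    all_goals rw [h3, h4, lineMap_armPoint, AffineMap.lineMap_apply_module]
    all_goals
      simp only [bary_armPoint hn, smul_eq_mul]
      clear h3 h4
      generalize (vertexDist n (i + 1) : ℝ) = D at *
    · have e : (1 - t) * 0 + t * D = t * D := by ring
      have e1 : t * D / D = t := by field_simp
      have e2 : t * D ≤ D := by nlinarith
      rw [e, e1]
      refine ⟨?_, ?_, fun f hf hf' => ?_⟩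
      · rw [if_pos trivial, min_eq_right h1]
      · rw [if_neg (by omega), if_pos (by unfold vertexArm; rw [if_pos (by omega)]),
          if_pos (by omega), min_eq_left (by linarith)]
      · rw [if_neg hf]
        by_cases hv : (i : ℕ) + 1 = vertexArm n f
        · rw [if_pos hv, if_neg, max_eq_left (by linarith)]
          intro hfn
          unfold vertexArm at hv
          rw [if_pos hfn] at hv
          exact hf' hv.symm
        · rw [if_neg hv]
    · have e : (1 - t) * D + t * (D + 1) = D + t := by ring
      have e1 : 1 ≤ (D + t) / D := by rw [le_div_iff₀ (by linarith)]; linarith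
      rw [e]
      refine ⟨?_, ?_, fun f hf hf' => ?_⟩
      · rw [if_neg (by omega), if_pos (by unfold vertexArm; rw [if_pos (by omega)]),
          if_pos (by omega), min_eq_right (by linarith)]
        ring
      · rw [if_neg (by omega), if_pos (by unfold vertexArm; rw [if_neg (by omega)]; omega),
          if_neg (by omega), max_eq_right (by linarith)]
        ring
      · by_cases hf0 : f = 0
        · rw [if_pos hf0, min_eq_left e1, sub_self]
        · rw [if_neg hf0, if_neg]
          unfold vertexArm
          split_ifs <;> omega
  obtain ⟨i, c, d, (⟨rfl, rfl⟩ | ⟨rfl, rfl⟩), hh⟩ := adj₀_cases hn h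
  · exact key i _ _ hh h0 h1
  · have := key i _ _ hh (t := 1 - t) (by linarith) (by linarith)
    rw [AffineMap.lineMap_apply_one_sub, sub_sub_cancel] at this
    exact ⟨this.2.1, this.1, fun f hf hf' => this.2.2 f hf' hf⟩

theorem exists_edge_of_mem_Od {n : ℕ} (hn : 3 ≤ n) {x : Fin n → ℝ} (hx : x ∈ Od n) :
    ∃ a b, Adj₀ n a b ∧ ∃ t : ℝ, 0 ≤ t ∧ t ≤ 1 ∧
      x = AffineMap.lineMap (vertex n a) (vertex n b) t := by
  obtain ⟨i, s, h0, h1, rfl⟩ := hx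
  have hi := i.2
  have e1 : vertex n (i + 1) = armPoint n i (vertexDist n (i + 1)) :=
    vertex_eq_armPoint n _ i (Or.inr (by unfold vertexArm; rw [if_pos (by omega)]))
  have hD : (1 : ℝ) ≤ vertexDist n (i + 1) := by
    exact_mod_cast vertexDist_pos hn (Nat.succ_ne_zero _)
  by_cases hs : s ≤ vertexDist n (i + 1)
  · refine ⟨0, i + 1, Or.inl (Or.inl ⟨rfl, by omega, by omega⟩), s / vertexDist n (i + 1),
      by positivity, (div_le_one (by linarith)).2 hs, ?_⟩
    have e0 : vertexDist n 0 = 0 := rfl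
    rw [e1, vertex_eq_armPoint n 0 i (Or.inl rfl), lineMap_armPoint, AffineMap.lineMap_apply_module,
      e0]
    congr 1
    generalize (vertexDist n (i + 1) : ℝ) = D at hD
    rw [Nat.cast_zero, smul_zero, zero_add, smul_eq_mul, div_mul_cancel₀ _ (by linarith)]
  · have h2 : n ≤ i + 2 ∧ armLen n (i + 1) = vertexDist n (i + 1) + 1 := by
      rcases armLen_eq hn i with h | h
      · exact h
      · exact absurd (by rwa [h] at h1) hs
    refine ⟨i + 1, i + 3, ?_, s - vertexDist n (i + 1), by linarith, ?_, ?_⟩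
    · unfold Adj₀; omega
    · rw [h2.2] at h1; push_cast at h1; linarith
    · rw [e1, vertex_eq_armPoint n (i + 3) i (Or.inr (by
        unfold vertexArm; rw [if_neg (by omega)]; omega)), lineMap_armPoint,
        AffineMap.lineMap_apply_module]
      congr 1
      have : vertexDist n (i + 3) = vertexDist n (i + 1) + 1 := by
        unfold vertexDist vertexArm armLen
        split_ifs <;> omega
      rw [this]
      push_cast
      simp only [smul_eq_mul]
      ring

theorem exists_half_le_bary {n : ℕ} (hn : 3 ≤ n) {x : Fin n → ℝ} (hx : x ∈ Od n) :
    ∃ c, c ≤ n + 2 ∧ 1 / 2 ≤ bary n c x := by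
  obtain ⟨a, b, hab, t, h0, h1, rfl⟩ := exists_edge_of_mem_Od hn hx
  have h := bary_lineMap hn hab h0 h1
  by_cases ht : t ≤ 1 / 2
  · exact ⟨a, (hab.le hn).1, by rw [h.1]; linarith⟩
  · exact ⟨b, (hab.le hn).2, by rw [h.2.1]; linarith⟩

/-! ### Surjectivity of the bonding map -/

/-- Arm $n$ covers the edges from $v_0$ to $v_1,\dots,v_{n-2}$, arm $n-2$ the edge to $v_{n+1}$, and
arm $n-1$ the remaining ones. -/
theorem exists_edge_over {n a b : ℕ} (hn : 3 ≤ n) (h : Adj₀ n a b) :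
    ∃ p q, IsPos n p ∧ IsPos n q ∧ OAdj p q ∧ lab n p = a ∧ lab n q = b := by
  have key : ∀ a b : ℕ, ((a = 0 ∧ 1 ≤ b ∧ b ≤ n) ∨ (a = n - 1 ∧ b = n + 1) ∨ (a = n ∧ b = n + 2)) →
      ∃ p q, IsPos n p ∧ IsPos n q ∧ OAdj p q ∧ lab n p = a ∧ lab n q = b := by
    have hb : ∀ k, k ≤ 4 → IsPos n (n - 1, k) := fun k hk => ⟨by
      simp only [armLen, if_true]; rw [if_neg (by omega)]; exact hk, fun _ => by simp only; omega⟩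
    have lb : ∀ k, lab n (n - 1, k) = if k = 0 then 0 else if k = 1 then n - 1 else
        if k = 2 then 0 else if k = 3 then n else n + 2 := fun k => by
      unfold lab phiVertex
      simp only [if_true]
      rw [if_neg (by omega)]
    rintro a b (⟨rfl, h1, h2⟩ | ⟨rfl, rfl⟩ | ⟨rfl, rfl⟩)
    · by_cases e1 : b = n - 1
      · exact ⟨(n - 1, 0), (n - 1, 1), hb _ (by omega), hb _ (by omega), Or.inl ⟨rfl, Or.inl rfl⟩,
          by rw [lb]; simp, by rw [lb, e1]; simp⟩
      by_cases e2 : b = n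
      · exact ⟨(n - 1, 2), (n - 1, 3), hb _ (by omega), hb _ (by omega), Or.inl ⟨rfl, Or.inr rfl⟩,
          by rw [lb]; simp, by rw [lb, e2]; simp⟩
      · have hL : Long n n := ⟨by omega, le_rfl, by omega, by omega⟩
        obtain ⟨s, s1, s2, s3⟩ := exists_oddLab_eq hn hL h1 (by omega : b ≤ n - 2)
        have hp : ∀ k, k ≤ 2 * n → IsPos n (n, k) := fun k hk => ⟨by
          simp only [armLen]; rw [if_neg hL.2.2.1, if_neg hL.2.2.2]; exact hk,
          fun _ => by simp only; omega⟩
        exact ⟨(n, 2 * s), (n, 2 * s + 1), hp _ (by omega), hp _ (by omega),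
          Or.inl ⟨rfl, Or.inr rfl⟩, lab_long_even _ hL (by simp only; omega) (by simp only; omega), s3⟩
    · have hp : ∀ k, k ≤ 2 → IsPos n (n - 2, k) := fun k hk => ⟨by
        simp only [armLen, if_true]; exact hk, fun _ => by simp only; omega⟩
      exact ⟨(n - 2, 1), (n - 2, 2), hp _ (by omega), hp _ (by omega), Or.inl ⟨rfl, Or.inr rfl⟩,
        by simp [lab, phiVertex], by simp [lab, phiVertex]⟩
    · exact ⟨(a - 1, 3), (a - 1, 4), hb _ (by omega), hb _ (by omega), Or.inl ⟨rfl, Or.inr rfl⟩,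
          by rw [lb]; simp, by rw [lb]; simp⟩
  rcases h with h | h
  · exact key a b h
  · obtain ⟨p, q, h1, h2, h3, h4, h5⟩ := key b a h
    exact ⟨q, p, h2, h1, h3.symm, h5, h4⟩

theorem lineMap_pt_mem_Od {n : ℕ} {p q : ℕ × ℕ} (hp : IsPos n p) (hq : IsPos n q)
    (h : OAdj p q) {t : ℝ} (h0 : 0 ≤ t) (h1 : t ≤ 1) :
    AffineMap.lineMap (pt n p) (pt n q) t ∈ Od n := by
  have key : ∀ {p q : ℕ × ℕ}, IsPos n q → q.2 = p.2 + 1 → (p.2 = 0 ∨ p.1 = q.1) → ∀ {t : ℝ}, 0 ≤ t →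
      t ≤ 1 → AffineMap.lineMap (pt n p) (pt n q) t ∈ Od n := by
    intro p q hq hpq hpq' t h0 h1
    have hb := hq.2 (by omega)
    obtain ⟨i, hi⟩ : ∃ i : Fin n, (i : ℕ) + 1 = q.1 := ⟨⟨q.1 - 1, by omega⟩, by simp only; omega⟩
    refine ⟨i, p.2 + t, by positivity, ?_, ?_⟩
    · have : ((p.2 + 1 : ℕ) : ℝ) ≤ armLen n (i + 1) := by
        rw [hi, ← hpq]; exact_mod_cast hq.1
      push_cast at this
      linarith
    · have e1 : pt n p = armPoint n i p.2 := by
        rw [← pt_eq_armPoint]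
        exact eq_pt_of_eq rfl fun h => by rw [hi]; exact hpq'.resolve_left h
      have e2 : pt n q = armPoint n i (p.2 + 1 : ℕ) := by
        rw [← pt_eq_armPoint, hi, ← hpq]
      rw [e1, e2, lineMap_armPoint, AffineMap.lineMap_apply_module]
      congr 1
      push_cast; simp only [smul_eq_mul]; ring
  rcases h with ⟨h2, h3⟩ | ⟨h2, h3⟩
  · exact key hq h2 h3 h0 h1
  · rw [← AffineMap.lineMap_apply_one_sub]
    exact key hp h2 (h3.imp id Eq.symm) (by linarith) (by linarith)

theorem bonding_surjective {n : ℕ} (hn : 3 ≤ n) : Function.Surjective (bonding n hn) := by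
  rintro ⟨x, hx⟩
  obtain ⟨a, b, hab, t, h0, h1, rfl⟩ := exists_edge_of_mem_Od hn hx
  obtain ⟨p, q, hp, hq, hpq, rfl, rfl⟩ := exists_edge_over hn hab
  exact ⟨⟨_, lineMap_pt_mem_Od hp hq hpq h0 h1⟩,
    Subtype.ext (phi_lineMap_pt hn hp hq hpq h0 h1)⟩


/-! ### Approximation by the factors of an inverse sequence -/

/-- A continuous function on a compact space is determined, up to `ε`, by a late enough member of an
increasing sequence of maps that separates points. -/
theorem exists_factor_approx {K M : Type*} [TopologicalSpace K] [CompactSpace K]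
    [PseudoMetricSpace M] {L : ℕ → Type*} [∀ i, MetricSpace (L i)] {q : K → M} (hq : Continuous q)
    {p : ∀ i, K → L i} (hp : ∀ i, Continuous (p i))
    (mono : ∀ i z z', p (i + 1) z = p (i + 1) z' → p i z = p i z')
    (inj : ∀ z z', (∀ i, p i z = p i z') → z = z') {ε : ℝ} (hε : 0 < ε) :
    ∃ i, ∃ δ > 0, ∀ z z', dist (p i z) (p i z') < δ → dist (q z) (q z') < ε := by
  have hqc : Continuous fun w : K × K => dist (q w.1) (q w.2) :=
    (hq.comp continuous_fst).dist (hq.comp continuous_snd)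
  have hpc : ∀ i, Continuous fun w : K × K => dist (p i w.1) (p i w.2) := fun i =>
    ((hp i).comp continuous_fst).dist ((hp i).comp continuous_snd)
  let C : ℕ → Set (K × K) := fun i => {w | ε ≤ dist (q w.1) (q w.2) ∧ dist (p i w.1) (p i w.2) = 0}
  have hcl : ∀ i, IsClosed (C i) := fun i =>
    (isClosed_le continuous_const hqc).inter (isClosed_eq (hpc i) continuous_const)
  -- These compact sets of pairs decrease, and a common point would be a pair that no map separates
  -- although $q$ does.
  have h1 : ∃ i, C i = ∅ := by
    by_contra hne
    push Not at hne
    obtain ⟨w, hw⟩ := IsCompact.nonempty_iInter_of_sequence_nonempty_isCompact_isClosed C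
      (fun i w hw => ⟨hw.1, by rw [mono i _ _ (dist_eq_zero.1 hw.2), dist_self]⟩) hne
      (hcl 0).isCompact hcl
    rw [Set.mem_iInter] at hw
    have := (hw 0).1
    rw [inj w.1 w.2 fun i => dist_eq_zero.1 (hw i).2, dist_self] at this
    linarith
  obtain ⟨i, hi⟩ := h1
  have hA : IsCompact {w : K × K | ε ≤ dist (q w.1) (q w.2)} :=
    (isClosed_le continuous_const hqc).isCompact
  rcases Set.eq_empty_or_nonempty {w : K × K | ε ≤ dist (q w.1) (q w.2)} with h | h
  · refine ⟨i, 1, one_pos, fun z z' _ => ?_⟩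
    by_contra hcon
    exact Set.notMem_empty (z, z') (h ▸ not_lt.1 hcon)
  · obtain ⟨w, hw, hmin⟩ := hA.exists_isMinOn h (hpc i).continuousOn
    refine ⟨i, dist (p i w.1) (p i w.2), ?_, fun z z' hz => ?_⟩
    · refine dist_nonneg.lt_of_ne fun h0 => ?_
      exact Set.notMem_empty w (hi ▸ ⟨hw, h0.symm⟩)
    · by_contra hcon
      exact absurd (hmin (a := (z, z')) (not_lt.1 hcon)) (not_le.2 hz)

/-- Coordinates above $N$ come from sections of the bonding maps, those below from the maps
themselves; the induction shifts the sequence by one. -/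
theorem exists_mem_inverseLimit {X : ℕ → Type*} {f : ∀ i, X (i + 1) → X i}
    (hf : ∀ i, Function.Surjective (f i)) (N : ℕ) (x : X N) :
    ∃ z ∈ inverseLimit X f, z N = x := by
  choose g hg using hf
  have up : ∀ (Y : ℕ → Type _) (f : ∀ i, Y (i + 1) → Y i) (g : ∀ i, Y i → Y (i + 1)),
      (∀ i y, f i (g i y) = y) → ∀ y : Y 0, ∃ z : ∀ i, Y i, (∀ i, f i (z (i + 1)) = z i) ∧ z 0 = y := by
    intro Y f g hg y
    exact ⟨fun i => Nat.rec y (fun i w => g i w) i, fun i => hg i _, rfl⟩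
  induction N generalizing X with
  | zero =>
    obtain ⟨z, h1, h2⟩ := up X f g hg x
    exact ⟨z, h1, h2⟩
  | succ N ih =>
    obtain ⟨z, h1, h2⟩ := ih (X := fun i => X (i + 1)) (f := fun i => f (i + 1)) x
      (fun i => g (i + 1)) (fun i => hg (i + 1))
    refine ⟨fun i => Nat.rec (f 0 (z 0)) (fun i _ => z i) i, fun i => ?_, h2⟩
    cases i with
    | zero => rfl
    | succ i => exact h1 i

/-! ### Coordinates on a simple od -/

/-- A simple-`k`-od embeds in the union of the unit segments of the coordinate axes. -/
theorem IsSimpleOd.exists_coord {k : ℕ} {Y : Type*} [TopologicalSpace Y] (h : IsSimpleOd k Y) :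
    ∃ U : Y → Fin k → ℝ, Continuous U ∧ Function.Injective U ∧
      ∀ y, ∃ e t, 0 ≤ t ∧ t ≤ 1 ∧ U y = Pi.single e t := by
  obtain ⟨hT2, p, γ, h1, h2, h3⟩ := h
  have hex : ∀ y, ∃ (e : Fin k) (t : unitInterval), γ e t = y := by
    intro y
    have := h3.symm ▸ Set.mem_univ y
    obtain ⟨e, t, ht⟩ := Set.mem_iUnion.1 this
    exact ⟨e, t, ht⟩
  choose E T hET using hex
  have hzero : ∀ e e' t t', e ≠ e' → γ e t = γ e' t' → t = 0 ∧ t' = 0 := by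
    intro e e' t t' hne heq
    have hm : γ e t ∈ Set.range (γ e) ∩ Set.range (γ e') := ⟨⟨t, rfl⟩, ⟨t', heq.symm⟩⟩
    rw [h2 e e' hne] at hm
    have hm : γ e t = p := hm
    exact ⟨(h1 e).1.injective (hm.trans (h1 e).2.symm),
      (h1 e').1.injective ((heq.symm.trans hm).trans (h1 e').2.symm)⟩
  have hU : ∀ e t, (Pi.single (E (γ e t)) (T (γ e t) : ℝ) : Fin k → ℝ) = Pi.single e (t : ℝ) := by
    intro e t
    have hy := hET (γ e t)
    by_cases he : E (γ e t) = e
    · have hy' : ∀ e', E (γ e t) = e' → γ e' (T (γ e t)) = γ e t := by rintro _ rfl; exact hy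
      have : T (γ e t) = t := (h1 e).1.injective (hy' e he)
      rw [this, he]
    · obtain ⟨e1, e2⟩ := hzero _ _ _ _ he hy
      rw [e1, e2]; simp
  refine ⟨fun y => Pi.single (E y) (T y : ℝ), ?_, ?_, fun y =>
    ⟨E y, T y, (T y).2.1, (T y).2.2, rfl⟩⟩
  · refine LocallyFinite.continuous (f := fun e => Set.range (γ e))
      (locallyFinite_of_finite _) h3 (fun e => ?_) (fun e => ?_)
    · exact (isCompact_range (h1 e).1.continuous).isClosed
    · rw [continuousOn_iff_continuous_domRestrict]
      have : (Set.range (γ e)).domRestrict (fun y => (Pi.single (E y) (T y : ℝ) : Fin k → ℝ)) =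
          (fun t : unitInterval => (Pi.single e (t : ℝ) : Fin k → ℝ)) ∘ (h1 e).1.toHomeomorph.symm := by
        funext y
        obtain ⟨t, rfl⟩ := (h1 e).1.toHomeomorph.surjective y
        simp only [Function.comp, Homeomorph.symm_apply_apply]
        exact hU e t
      rw [this]
      exact ((continuous_single e).comp continuous_subtype_val).comp (Homeomorph.continuous _)
  · intro y y' h
    simp only at h
    rw [← hET y, ← hET y'] at h ⊢
    rw [hU, hU] at h
    by_cases he : E y = E y'
    · rw [he] at h ⊢
      rw [Subtype.ext (Pi.single_injective (M := fun _ : Fin k => ℝ) _ h)]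
    · have e1 : (T y : ℝ) = 0 := by
        have := congrFun h (E y)
        rwa [Pi.single_eq_same, Pi.single_eq_of_ne he] at this
      have e2 : (T y' : ℝ) = 0 := by
        have := congrFun h (E y')
        rw [Pi.single_eq_same, Pi.single_eq_of_ne (Ne.symm he)] at this
        exact this.symm
      rw [show T y = 0 from Subtype.ext e1, show T y' = 0 from Subtype.ext e2, (h1 _).2, (h1 _).2]

/-- The position on the grid of width `1 / M`. -/
noncomputable def grid {k : ℕ} (M : ℕ) (w : Fin k → ℝ) : ℕ × ℕ :=
  open Classical in
  if h : ∃ e, 1 ≤ M * w e then opt h.choose ⌊M * w h.choose⌋₊ else (0, 0)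

theorem grid_single {k M : ℕ} (e : Fin k) (t : ℝ) :
    grid M (Pi.single e t : Fin k → ℝ) = opt e ⌊M * t⌋₊ := by
  unfold grid
  split_ifs with h
  · have : h.choose = e := by
      by_contra hne
      have := h.choose_spec
      rw [Pi.single_eq_of_ne hne] at this
      simp at this
      linarith
    rw [this, Pi.single_eq_same]
  · push Not at h
    have := h e
    rw [Pi.single_eq_same] at this
    rw [Nat.floor_eq_zero.2 this]; rfl

theorem grid_norm {k M : ℕ} (w : Fin k → ℝ) : (grid M w).2 = 0 → (grid M w).1 = 0 := by
  unfold grid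
  split_ifs
  · exact norm_opt _ _
  · exact fun _ => rfl

theorem grid_fst_lt {k M : ℕ} (hk : 0 < k) (w : Fin k → ℝ) : (grid M w).1 < k := by
  unfold grid
  split_ifs
  · exact opt_fst_lt (Fin.is_lt _)
  · exact hk

theorem floor_cases {a b : ℝ} (ha : 0 ≤ a) (hb : 0 ≤ b) (h : |a - b| < 1) :
    ⌊a⌋₊ = ⌊b⌋₊ ∨ ⌊b⌋₊ = ⌊a⌋₊ + 1 ∨ ⌊a⌋₊ = ⌊b⌋₊ + 1 := by
  have h1 := Nat.floor_le ha
  have h2 := Nat.floor_le hb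
  have h3 := Nat.lt_floor_add_one a
  have h4 := Nat.lt_floor_add_one b
  obtain ⟨h5, h6⟩ := abs_lt.1 h
  have e1 : ⌊a⌋₊ < ⌊b⌋₊ + 2 := by
    have : (⌊a⌋₊ : ℝ) < (⌊b⌋₊ + 2 : ℕ) := by push_cast; linarith
    exact_mod_cast this
  have e2 : ⌊b⌋₊ < ⌊a⌋₊ + 2 := by
    have : (⌊b⌋₊ : ℝ) < (⌊a⌋₊ + 2 : ℕ) := by push_cast; linarith
    exact_mod_cast this
  omega

/-- On different arms both distances from the centre are bounded by the distance of the points, so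
both points lie in the central cell. -/
theorem grid_step {k M : ℕ} {w w' : Fin k → ℝ} (hw : ∃ e t, 0 ≤ t ∧ t ≤ 1 ∧ w = Pi.single e t)
    (hw' : ∃ e t, 0 ≤ t ∧ t ≤ 1 ∧ w' = Pi.single e t) (h : M * dist w w' < 1) :
    OAdj (grid M w) (grid M w') ∨ grid M w = grid M w' := by
  obtain ⟨e, t, t0, t1, rfl⟩ := hw
  obtain ⟨e', t', t0', t1', rfl⟩ := hw'
  rw [grid_single, grid_single]
  have hM : (0 : ℝ) ≤ M := by positivity
  by_cases he : e = e'
  · subst he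
    have h1 := dist_le_pi_dist (Pi.single e t : Fin k → ℝ) (Pi.single e t') e
    simp only [Pi.single_eq_same, Real.dist_eq] at h1
    have h2 : |M * t - M * t'| < 1 := by
      rw [← mul_sub, abs_mul, abs_of_nonneg hM]
      exact (mul_le_mul_of_nonneg_left h1 hM).trans_lt h
    rcases floor_cases (by positivity) (by positivity) h2 with h3 | h3 | h3
    · right; rw [h3]
    · left; rw [h3]; exact FactorData.opt_adj _ _
    · left; rw [h3]; exact (FactorData.opt_adj _ _).symm
  · right
    have h1 := dist_le_pi_dist (Pi.single e t : Fin k → ℝ) (Pi.single e' t') e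
    have h2 := dist_le_pi_dist (Pi.single e t : Fin k → ℝ) (Pi.single e' t') e'
    simp only [Pi.single_eq_same, Real.dist_eq, Pi.single_eq_of_ne he,
      Pi.single_eq_of_ne (Ne.symm he), sub_zero, zero_sub, abs_neg, abs_of_nonneg t0,
      abs_of_nonneg t0'] at h1 h2
    rw [Nat.floor_eq_zero.2 ((mul_le_mul_of_nonneg_left h1 hM).trans_lt h),
      Nat.floor_eq_zero.2 ((mul_le_mul_of_nonneg_left h2 hM).trans_lt h)]
    rfl

theorem dist_le_of_grid_eq {k M : ℕ} {w w' : Fin k → ℝ}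
    (hw : ∃ e t, 0 ≤ t ∧ t ≤ 1 ∧ w = Pi.single e t)
    (hw' : ∃ e t, 0 ≤ t ∧ t ≤ 1 ∧ w' = Pi.single e t) (hM : 0 < M) (h : grid M w = grid M w') :
    dist w w' ≤ 1 / M := by
  obtain ⟨e, t, t0, t1, rfl⟩ := hw
  obtain ⟨e', t', t0', t1', rfl⟩ := hw'
  have hM' : (0 : ℝ) < M := by exact_mod_cast hM
  rw [grid_single, grid_single] at h
  obtain ⟨h1, h2⟩ := FactorData.opt_inj h
  have f1 := Nat.floor_le (mul_nonneg hM'.le t0)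
  have f2 := Nat.floor_le (mul_nonneg hM'.le t0')
  have f3 := Nat.lt_floor_add_one (M * t)
  have f4 := Nat.lt_floor_add_one (M * t')
  rw [dist_pi_le_iff (by positivity)]
  intro i
  have habs : ∀ r : ℝ, |r| * M = |r * M| := fun r => by rw [abs_mul, abs_of_pos hM']
  rw [Real.dist_eq, le_div_iff₀ hM', habs, abs_le]
  by_cases h0 : ⌊M * t⌋₊ = 0
  · rw [← h1, h0] at f2 f4
    rw [h0] at f1 f3
    simp only [Nat.cast_zero, zero_add] at *
    by_cases hi : i = e <;> by_cases hi' : i = e' <;>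
      [(subst hi; subst hi'); subst hi; subst hi'; skip] <;>
      simp only [Pi.single_eq_same, Pi.single_eq_of_ne, ne_eq, *, not_false_eq_true] <;>
      constructor <;> nlinarith
  · have he : e = e' := Fin.ext (h2 h0)
    subst he
    rw [← h1] at f2 f4
    by_cases hi : i = e
    · subst hi
      simp only [Pi.single_eq_same]
      constructor <;> nlinarith
    · simp [Pi.single_eq_of_ne hi]


/-! ### Continuity, compactness, and the resulting combinatorial factorization -/

theorem eq_armPoint_of {n : ℕ} {i : Fin n} {x : Fin n → ℝ} (h : ∀ j, j ≠ i → x j = 0) :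
    x = armPoint n i (x i) := by
  funext j
  by_cases hj : j = i
  · subst hj; simp [armPoint]
  · rw [h j hj, armPoint, Pi.single_eq_of_ne hj]

theorem armLen_le {n a : ℕ} (hn : 3 ≤ n) : armLen n a ≤ 2 * n := by
  unfold armLen; split_ifs <;> omega

theorem bonding_continuous {n : ℕ} (hn : 3 ≤ n) : Continuous (bonding n hn) := by
  refine Continuous.subtype_mk ?_ _
  refine LocallyFinite.continuous (ι := Fin n × Fin (2 * n))
    (f := fun e => {x : Od n | (e.2 : ℝ) ≤ x.1 e.1 ∧ x.1 e.1 ≤ e.2 + 1 ∧ ∀ j, j ≠ e.1 → x.1 j = 0})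
    (locallyFinite_of_finite _) ?_ ?_ ?_
  · refine Set.eq_univ_of_forall fun x => ?_
    obtain ⟨x, i, t, h0, h1, rfl⟩ := x
    have hl : (armLen n (i + 1) : ℝ) ≤ 2 * n := by exact_mod_cast armLen_le hn
    have hn' : (3 : ℝ) ≤ n := by exact_mod_cast hn
    obtain ⟨k, hk, k1, k2⟩ : ∃ k : ℕ, k < 2 * n ∧ (k : ℝ) ≤ t ∧ t ≤ k + 1 := by
      by_cases ht : t < 2 * n
      · refine ⟨⌊t⌋₊, ?_, Nat.floor_le h0, (Nat.lt_floor_add_one t).le⟩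
        rw [Nat.floor_lt h0]; push_cast; exact ht
      · refine ⟨2 * n - 1, by omega, ?_, ?_⟩
        · rw [Nat.cast_sub (by omega)]; push_cast; linarith
        · rw [Nat.cast_sub (by omega)]; push_cast; linarith
    refine Set.mem_iUnion.2 ⟨(i, ⟨k, hk⟩), ?_, ?_, fun j hj => ?_⟩
    · simpa [armPoint] using k1
    · simpa [armPoint] using k2
    · simp only [armPoint]; exact Pi.single_eq_of_ne hj _
  · rintro ⟨i, k⟩
    have hc : ∀ j, Continuous fun x : Od n => x.1 j := fun j =>
      (continuous_apply j).comp continuous_subtype_val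
    refine (isClosed_le continuous_const (hc i)).inter ((isClosed_le (hc i) continuous_const).inter ?_)
    have : IsClosed {x : Od n | ∀ j, j ≠ i → x.1 j = 0} := by
      simp only [Set.ofPred_forall]
      exact isClosed_iInter fun j => isClosed_iInter fun _ => isClosed_eq (hc j) continuous_const
    exact this
  · rintro ⟨i, k⟩
    have : ContinuousOn (fun x : Od n => (AffineMap.lineMap (vertex n (phiVertex n (i + 1) k))
        (vertex n (phiVertex n (i + 1) (k + 1))) (x.1 i - k) : Fin n → ℝ))
        {x : Od n | (k : ℝ) ≤ x.1 i ∧ x.1 i ≤ k + 1 ∧ ∀ j, j ≠ i → x.1 j = 0} := by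
      refine Continuous.continuousOn ?_
      have hc : Continuous fun x : Od n => x.1 i := (continuous_apply i).comp continuous_subtype_val
      exact AffineMap.lineMap_continuous.comp (hc.sub continuous_const)
    refine this.congr ?_
    rintro x ⟨h1, h2, h3⟩
    simp only
    conv_lhs => rw [eq_armPoint_of h3]
    rw [phi_armPoint n hn, ← phiArm_add (by linarith) (by linarith)]
    congr 1
    ring

theorem isCompact_Od (n : ℕ) : IsCompact (Od n) := by
  have : Od n = ⋃ i : Fin n, (fun t => armPoint n i t) '' Set.Icc (0 : ℝ) (armLen n (i + 1)) := by
    ext x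
    simp only [Od, Set.mem_iUnion, Set.mem_image, Set.mem_Icc]
    constructor
    · rintro ⟨i, t, h0, h1, rfl⟩
      exact ⟨i, t, ⟨h0, h1⟩, rfl⟩
    · rintro ⟨i, t, ⟨h0, h1⟩, rfl⟩
      exact ⟨i, t, h0, h1, rfl⟩
  rw [this]
  exact isCompact_iUnion fun i => isCompact_Icc.image
    (continuous_single (A := fun _ : Fin n => ℝ) i)

instance (n : ℕ) : CompactSpace (Od n) := isCompact_iff_compactSpace.1 (isCompact_Od n)

theorem isClosed_inverseLimit {X : ℕ → Type*} [∀ i, TopologicalSpace (X i)] [∀ i, T2Space (X i)]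
    {f : ∀ i, X (i + 1) → X i} (hf : ∀ i, Continuous (f i)) : IsClosed (inverseLimit X f) := by
  simp only [inverseLimit, Set.ofPred_forall]
  exact isClosed_iInter fun i => isClosed_eq ((hf i).comp (continuous_apply _)) (continuous_apply _)

instance compactSpace_K (n : ℕ) (hn : 3 ≤ n) : CompactSpace (K n hn) :=
  isCompact_iff_compactSpace.1 (isClosed_inverseLimit fun _ => bonding_continuous hn).isCompact

theorem K_iterate {n : ℕ} {hn : 3 ≤ n} (z : K n hn) (i N : ℕ) :
    (phi n)^[N] (z.1 (i + N)).1 = (z.1 i).1 := by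
  induction N with
  | zero => rfl
  | succ N ih =>
    rw [Function.iterate_succ_apply, ← ih]
    congr 1
    exact congrArg Subtype.val (z.2 (i + N))

theorem SubEdge.mem_Od {n j : ℕ} (hn : 3 ≤ n) {x y : Fin n → ℝ} (h : SubEdge n j x y) {t : ℝ}
    (h0 : 0 ≤ t) (h1 : t ≤ 1) : AffineMap.lineMap x y t ∈ Od n := by
  induction j generalizing x y t with
  | zero =>
    obtain ⟨a, b, hab, rfl, rfl⟩ := h
    exact lineMap_mem_Od n hn a b hab t h0 h1
  | succ j ih =>
    obtain ⟨u, v, huv, hu, hv, -⟩ := h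
    obtain ⟨s, s0, s1, rfl⟩ := segment_eq_image_lineMap' hu
    obtain ⟨s', s0', s1', rfl⟩ := segment_eq_image_lineMap' hv
    rw [lineMap_lineMap]
    have := lineMap_bounds s0 s1 s0' s1' h0 h1
    exact ih huv this.1 this.2

/-- A factor `Y i` of the other sequence determines barycentric coordinates in the first od up to
$1/100$. Points of that factor are replaced by grid cells fine enough for this, and then $N$ is
taken so large that nearby points of the $N$-th od go to equal or adjacent cells. Hysteresis makes
the resulting map exact on edges. -/
theorem exists_factors {n : ℕ} (hn : 3 ≤ n) (h : IsSimpleOdLike (n - 1) (K n hn)) :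
    ∃ N, Factors n N := by
  classical
  obtain ⟨Y, _, F, hod, hF, ⟨Φ⟩⟩ := h
  choose U U1 U2 U3 using fun i => (hod i).exists_coord
  let p : ∀ i : ℕ, K n hn → Fin (n - 1) → ℝ := fun i z => U i ((Φ z).1 i)
  have hp : ∀ i, Continuous (p i) := fun i => (U1 i).comp ((continuous_apply i).comp
    (continuous_subtype_val.comp Φ.continuous))
  have hp3 : ∀ i z, ∃ e t, 0 ≤ t ∧ t ≤ 1 ∧ p i z = Pi.single e t := fun i z => U3 i _
  let q : K n hn → Fin (n + 3) → ℝ := fun z c => bary n c (z.1 0).1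
  have hq : Continuous q := continuous_pi fun c => (continuous_bary n c).comp
    (continuous_subtype_val.comp ((continuous_apply 0).comp continuous_subtype_val))
  obtain ⟨i, η, hη, h1⟩ := exists_factor_approx hq hp (fun i z z' h => by
      have := U2 _ h
      simp only [p]
      rw [← (Φ z).2 i, ← (Φ z').2 i, this])
    (fun z z' h => Φ.injective (Subtype.ext (funext fun i => U2 i (h i))))
    (ε := 1 / 100) (by norm_num)
  obtain ⟨M, hM⟩ := exists_nat_one_div_lt hη
  obtain ⟨N, δ, hδ, h2⟩ := exists_factor_approx (hp i) (p := fun N (z : K n hn) => z.1 N)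
    (fun N => (continuous_apply N).comp continuous_subtype_val)
    (fun N z z' h => by rw [← z.2 N, ← z'.2 N, h])
    (fun z z' h => Subtype.ext (funext h)) (ε := 1 / ((M + 1 : ℕ) : ℝ)) (by positivity)
  refine ⟨N, ?_⟩
  have hZ : ∀ x : Od n, ∃ z : K n hn, z.1 N = x := fun x => by
    obtain ⟨z, h1, h2⟩ := exists_mem_inverseLimit (fun _ => bonding_surjective hn) N x
    exact ⟨⟨z, h1⟩, h2⟩
  -- An arbitrary section suffices, as only distances that are controlled by the $N$-th coordinate
  -- are used.
  choose Z hZ using hZ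
  let g : Od n → ℕ × ℕ := fun x => grid (M + 1) (p i (Z x))
  have h0Od : (0 : Fin n → ℝ) ∈ Od n := ⟨⟨0, by omega⟩, 0, le_rfl, by positivity, by simp [armPoint]⟩
  let rep : ℕ × ℕ → Od n := fun y => if h : ∃ x, g x = y then h.choose else ⟨0, h0Od⟩
  have hrep : ∀ x, g (rep (g x)) = g x := fun x => by
    have h : ∃ x', g x' = g x := ⟨x, rfl⟩
    have : rep (g x) = h.choose := dif_pos h
    rw [this]; exact h.choose_spec
  -- The weights are read off at one representative of each cell, so that they depend on the cell
  -- alone.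
  let B : ℕ × ℕ → ℕ → ℝ := fun y c => if c ≤ n + 2 then bary n c ((Z (rep y)).1 0).1 else 0
  have hB : ∀ x c, c ≤ n + 2 → |B (g x) c - bary n c ((phi n)^[N] x.1)| < 1 / 100 := by
    intro x c hc
    have hd := dist_le_of_grid_eq (hp3 i _) (hp3 i _) (Nat.succ_pos M) (hrep x)
    have hd' : dist (p i (Z (rep (g x)))) (p i (Z x)) < η :=
      hd.trans_lt (by rw [Nat.succ_eq_add_one]; push_cast; exact hM)
    have := (dist_le_pi_dist (q (Z (rep (g x)))) (q (Z x)) ⟨c, by omega⟩).trans_lt (h1 _ _ hd')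
    rw [Real.dist_eq] at this
    have e : (phi n)^[N] x.1 = ((Z x).1 0).1 := by
      have := K_iterate (Z x) 0 N
      rwa [Nat.zero_add, hZ] at this
    rw [e]
    simp only [B]
    rw [if_pos hc]
    exact this
  have hT : ∀ y, ∃ c, 1 / 2 ≤ B y c := fun y => by
    obtain ⟨c, hc, hc'⟩ := exists_half_le_bary hn ((Z (rep y)).1 0).2
    exact ⟨c, by simp only [B]; rwa [if_pos hc]⟩
  choose T hT using hT
  have hmain : ∀ x x' (hx : x ∈ Od n) (hx' : x' ∈ Od n), SubEdge n N x x' → ∃ a,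
      (phi n)^[N] x = vertex n a ∧ hysLabel B T (g ⟨x, hx⟩) = a ∧
      OAdj (contract (hysLabel B T) (g ⟨x, hx⟩)) (contract (hysLabel B T) (g ⟨x', hx'⟩)) := by
    intro x x' hx hx' hE
    obtain ⟨a, b, hab, hl⟩ := hE.linear hn
    have hne : a ≠ b := by unfold Adj₀ at hab; omega
    -- The edge is cut into $2J$ pieces shorter than $\delta$; an even number makes the midpoint a
    -- division point.
    obtain ⟨J, hJ⟩ := exists_nat_gt (dist x x' / δ)
    have hJ0 : (0 : ℝ) < J := (by positivity : (0:ℝ) ≤ dist x x' / δ).trans_lt hJ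
    have hJ0' : 0 < J := by exact_mod_cast hJ0
    have hpar : ∀ j ≤ 2 * J, (0 : ℝ) ≤ (j : ℝ) / (2 * J) ∧ (j : ℝ) / (2 * J) ≤ 1 := fun j hj =>
      ⟨by positivity, by
        rw [div_le_one (by positivity)]
        exact_mod_cast hj⟩
    let P : ℕ → Od n := fun j => if hj : j ≤ 2 * J then
      ⟨AffineMap.lineMap x x' ((j : ℝ) / (2 * J)), hE.mem_Od hn (hpar j hj).1 (hpar j hj).2⟩
      else ⟨x, hx⟩
    have hP : ∀ j ≤ 2 * J, (P j).1 = AffineMap.lineMap x x' ((j : ℝ) / (2 * J)) := fun j hj => by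
      simp only [P]; rw [dif_pos hj]
    have hbary := fun j hj => bary_lineMap hn hab (hpar j hj).1 (hpar j hj).2
    have hit : ∀ j ≤ 2 * J, (phi n)^[N] (P j).1 =
        AffineMap.lineMap (vertex n a) (vertex n b) ((j : ℝ) / (2 * J)) := fun j hj => by
      rw [hP j hj, hl _ (hpar j hj).1 (hpar j hj).2]
    have := contract_adj_of_path hT hne (y := fun j => g (P j)) hJ0' (fun j _ => grid_norm _)
      (fun j hj => ?_) (fun j hj => ?_) (fun j hj => ?_) (fun j hj d hd hd' => ?_)
    · have e0 : P 0 = ⟨x, hx⟩ := Subtype.ext (by rw [hP 0 (Nat.zero_le _)]; simp)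
      have e1 : P (2 * J) = ⟨x', hx'⟩ := Subtype.ext (by
        rw [hP _ le_rfl]
        push_cast
        rw [div_self (by positivity), AffineMap.lineMap_apply_one])
      simp only [e0, e1] at this
      refine ⟨a, ?_, this⟩
      have := hl 0 le_rfl zero_le_one
      rwa [AffineMap.lineMap_apply_zero, AffineMap.lineMap_apply_zero] at this
    · refine grid_step (hp3 i _) (hp3 i _) ?_
      have hd : dist (Z (P j) |>.1 N) (Z (P (j + 1)) |>.1 N) < δ := by
        rw [hZ, hZ, Subtype.dist_eq, hP j (by omega), hP (j + 1) (by omega), dist_lineMap_lineMap,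
          Real.dist_eq]
        have : (j : ℝ) / (2 * J) - ((j + 1 : ℕ) : ℝ) / (2 * J) = - (1 / (2 * J)) := by
          push_cast; field_simp; ring
        rw [this, abs_neg, abs_of_pos (by positivity)]
        rw [div_lt_iff₀ hδ] at hJ
        rw [one_div, inv_mul_lt_iff₀ (by positivity)]
        nlinarith [dist_nonneg (x := x) (y := x')]
      have := h2 _ _ hd
      rw [lt_div_iff₀ (by positivity)] at this
      rwa [mul_comm]
    · have := hB (P j) a (hab.le hn).1
      rwa [hit j hj, (hbary j hj).1] at this
    · have := hB (P j) b (hab.le hn).2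
      rwa [hit j hj, (hbary j hj).2.1] at this
    · by_cases hdn : d ≤ n + 2
      · have := hB (P j) d hdn
        rw [hit j hj, (hbary j hj).2.2 d hd hd', sub_zero] at this
        exact (abs_lt.1 this).2
      · simp only [B]
        rw [if_neg hdn]; norm_num
  have hOd : ∀ {x x'}, SubEdge n N x x' → x ∈ Od n := fun {x x'} h => by
    have := h.mem_Od hn le_rfl zero_le_one
    rwa [AffineMap.lineMap_apply_zero] at this
  let f : (Fin n → ℝ) → ℕ × ℕ := fun x =>
    if hx : x ∈ Od n then contract (hysLabel B T) (g ⟨x, hx⟩) else (0, 0)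
  have hf : ∀ x (hx : x ∈ Od n), f x = contract (hysLabel B T) (g ⟨x, hx⟩) := fun x hx => dif_pos hx
  refine ⟨f, ?_, ?_, ?_, ?_⟩
  · intro x
    simp only [f]
    split_ifs
    · exact opt_fst_lt (grid_fst_lt (by omega) _)
    · simp only; omega
  · intro x
    simp only [f]
    split_ifs
    · exact norm_opt _ _
    · exact fun _ => rfl
  · intro x x' hE
    rw [hf x (hOd hE), hf x' (hOd hE.symm)]
    obtain ⟨a, -, -, h⟩ := hmain x x' (hOd hE) (hOd hE.symm) hE
    exact h
  · rintro x y ⟨x', hx⟩ ⟨y', hy⟩ he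
    obtain ⟨a, a1, a2, -⟩ := hmain x x' (hOd hx) (hOd hx.symm) hx
    obtain ⟨b, b1, b2, -⟩ := hmain y y' (hOd hy) (hOd hy.symm) hy
    rw [hf x (hOd hx), hf y (hOd hy)] at he
    have := label_eq_of_contract_eq (grid_norm _) (grid_norm _) he
    rw [a1, b1, ← a2, ← b2, this]

theorem not_isSimpleOdLike {n : ℕ} (hn : 3 ≤ n) : ¬ IsSimpleOdLike (n - 1) (K n hn) := fun h =>
  have ⟨N, hN⟩ := exists_factors hn h
  not_factors hn N hN


/-! ### Where the bonding map is injective -/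

theorem isPos_arm {n : ℕ} (i : Fin n) {m : ℕ} (h : m ≤ armLen n (i + 1)) : IsPos n ((i : ℕ) + 1, m) :=
  ⟨h, fun _ => ⟨by simp only; omega, by simp only; omega⟩⟩

theorem phi_armPoint_add {n : ℕ} (hn : 3 ≤ n) (i : Fin n) (m : ℕ) {t : ℝ} (h0 : 0 ≤ t)
    (h1 : t ≤ 1) : phi n (armPoint n i (m + t)) =
      AffineMap.lineMap (vertex n (lab n ((i : ℕ) + 1, m))) (vertex n (lab n ((i : ℕ) + 1, m + 1))) t := by
  rw [phi_armPoint n hn, phiArm_add h0 h1]; rfl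

theorem phi_armPoint_nat {n : ℕ} (hn : 3 ≤ n) (i : Fin n) (m : ℕ) :
    phi n (armPoint n i m) = vertex n (lab n ((i : ℕ) + 1, m)) := by
  have := phi_armPoint_add hn i m le_rfl zero_le_one
  rwa [add_zero, AffineMap.lineMap_apply_zero] at this

/-- The labels $n$, $n+1$ and $n+2$ occur only at the last two vertices of an arm. -/
theorem lab_le_of_le {n m : ℕ} (hn : 3 ≤ n) (i : Fin n) (h : m + 2 ≤ armLen n (i + 1)) :
    lab n ((i : ℕ) + 1, m) ≤ n - 1 := by
  have hp := isPos_arm i (by omega : m ≤ armLen n (i + 1))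
  have e : armLen n (i + 1) = if (i : ℕ) + 1 = n - 2 then 2 else if (i : ℕ) + 1 = n - 1 then 4
    else 2 * n := rfl
  rcases pos_cases hn _ hp with h' | h' | h' | h' | h' | h' | ⟨hl, h' | ⟨s, h', hs, hs', h'''⟩ | h' | h'⟩ <;>
    simp only at * <;> try omega
  · rw [if_pos h'.1] at e; omega
  · rw [if_neg (by omega), if_pos h'.1] at e; omega
  · rw [if_neg (by omega), if_pos h'.1] at e; omega
  · have hb := start_bounds hn hl
    have := mid_label_bounds hb.1 hb.2 h' hs h'''
    omega
  · have := hl.2.2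
    rw [if_neg this.1, if_neg this.2] at e; omega
  · have := hl.2.2
    rw [if_neg this.1, if_neg this.2] at e; omega

/-- The labels on the last two edges of an arm. -/
theorem lab_tail {n : ℕ} (hn : 3 ≤ n) (i : Fin n) : 2 ≤ armLen n (i + 1) ∧
    lab n ((i : ℕ) + 1, armLen n (i + 1) - 2) = 0 ∧
    ∃ c : Fin n, n ≤ c + 2 ∧ lab n ((i : ℕ) + 1, armLen n (i + 1) - 1) = c + 1 ∧
      lab n ((i : ℕ) + 1, armLen n (i + 1)) = c + 3 := by
  have hi := i.2
  by_cases h1 : (i : ℕ) + 1 = n - 2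
  · have e : armLen n (i + 1) = 2 := by unfold armLen; rw [if_pos h1]
    rw [e]
    refine ⟨le_rfl, lab_zero hn _ rfl, ⟨n - 2, by omega⟩, by simp only; omega, ?_, ?_⟩
    · rw [lab_one _ rfl]; simp only; omega
    · unfold lab phiVertex
      simp only [h1, if_true]
      simp
      omega
  by_cases h2 : (i : ℕ) + 1 = n - 1
  · have e : armLen n (i + 1) = 4 := by unfold armLen; rw [if_neg h1, if_pos h2]
    rw [e]
    refine ⟨by omega, ?_, ⟨n - 1, by omega⟩, by simp only; omega, ?_, ?_⟩ <;>
      (unfold lab phiVertex; simp only [if_neg h1, if_pos h2]; simp; try omega)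
  have e : armLen n (i + 1) = 2 * n := by unfold armLen; rw [if_neg h1, if_neg h2]
  have hL : Long n (i + 1) := ⟨by omega, by omega, h1, h2⟩
  rw [e]
  refine ⟨by omega, lab_long_even _ hL (by simp only; omega) (by simp only; omega),
    ⟨n - 1, by omega⟩, by simp only; omega, ?_, ?_⟩
  · rw [lab_long_pre hn _ hL rfl]; simp only; omega
  · rw [lab_long_end hn _ hL rfl]; simp only; omega

theorem vertex_inner {n : ℕ} (i : Fin n) :
    vertex n (i + 1) = armPoint n i (vertexDist n (i + 1)) :=
  vertex_eq_armPoint n _ i (Or.inr (by unfold vertexArm; rw [if_pos (by omega)]))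

theorem vertex_outer {n : ℕ} (hn : 3 ≤ n) {i : Fin n} (hi : n ≤ i + 2) :
    vertex n (i + 3) = armPoint n i (vertexDist n (i + 1) + 1) := by
  obtain ⟨j, c, d, h1, h2⟩ := adj₀_cases hn (a := i + 1) (b := i + 3) (by unfold Adj₀; omega)
  rcases h2 with ⟨h2, h3, -⟩ | ⟨h2, h3, -, -, h4⟩
  · omega
  · have hc : c = i + 1 ∧ d = i + 3 := by omega
    obtain rfl : j = i := Fin.ext (by omega)
    rw [← hc.2, h4]

/-- On the last two edges of an arm the bonding map is injective. -/
theorem injOn_tail {n : ℕ} (hn : 3 ≤ n) (i : Fin n) :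
    Set.InjOn (fun t => phi n (armPoint n i t))
      (Set.Icc ((armLen n (i + 1) : ℝ) - 2) (armLen n (i + 1))) := by
  obtain ⟨h2, l0, c, hc, l1, l2⟩ := lab_tail hn i
  have hD : (1 : ℝ) ≤ vertexDist n (c + 1) := by
    exact_mod_cast vertexDist_pos hn (Nat.succ_ne_zero _)
  generalize hL : armLen n (i + 1) = L at *
  have hL2 : ((L - 2 : ℕ) : ℝ) = L - 2 := by rw [Nat.cast_sub h2]; norm_num
  have hL1 : ((L - 1 : ℕ) : ℝ) = L - 1 := by rw [Nat.cast_sub (by omega)]; norm_num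
  have key : ∀ t ∈ Set.Icc ((L : ℝ) - 2) L, phi n (armPoint n i t) =
      armPoint n c (if t ≤ L - 1 then vertexDist n (c + 1) * (t - (L - 2))
        else vertexDist n (c + 1) + (t - (L - 1))) := by
    rintro t ⟨h0, h1⟩
    split_ifs with ht
    · have := phi_armPoint_add hn i (L - 2) (t := t - (L - 2)) (by linarith) (by linarith)
      rw [hL2, add_sub_cancel, l0, show L - 2 + 1 = L - 1 by omega, l1, vertex_inner,
        vertex_eq_armPoint n 0 c (Or.inl rfl), lineMap_armPoint, AffineMap.lineMap_apply_module] at this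
      rw [this]
      congr 1
      simp [vertexDist, mul_comm]
    · have := phi_armPoint_add hn i (L - 1) (t := t - (L - 1)) (by linarith) (by linarith)
      rw [hL1, add_sub_cancel, l1, show L - 1 + 1 = L by omega, l2, vertex_inner,
        vertex_outer hn hc, lineMap_armPoint, AffineMap.lineMap_apply_module] at this
      rw [this]
      congr 1
      simp only [smul_eq_mul]
      ring
  intro s hs t ht hst
  simp only at hst
  rw [key s hs, key t ht] at hst
  have := Pi.single_injective (M := fun _ : Fin n => ℝ) c hst
  split_ifs at this with h3 h4 h4
  · have := mul_left_cancel₀ (by linarith) this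
    linarith
  · nlinarith
  · nlinarith
  · linarith

theorem injOn_edge {n : ℕ} (hn : 3 ≤ n) (i : Fin n) {m : ℕ} (hm : m < armLen n (i + 1)) :
    Set.InjOn (fun t => phi n (armPoint n i t)) (Set.Icc (m : ℝ) (m + 1)) := by
  have hadj := adj_phiVertex n hn (i + 1) m hm
  have key : ∀ t ∈ Set.Icc (m : ℝ) (m + 1), phi n (armPoint n i t) =
      AffineMap.lineMap (vertex n (lab n ((i : ℕ) + 1, m))) (vertex n (lab n ((i : ℕ) + 1, m + 1))) (t - m) := by
    rintro t ⟨h0, h1⟩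
    rw [← phi_armPoint_add hn i m (by linarith) (by linarith), add_sub_cancel]
  intro s hs t ht hst
  simp only at hst
  rw [key s hs, key t ht] at hst
  have hne : vertex n (lab n ((i : ℕ) + 1, m)) ≠ vertex n (lab n ((i : ℕ) + 1, m + 1)) := by
    intro h
    have h1 := vertex_inj hn (lab_le hn (isPos_arm i hm.le)) 
      (lab_le hn (isPos_arm i (m := m + 1) hm)) h
    have hadj : Adj₀ n (lab n ((i : ℕ) + 1, m)) (lab n ((i : ℕ) + 1, m + 1)) := hadj
    rw [h1] at hadj
    unfold Adj₀ at hadj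
    omega
  have := AffineMap.lineMap_injective ℝ hne hst
  linarith

/-! ### Sequences of connected sets -/

/-- The projections of a connected subset of the inverse limit. -/
structure ConnSeq (n : ℕ) (S : ℕ → Set (Fin n → ℝ)) : Prop where
  conn : ∀ j, IsPreconnected (S j)
  nonempty : ∀ j, (S j).Nonempty
  sub : ∀ j, S j ⊆ Od n
  image : ∀ j, phi n '' S (j + 1) = S j

namespace ConnSeq

variable {n : ℕ} {S : ℕ → Set (Fin n → ℝ)}

theorem phi_mem (h : ConnSeq n S) {j : ℕ} {x : Fin n → ℝ} (hx : x ∈ S (j + 1)) : phi n x ∈ S j :=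
  h.image j ▸ Set.mem_image_of_mem _ hx

theorem exists_phi (h : ConnSeq n S) {j : ℕ} {x : Fin n → ℝ} (hx : x ∈ S j) :
    ∃ y ∈ S (j + 1), phi n y = x := by
  rw [← h.image j] at hx; exact hx

theorem coord_ge (h : ConnSeq n S) {j : ℕ} {x : Fin n → ℝ} (hx : x ∈ S j) (i : Fin n) :
    0 ≤ x i ∧ x i ≤ armLen n (i + 1) := by
  obtain ⟨i', t, h0, h1, rfl⟩ := h.sub j hx
  by_cases hi : i = i'
  · subst hi; simp only [armPoint, Pi.single_eq_same]; exact ⟨h0, h1⟩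
  · simp [armPoint, Pi.single_eq_of_ne hi]

theorem eq_armPoint (h : ConnSeq n S) {j : ℕ} {x : Fin n → ℝ} (hx : x ∈ S j) {i : Fin n}
    (hi : x i ≠ 0) : x = armPoint n i (x i) := by
  obtain ⟨i', t, h0, h1, rfl⟩ := h.sub j hx
  have : i = i' := by
    by_contra hne
    exact hi (Pi.single_eq_of_ne hne _)
  subst this
  simp [armPoint]

/-- Intermediate values on an arm. -/
theorem armPoint_mem (h : ConnSeq n S) {j : ℕ} {x y : Fin n → ℝ} (hx : x ∈ S j) (hy : y ∈ S j)
    (i : Fin n) {t : ℝ} (h0 : 0 < t) (h1 : x i ≤ t) (h2 : t ≤ y i) : armPoint n i t ∈ S j := by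
  have hc := (h.conn j).image (fun x => x i) (continuous_apply i).continuousOn
  obtain ⟨z, hz, hzt⟩ := hc.Icc_subset ⟨x, hx, rfl⟩ ⟨y, hy, rfl⟩ ⟨h1, h2⟩
  simp only at hzt
  have := h.eq_armPoint hz (i := i) (by rw [hzt]; exact h0.ne')
  rw [hzt] at this
  rwa [← this]

theorem zero_mem_of_succ (hn : 3 ≤ n) (h : ConnSeq n S) {j : ℕ} (h0 : (0 : Fin n → ℝ) ∈ S (j + 1)) :
    (0 : Fin n → ℝ) ∈ S j := by
  have := h.phi_mem h0
  have e := phi_armPoint_nat hn ⟨0, by omega⟩ 0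
  rw [lab_zero hn _ rfl, vertex_zero] at e
  simp only [armPoint, Nat.cast_zero, Pi.single_zero] at e
  rwa [e] at this

theorem zero_notMem_of_le (hn : 3 ≤ n) (h : ConnSeq n S) {j k : ℕ} (hjk : j ≤ k)
    (h0 : (0 : Fin n → ℝ) ∉ S j) : (0 : Fin n → ℝ) ∉ S k := by
  induction k, hjk using Nat.le_induction with
  | base => exact h0
  | succ k _ ih => exact fun h1 => ih (h.zero_mem_of_succ hn h1)

/-- A connected set that misses the centre lies in one arm. -/
theorem exists_arm (h : ConnSeq n S) {j : ℕ} (h0 : (0 : Fin n → ℝ) ∉ S j) :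
    ∃ i : Fin n, ∀ x ∈ S j, 0 < x i ∧ x = armPoint n i (x i) := by
  obtain ⟨y, hy⟩ := h.nonempty j
  obtain ⟨i, hi⟩ : ∃ i, y i ≠ 0 := by
    by_contra hcon
    push Not at hcon
    exact h0 (by rwa [show y = 0 from funext hcon] at hy)
  refine ⟨i, fun x hx => ?_⟩
  suffices hx0 : x i ≠ 0 from ⟨(h.coord_ge hx i).1.lt_of_ne hx0.symm, h.eq_armPoint hx hx0⟩
  intro hx0
  -- On the od this function is positive on arm $i$ and negative on the other arms, and it vanishes
  -- only at the centre; the intermediate value theorem would put the centre into the set.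
  have hg : Continuous fun x : Fin n → ℝ => x i - ∑ k ∈ Finset.univ.erase i, x k := by fun_prop
  have hc := (h.conn j).image _ hg.continuousOn
  have s1 : ∀ x ∈ S j, 0 ≤ ∑ k ∈ Finset.univ.erase i, x k := fun x hx =>
    Finset.sum_nonneg fun k _ => (h.coord_ge hx k).1
  have s2 : ∑ k ∈ Finset.univ.erase i, y k = 0 := by
    refine Finset.sum_eq_zero fun k hk => ?_
    rw [h.eq_armPoint hy hi]
    exact Pi.single_eq_of_ne (Finset.ne_of_mem_erase hk) _
  obtain ⟨z, hz, hzt⟩ := hc.Icc_subset ⟨x, hx, rfl⟩ ⟨y, hy, rfl⟩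
    (show (0 : ℝ) ∈ Set.Icc _ _ from ⟨by
      simp only; rw [hx0]; linarith [s1 x hx], by
      simp only; rw [s2]; linarith [(h.coord_ge hy i).1]⟩)
  simp only at hzt
  apply h0
  have hz0 : z = 0 := by
    by_cases hzi : z i = 0
    · rw [hzi] at hzt
      have hs : ∑ k ∈ Finset.univ.erase i, z k = 0 := by linarith
      rw [Finset.sum_eq_zero_iff_of_nonneg fun k _ => (h.coord_ge hz k).1] at hs
      funext k
      by_cases hk : k = i
      · rw [hk, hzi]; rfl
      · exact hs k (Finset.mem_erase.2 ⟨hk, Finset.mem_univ k⟩)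
    · have hs : ∑ k ∈ Finset.univ.erase i, z k = 0 := by
        refine Finset.sum_eq_zero fun k hk => ?_
        rw [h.eq_armPoint hz hzi]
        exact Pi.single_eq_of_ne (Finset.ne_of_mem_erase hk) _
      rw [hs] at hzt
      exact absurd (by linarith) hzi
  rwa [hz0] at hz

/-- `S` contains the edge of `X₀` between `v_a` and `v_b`. -/
def HasEdge (n : ℕ) (S : Set (Fin n → ℝ)) (a b : ℕ) : Prop :=
  ∀ t : ℝ, 0 ≤ t → t ≤ 1 → AffineMap.lineMap (vertex n a) (vertex n b) t ∈ S

theorem HasEdge.symm {S : Set (Fin n → ℝ)} {a b : ℕ} (h : HasEdge n S a b) : HasEdge n S b a := by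
  intro t h0 h1
  rw [← AffineMap.lineMap_apply_one_sub]
  exact h _ (by linarith) (by linarith)

theorem HasEdge.map_inner (hn : 3 ≤ n) (h : ConnSeq n S) {j : ℕ} (i : Fin n)
    (hE : HasEdge n (S (j + 1)) 0 (i + 1)) {m : ℕ} (hm : m < vertexDist n (i + 1)) :
    HasEdge n (S j) (lab n ((i : ℕ) + 1, m)) (lab n ((i : ℕ) + 1, m + 1)) := by
  intro t h0 h1
  rw [← phi_armPoint_add hn i m h0 h1]
  refine h.phi_mem ?_
  have hD : ((m + 1 : ℕ) : ℝ) ≤ vertexDist n (i + 1) := by exact_mod_cast hm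
  push_cast at hD
  have hD0 : (0 : ℝ) < vertexDist n (i + 1) := by linarith [(Nat.cast_nonneg m : (0 : ℝ) ≤ m)]
  have := hE ((m + t) / vertexDist n (i + 1)) (by positivity) ((div_le_one hD0).2 (by linarith))
  rw [vertex_inner, vertex_eq_armPoint n 0 i (Or.inl rfl), lineMap_armPoint,
    AffineMap.lineMap_apply_module] at this
  convert this using 2
  have e0 : vertexDist n 0 = 0 := rfl
  rw [e0]
  generalize (vertexDist n (i + 1) : ℝ) = D at hD0
  simp only [Nat.cast_zero, smul_eq_mul, mul_zero, zero_add]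
  field_simp

theorem HasEdge.map_outer (hn : 3 ≤ n) (h : ConnSeq n S) {j : ℕ} {i : Fin n} (hi : n ≤ i + 2)
    (hE : HasEdge n (S (j + 1)) (i + 1) (i + 3)) :
    HasEdge n (S j) (lab n ((i : ℕ) + 1, vertexDist n (i + 1)))
      (lab n ((i : ℕ) + 1, vertexDist n (i + 1) + 1)) := by
  intro t h0 h1
  rw [← phi_armPoint_add hn i _ h0 h1]
  refine h.phi_mem ?_
  have := hE t h0 h1
  rw [vertex_inner, vertex_outer hn hi, lineMap_armPoint, AffineMap.lineMap_apply_module] at this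
  convert this using 2
  simp only [smul_eq_mul]
  ring

/-- If one of the sets contains an edge at the centre, then an earlier one is everything. -/
theorem eq_Od_of_hasEdge (hn : 3 ≤ n) (h : ConnSeq n S) {j : ℕ} {c : Fin n}
    (hE : HasEdge n (S (j + 5)) 0 (c + 1)) : Od n ⊆ S j := by
  have hb : ∀ k, lab n (n - 1, k) = if k = 0 then 0 else if k = 1 then n - 1 else
      if k = 2 then 0 else if k = 3 then n else n + 2 := fun k => by
    unfold lab phiVertex
    simp only [if_true]
    rw [if_neg (by omega)]
  have hL : Long n n := ⟨by omega, le_rfl, by omega, by omega⟩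
  obtain ⟨ia, hia⟩ : ∃ i : Fin n, (i : ℕ) + 1 = n := ⟨⟨n - 1, by omega⟩, by simp only; omega⟩
  obtain ⟨ib, hib⟩ : ∃ i : Fin n, (i : ℕ) + 1 = n - 1 := ⟨⟨n - 2, by omega⟩, by simp only; omega⟩
  obtain ⟨iz, hiz⟩ : ∃ i : Fin n, (i : ℕ) + 1 = n - 2 := ⟨⟨n - 3, by omega⟩, by simp only; omega⟩
  have da : vertexDist n n = 2 * n - 1 := by
    unfold vertexDist; rw [if_neg (by omega), if_neg (by omega), if_pos rfl]
  have db : vertexDist n (n - 1) = 3 := by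
    unfold vertexDist; rw [if_neg (by omega), if_pos rfl]
  have dz : vertexDist n (n - 2) = 2 := by
    have e : vertexArm n (n - 2) = n - 2 := if_pos (by omega)
    unfold vertexDist
    rw [if_neg (by omega), if_neg (by omega), if_neg (by omega), e]
    exact if_pos rfl
  -- Every arm starts with the labels $0,n-1$. Next, arm $n-1$ covers $v_0v_n$, and arm $n$ covers
  -- all edges at $v_0$. The edge $v_{n-1}v_{n+1}$ comes from arm $n-2$, and one step later gives
  -- $v_nv_{n+2}$.
  have s1 : HasEdge n (S (j + 4)) 0 (n - 1) := by
    have := HasEdge.map_inner hn h c hE (m := 0) (vertexDist_pos hn (Nat.succ_ne_zero _))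
    rwa [lab_zero hn _ rfl, lab_one _ rfl] at this
  have s2 : HasEdge n (S (j + 3)) 0 n := by
    have := HasEdge.map_inner hn h (j := j + 3) ib (by rw [hib]; exact s1) (m := 2) (by rw [hib, db]; omega)
    rw [hib, hb, hb] at this
    simpa using this
  have all : ∀ j, HasEdge n (S (j + 1)) 0 n → ∀ b, 1 ≤ b → b ≤ n → HasEdge n (S j) 0 b := by
    intro j hE b h1 h2
    have key := fun m (hm : m < 2 * n - 1) =>
      HasEdge.map_inner hn h (j := j) ia (by rw [hia]; exact hE) (m := m) (by rw [hia, da]; exact hm)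
    simp only [hia] at key
    obtain ⟨s, hs, hs'⟩ : ∃ s, s ≤ n - 1 ∧ oddLab n n s = b := by
      by_cases e1 : b = n - 1
      · exact ⟨0, by omega, by rw [oddLab_zero, e1]⟩
      by_cases e2 : b = n
      · exact ⟨n - 1, le_rfl, by rw [oddLab_last hn hL, e2]⟩
      · obtain ⟨s, s1, s2, s3⟩ := exists_oddLab_eq hn hL h1 (by omega : b ≤ n - 2)
        exact ⟨s, by omega, s3⟩
    have := key (2 * s) (by omega)
    rw [lab_long_even _ hL (by simp only; omega) (by simp only; omega)] at this
    rw [← hs']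
    exact this
  have s3 := all _ s2
  have s4 := all _ (s3 n (by omega) le_rfl)
  have s5 := all _ (s4 n (by omega) le_rfl)
  have outb : ∀ j, HasEdge n (S (j + 1)) 0 (n - 2) → HasEdge n (S j) (n - 1) (n + 1) := by
    intro j hE
    have := HasEdge.map_inner hn h (j := j) iz (by rw [hiz]; exact hE) (m := 1) (by rw [hiz, dz]; omega)
    rw [hiz, lab_one _ rfl] at this
    have e : lab n (n - 2, 1 + 1) = n + 1 := by simp [lab, phiVertex]
    rwa [e] at this
  have o4 := outb _ (s3 (n - 2) (by omega) (by omega))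
  have o5 := outb _ (s4 (n - 2) (by omega) (by omega))
  have a5 : HasEdge n (S j) n (n + 2) := by
    have := HasEdge.map_outer hn h (j := j) (i := ib) (by omega) (by
      rw [hib, show (ib : ℕ) + 3 = n + 1 by omega]; exact o4)
    rw [hib, db, hb, hb] at this
    simpa using this
  intro x hx
  obtain ⟨a, b, hab, t, h0, h1, rfl⟩ := exists_edge_of_mem_Od hn hx
  have key : ∀ a b : ℕ, ((a = 0 ∧ 1 ≤ b ∧ b ≤ n) ∨ (a = n - 1 ∧ b = n + 1) ∨ (a = n ∧ b = n + 2)) →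
      HasEdge n (S j) a b := by
    rintro a b (⟨rfl, h1, h2⟩ | ⟨rfl, rfl⟩ | ⟨rfl, rfl⟩)
    · exact s5 b h1 h2
    · exact o5
    · exact a5
  rcases hab with hab | hab
  · exact key a b hab t h0 h1
  · exact (key b a hab).symm t h0 h1

end ConnSeq
namespace ConnSeq

variable {n : ℕ} {S : ℕ → Set (Fin n → ℝ)}

theorem Od_subset_of_succ (hn : 3 ≤ n) (h : ConnSeq n S) {j : ℕ} (hj : Od n ⊆ S (j + 1)) :
    Od n ⊆ S j := by
  intro x hx
  obtain ⟨y, hy⟩ := bonding_surjective hn ⟨x, hx⟩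
  have : phi n y = x := congrArg Subtype.val hy
  rw [← this]
  exact h.phi_mem (hj y.2)

theorem Od_subset_of_le (hn : 3 ≤ n) (h : ConnSeq n S) {j k : ℕ} (hjk : j ≤ k) (hk : Od n ⊆ S k) :
    Od n ⊆ S j := by
  induction k, hjk using Nat.le_induction with
  | base => exact hk
  | succ k _ ih => exact ih (h.Od_subset_of_succ hn hk)

theorem hasEdge_of_le (h : ConnSeq n S) {j : ℕ} (h0 : (0 : Fin n → ℝ) ∈ S j) {x : Fin n → ℝ}
    (hx : x ∈ S j) {i : Fin n} (hi : (vertexDist n (i + 1) : ℝ) ≤ x i) :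
    HasEdge n (S j) 0 (i + 1) := by
  intro t ht0 ht1
  rw [vertex_inner, vertex_eq_armPoint n 0 i (Or.inl rfl), lineMap_armPoint,
    AffineMap.lineMap_apply_module, show vertexDist n 0 = 0 from rfl, Nat.cast_zero, smul_zero,
    zero_add, smul_eq_mul]
  have hD : (0 : ℝ) ≤ vertexDist n (i + 1) := Nat.cast_nonneg _
  rcases (mul_nonneg ht0 hD).eq_or_lt with h1 | h1
  · rw [← h1]; simpa [armPoint] using h0
  · exact h.armPoint_mem h0 hx i h1 h1.le (by nlinarith)

/-- The alternatives for a sequence that contains the centre. -/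
theorem dichotomy_of_zero_mem (hn : 3 ≤ n) (h : ConnSeq n S) (h0 : ∀ j, (0 : Fin n → ℝ) ∈ S j) :
    (∀ j, Od n ⊆ S j) ∨ ∃ (J : ℕ) (i : Fin n), (∀ x ∈ S J, x = armPoint n i (x i)) ∧
      ∀ j, J ≤ j → Set.InjOn (phi n) (S (j + 1)) := by
  by_cases hE : ∀ J, ∃ j, J ≤ j ∧ ∃ c : Fin n, HasEdge n (S j) 0 (c + 1)
  · left
    intro i
    obtain ⟨j, hj, c, hc⟩ := hE (i + 5)
    obtain ⟨j, rfl⟩ : ∃ j', j = j' + 5 := ⟨j - 5, by omega⟩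
    exact h.Od_subset_of_le hn (by omega) (eq_Od_of_hasEdge hn h hc)
  right
  push Not at hE
  obtain ⟨J, hJ⟩ := hE
  obtain ⟨ib, hib⟩ : ∃ i : Fin n, (i : ℕ) + 1 = n - 1 := ⟨⟨n - 2, by omega⟩, by simp only; omega⟩
  -- The point at distance $1$ on any arm is sent to $v_{n-1}$, and together with the centre this
  -- would give an edge one level lower.
  have lt_one : ∀ j, J ≤ j → ∀ x ∈ S (j + 1), ∀ i, x i < 1 := by
    intro j hj x hx i
    by_contra hge
    have h1 := h.phi_mem (h.armPoint_mem (h0 (j + 1)) hx i one_pos zero_le_one (not_lt.1 hge))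
    have e := phi_armPoint_nat hn i 1
    rw [Nat.cast_one, lab_one _ rfl, ← hib] at e
    rw [e] at h1
    refine hJ j hj ib (h.hasEdge_of_le (h0 j) h1 ?_)
    rw [vertex_inner]
    simp [armPoint]
  have arm : ∀ j, J ≤ j → ∀ x ∈ S j, x = armPoint n ib (x ib) := by
    intro j hj x hx
    obtain ⟨y, hy, rfl⟩ := h.exists_phi hx
    obtain ⟨i, t, ht0, -, rfl⟩ := h.sub _ hy
    have ht1 := lt_one j hj _ hy i
    simp only [armPoint, Pi.single_eq_same] at ht1
    have e := phi_armPoint_add hn i 0 ht0 ht1.le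
    rw [Nat.cast_zero, zero_add, lab_zero hn _ rfl, lab_one _ rfl, ← hib, vertex_inner,
      vertex_eq_armPoint n 0 ib (Or.inl rfl), lineMap_armPoint] at e
    rw [e]
    simp [armPoint]
  refine ⟨J, ib, arm J le_rfl, fun j hj x hx y hy hxy => ?_⟩
  have hpos : 0 < armLen n (ib + 1) := by unfold armLen; split_ifs <;> omega
  have ex := arm (j + 1) (by omega) x hx
  have ey := arm (j + 1) (by omega) y hy
  have := injOn_edge hn ib hpos (x₁ := x ib) (x₂ := y ib)
    ⟨by simpa using (h.coord_ge hx ib).1, by simpa using (lt_one j hj x hx ib).le⟩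
    ⟨by simpa using (h.coord_ge hy ib).1, by simpa using (lt_one j hj y hy ib).le⟩
    (by simp only; rw [← ex, ← ey, hxy])
  rw [ex, ey, this]

/-- Vertices other than the centre eventually reach the last edge of arm `n`. -/
theorem vertex_mem_of_vertex_mem (hn : 3 ≤ n) (h : ConnSeq n S) :
    (∀ j, vertex n n ∈ S (j + 1) ∨ vertex n (n + 2) ∈ S (j + 1) →
      vertex n n ∈ S j ∨ vertex n (n + 2) ∈ S j) ∧
    ∀ j c, 1 ≤ c → c ≤ n - 1 → vertex n c ∈ S (j + 2) → vertex n n ∈ S j ∨ vertex n (n + 2) ∈ S j := by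
  have hb : ∀ k, lab n (n - 1, k) = if k = 0 then 0 else if k = 1 then n - 1 else
      if k = 2 then 0 else if k = 3 then n else n + 2 := fun k => by
    unfold lab phiVertex
    simp only [if_true]
    rw [if_neg (by omega)]
  have hL : Long n n := ⟨by omega, le_rfl, by omega, by omega⟩
  obtain ⟨ia, hia⟩ : ∃ i : Fin n, (i : ℕ) + 1 = n := ⟨⟨n - 1, by omega⟩, by simp only; omega⟩
  obtain ⟨ib, hib⟩ : ∃ i : Fin n, (i : ℕ) + 1 = n - 1 := ⟨⟨n - 2, by omega⟩, by simp only; omega⟩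
  have da : vertexDist n n = 2 * n - 1 := by
    unfold vertexDist; rw [if_neg (by omega), if_neg (by omega), if_pos rfl]
  have db : vertexDist n (n - 1) = 3 := by
    unfold vertexDist; rw [if_neg (by omega), if_pos rfl]
  -- The vertices $v_n$ and $v_{n+2}$ are fixed, while $v_{n-1}$ goes to $v_n$ and $v_{n+1}$ to
  -- $v_{n+2}$; the others reach one of the fixed vertices within two steps.
  have fn : phi n (vertex n n) = vertex n n := by
    have e := vertex_inner ia
    rw [hia, da] at e
    nth_rw 1 [e]
    rw [phi_armPoint_nat hn, hia, lab_long_pre hn _ hL rfl]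
  have fn2 : phi n (vertex n (n + 2)) = vertex n (n + 2) := by
    have e := vertex_outer hn (i := ia) (by omega)
    rw [hia, show (ia : ℕ) + 3 = n + 2 by omega, da,
      show ((2 * n - 1 : ℕ) : ℝ) + 1 = (2 * n : ℕ) by
        rw [← Nat.cast_succ]; congr 1; omega] at e
    nth_rw 1 [e]
    rw [phi_armPoint_nat hn, hia, lab_long_end hn _ hL rfl]
  have fb : phi n (vertex n (n - 1)) = vertex n n := by
    have e := vertex_inner ib
    rw [hib, db] at e
    rw [e, phi_armPoint_nat hn, hib, hb]
    simp
  have fb2 : phi n (vertex n (n + 1)) = vertex n (n + 2) := by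
    have e := vertex_outer hn (i := ib) (by omega)
    rw [hib, show (ib : ℕ) + 3 = n + 1 by omega, db,
      show ((3 : ℕ) : ℝ) + 1 = (4 : ℕ) by norm_num] at e
    rw [e, phi_armPoint_nat hn, hib, hb]
    simp
  have step : ∀ j, vertex n n ∈ S (j + 1) ∨ vertex n (n + 2) ∈ S (j + 1) →
      vertex n n ∈ S j ∨ vertex n (n + 2) ∈ S j := by
    rintro j (hj | hj)
    · left; have := h.phi_mem hj; rwa [fn] at this
    · right; have := h.phi_mem hj; rwa [fn2] at this
  refine ⟨step, fun j c h1 h2 hc => ?_⟩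
  have hc' := h.phi_mem hc
  by_cases c1 : c = n - 1
  · rw [c1, fb] at hc'
    exact step j (Or.inl hc')
  obtain ⟨i, hi⟩ : ∃ i : Fin n, (i : ℕ) + 1 = c := ⟨⟨c - 1, by omega⟩, by simp only; omega⟩
  have e := vertex_inner i
  have ev : vertexArm n c = c := if_pos (by omega)
  have ed : vertexDist n c = armLen n c := by
    unfold vertexDist; rw [if_neg (by omega), if_neg c1, if_neg (by omega), ev]
  rw [hi, ed] at e
  rw [e, phi_armPoint_nat hn, hi] at hc'
  by_cases c2 : c = n - 2
  · have el : lab n (c, armLen n c) = n + 1 := by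
      rw [c2]; simp [armLen, lab, phiVertex]
    rw [el] at hc'
    have := h.phi_mem hc'
    rw [fb2] at this
    exact Or.inr this
  · have el : armLen n c = 2 * n := by unfold armLen; rw [if_neg c2, if_neg c1]
    rw [el, lab_long_end hn _ ⟨h1, by omega, c2, c1⟩ rfl] at hc'
    exact step j (Or.inr hc')

/-- Otherwise such vertices of $X_1$ occur at arbitrarily late levels. Since the centre is avoided,
they force $v_n$ or $v_{n+2}$ into every set. Connectedness then yields the vertex $2n-2$ on arm
$n$, which is mapped to the centre. -/
theorem exists_forall_not_integer_mem (hn : 3 ≤ n) (h : ConnSeq n S) {J₀ : ℕ}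
    (h0 : ∀ j, J₀ ≤ j → (0 : Fin n → ℝ) ∉ S j) :
    ∃ J, J₀ ≤ J ∧ ∀ j, J ≤ j → ∀ (i : Fin n) (m : ℕ), 1 ≤ m → m + 2 ≤ armLen n (i + 1) →
      armPoint n i m ∉ S (j + 1) := by
  by_contra hcon
  push Not at hcon
  obtain ⟨step, two⟩ := h.vertex_mem_of_vertex_mem hn
  have down : ∀ k j, j ≤ k → vertex n n ∈ S k ∨ vertex n (n + 2) ∈ S k →
      vertex n n ∈ S j ∨ vertex n (n + 2) ∈ S j := by
    intro k j hjk
    induction k, hjk using Nat.le_induction with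
    | base => exact id
    | succ k _ ih => exact fun hk => ih (step k hk)
  have all : ∀ k, vertex n n ∈ S k ∨ vertex n (n + 2) ∈ S k := by
    intro k
    obtain ⟨j, hj, i, m, h1, h2, hm⟩ := hcon (J₀ + k + 2) (by omega)
    have hv := h.phi_mem hm
    rw [phi_armPoint_nat hn] at hv
    have hc0 : lab n ((i : ℕ) + 1, m) ≠ 0 := by
      intro hc
      rw [hc, vertex_zero] at hv
      exact h0 j (by omega) hv
    obtain ⟨j, rfl⟩ : ∃ j', j = j' + 2 := ⟨j - 2, by omega⟩
    exact down j k (by omega) (two j _ (Nat.one_le_iff_ne_zero.2 hc0) (lab_le_of_le hn i h2) hv)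
  have hL : Long n n := ⟨by omega, le_rfl, by omega, by omega⟩
  obtain ⟨ia, hia⟩ : ∃ i : Fin n, (i : ℕ) + 1 = n := ⟨⟨n - 1, by omega⟩, by simp only; omega⟩
  have ea : armLen n (ia + 1) = 2 * n := by
    unfold armLen; rw [if_neg (by omega), if_neg (by omega)]
  have da : vertexDist n n = 2 * n - 1 := by
    unfold vertexDist; rw [if_neg (by omega), if_neg (by omega), if_pos rfl]
  obtain ⟨j, hj, i, m, h1, h2, hm⟩ := hcon J₀ le_rfl
  obtain ⟨y, hy, hya⟩ : ∃ y ∈ S (j + 1), ((2 * n - 2 : ℕ) : ℝ) ≤ y ia := by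
    rcases all (j + 1) with hv | hv
    · refine ⟨_, hv, ?_⟩
      have e := vertex_inner ia
      rw [hia, da] at e
      rw [e]
      simp only [armPoint, Pi.single_eq_same]
      exact_mod_cast (by omega : 2 * n - 2 ≤ 2 * n - 1)
    · refine ⟨_, hv, ?_⟩
      have e := vertex_outer hn (i := ia) (by omega)
      rw [hia, show (ia : ℕ) + 3 = n + 2 by omega, da] at e
      rw [e]
      simp only [armPoint, Pi.single_eq_same]
      exact_mod_cast (by omega : 2 * n - 2 ≤ 2 * n - 1 + 1)
  have hle : armPoint n i m ia ≤ ((2 * n - 2 : ℕ) : ℝ) := by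
    by_cases hi : i = ia
    · subst hi
      simp only [armPoint, Pi.single_eq_same]
      exact_mod_cast (by omega : m ≤ 2 * n - 2)
    · simp [armPoint, Pi.single_eq_of_ne (Ne.symm hi)]
  have hmem := h.phi_mem (h.armPoint_mem hm hy ia (by exact_mod_cast (by omega : 0 < 2 * n - 2)) hle hya)
  rw [phi_armPoint_nat hn, hia, lab_long_even _ hL (by simp only; omega) (by simp only; omega),
    vertex_zero] at hmem
  exact h0 j hj hmem

/-- Once the centre is avoided, a late set lies in one arm and meets no vertex of $X_1$ before its
last two edges. So it lies in a single edge or in those two, and the map is injective on each of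
these. -/
theorem dichotomy (hn : 3 ≤ n) (h : ConnSeq n S) :
    (∀ j, Od n ⊆ S j) ∨ ∃ (J : ℕ) (i : Fin n), (∀ x ∈ S J, x = armPoint n i (x i)) ∧
      ∀ j, J ≤ j → Set.InjOn (phi n) (S (j + 1)) := by
  by_cases hz : ∀ j, (0 : Fin n → ℝ) ∈ S j
  · exact h.dichotomy_of_zero_mem hn hz
  right
  push Not at hz
  obtain ⟨J₀, hJ₀⟩ := hz
  have h0 : ∀ j, J₀ ≤ j → (0 : Fin n → ℝ) ∉ S j := fun j hj => h.zero_notMem_of_le hn hj hJ₀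
  obtain ⟨J, hJ, hint⟩ := h.exists_forall_not_integer_mem hn h0
  obtain ⟨i₀, hi₀⟩ := h.exists_arm (h0 J hJ)
  refine ⟨J, i₀, fun x hx => (hi₀ x hx).2, fun j hj => ?_⟩
  obtain ⟨i, hi⟩ := h.exists_arm (h0 (j + 1) (by omega))
  have key : ∀ x ∈ S (j + 1), ∀ y ∈ S (j + 1), x i ≤ y i → phi n x = phi n y → x = y := by
    intro x hx y hy hxy he
    obtain ⟨x0, ex⟩ := hi x hx
    obtain ⟨y0, ey⟩ := hi y hy
    have x1 := (h.coord_ge hx i).2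
    have y1 := (h.coord_ge hy i).2
    rw [ex, ey] at he
    suffices x i = y i by rw [ex, ey, this]
    by_cases ht : (armLen n (i + 1) : ℝ) - 2 ≤ x i
    · exact injOn_tail hn i ⟨ht, x1⟩ ⟨ht.trans hxy, y1⟩ he
    · have h2 := (lab_tail hn i).1
      have hlt : x i < ((armLen n (i + 1) - 2 : ℕ) : ℝ) := by
        rw [Nat.cast_sub h2]; push_cast; linarith
      have hfl := Nat.floor_le x0.le
      have hfl' := Nat.lt_floor_add_one (x i)
      have hf : ⌊x i⌋₊ < armLen n (i + 1) - 2 := by exact_mod_cast hfl.trans_lt hlt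
      have hy' : y i < ⌊x i⌋₊ + 1 := by
        by_contra hge
        refine hint j hj i (⌊x i⌋₊ + 1) (by omega) (by omega) ?_
        push_cast
        exact h.armPoint_mem hx hy i (by positivity) hfl'.le (not_lt.1 hge)
      exact injOn_edge hn i (by omega : ⌊x i⌋₊ < armLen n (i + 1)) ⟨hfl, hfl'.le⟩
        ⟨hfl.trans hxy, hy'.le⟩ he
  intro x hx y hy he
  rcases le_total (x i) (y i) with hxy | hxy
  · exact key x hx y hy hxy he
  · exact (key y hy x hx hxy he.symm).symm

end ConnSeq

/-! ### Subcontinua and the remaining properties of the limit -/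

/-- A compact connected set with more than one point that embeds in the line is an arc. -/
theorem isArc_of_injOn {X : Type*} [TopologicalSpace X] {W : Set X} (hW : IsCompact W)
    (hc : IsConnected W) (hnt : W.Nontrivial) {g : X → ℝ} (hg : Continuous g)
    (hinj : Set.InjOn g W) : IsArc W := by
  have := isCompact_iff_compactSpace.1 hW
  have hcl : Topology.IsClosedEmbedding (W.domRestrict g) :=
    (hg.comp continuous_subtype_val).isClosedEmbedding (Set.injOn_iff_injective.1 hinj)
  have himc : IsCompact (g '' W) := hW.image hg
  have himn : IsConnected (g '' W) := hc.image g hg.continuousOn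
  have heq : g '' W = Set.Icc (sInf (g '' W)) (sSup (g '' W)) :=
    eq_Icc_of_connected_compact himn himc
  have hlt : sInf (g '' W) < sSup (g '' W) := by
    obtain ⟨x, hx, y, hy, hxy⟩ := hnt
    have hne : g x ≠ g y := fun h => hxy (hinj hx hy h)
    have h1 : g x ∈ Set.Icc _ _ := heq ▸ Set.mem_image_of_mem g hx
    have h2 : g y ∈ Set.Icc _ _ := heq ▸ Set.mem_image_of_mem g hy
    rcases hne.lt_or_gt with h3 | h3
    · exact (h1.1.trans_lt h3).trans_le h2.2
    · exact (h2.1.trans_lt h3).trans_le h1.2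
  refine ⟨(hcl.isEmbedding.toHomeomorph.trans (Homeomorph.setCongr ?_)).trans (iccHomeoI _ _ hlt)⟩
  rw [Set.range_domRestrict]
  exact heq

theorem isArc_of_subcontinuum {n : ℕ} (hn : 3 ≤ n) (W : Set (K n hn)) (hW : IsCompact W)
    (hc : IsConnected W) (hnt : W.Nontrivial) (hne : W ≠ Set.univ) : IsArc W := by
  have hcont : ∀ j, Continuous fun z : K n hn => (z.1 j).1 := fun j =>
    continuous_subtype_val.comp ((continuous_apply j).comp continuous_subtype_val)
  have hphi : ∀ (z : K n hn) j, phi n (z.1 (j + 1)).1 = (z.1 j).1 := fun z j => K_iterate z j 1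
  have h : ConnSeq n fun j => (fun z : K n hn => (z.1 j).1) '' W :=
    { conn := fun j => hc.isPreconnected.image _ (hcont j).continuousOn
      nonempty := fun j => hc.nonempty.image _
      sub := by rintro j _ ⟨z, -, rfl⟩; exact (z.1 j).2
      image := fun j => by
        rw [Set.image_image]
        exact Set.image_congr fun z _ => hphi z j }
  rcases h.dichotomy hn with hall | ⟨J, i, harm, hinj⟩
  · exfalso
    refine hne (Set.eq_univ_of_forall fun z => ?_)
    have := compactSpace_K n hn
    -- A closed subset of the limit that projects onto every factor is the whole limit, by
    -- compactness.
    have hnon : (⋂ j, {w : K n hn | w ∈ W ∧ (w.1 j).1 = (z.1 j).1}).Nonempty := by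
      refine IsCompact.nonempty_iInter_of_sequence_nonempty_isCompact_isClosed _ ?_ ?_ ?_ ?_
      · rintro j w ⟨hw, hj⟩
        exact ⟨hw, by rw [← hphi w j, hj, hphi z j]⟩
      · intro j
        obtain ⟨w, hw, hj⟩ := hall j (z.1 j).2
        exact ⟨w, hw, hj⟩
      · exact hW.inter_right (isClosed_eq (hcont 0) continuous_const)
      · exact fun j => hW.isClosed.inter (isClosed_eq (hcont j) continuous_const)
    obtain ⟨w, hw⟩ := hnon
    rw [Set.mem_iInter] at hw
    have : w = z := Subtype.ext (funext fun j => Subtype.ext (hw j).2)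
    exact this ▸ (hw 0).1
  · have inj : ∀ z ∈ W, ∀ w ∈ W, (z.1 J).1 = (w.1 J).1 → z = w := by
      intro z hz w hw he
      have up : ∀ k, (z.1 (J + k)).1 = (w.1 (J + k)).1 := by
        intro k
        induction k with
        | zero => exact he
        | succ k ih =>
          refine hinj (J + k) (by omega) ⟨z, hz, rfl⟩ ⟨w, hw, rfl⟩ ?_
          exact (hphi z (J + k)).trans (ih.trans (hphi w (J + k)).symm)
      refine Subtype.ext (funext fun j => Subtype.ext ?_)
      have := congrArg (phi n)^[J] (up j)
      rwa [Nat.add_comm J j, K_iterate, K_iterate] at this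
    refine isArc_of_injOn hW hc hnt ((continuous_apply i).comp (hcont J)) fun z hz w hw he => ?_
    refine inj z hz w hw ?_
    have e1 := harm (z.1 J).1 ⟨z, hz, rfl⟩
    have e2 := harm (w.1 J).1 ⟨w, hw, rfl⟩
    rw [e1, e2]
    exact congrArg (armPoint n i) he


theorem isSimpleOd_Od {n : ℕ} (hn : 3 ≤ n) : IsSimpleOd n (Od n) := by
  have hmem : ∀ (i : Fin n) (s : unitInterval), armPoint n i (s * armLen n (i + 1)) ∈ Od n :=
    fun i s => ⟨i, _, mul_nonneg s.2.1 (Nat.cast_nonneg _),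
      mul_le_of_le_one_left (Nat.cast_nonneg _) s.2.2, rfl⟩
  have hpos : ∀ a, 0 < armLen n a := fun a => by unfold armLen; split_ifs <;> omega
  have hzero : (0 : Fin n → ℝ) ∈ Od n :=
    ⟨⟨0, by omega⟩, 0, le_rfl, Nat.cast_nonneg _, by simp [armPoint]⟩
  refine ⟨inferInstance, ⟨0, hzero⟩, fun i s => ⟨_, hmem i s⟩, fun i => ⟨?_, ?_⟩, ?_, ?_⟩
  · refine Topology.IsClosedEmbedding.isEmbedding (Continuous.isClosedEmbedding ?_ ?_)
    · refine Continuous.subtype_mk ?_ _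
      exact (continuous_single i).comp (continuous_subtype_val.mul continuous_const)
    · intro s t hst
      have := Pi.single_injective (M := fun _ : Fin n => ℝ) i (congrArg Subtype.val hst)
      exact Subtype.ext (mul_right_cancel₀ (by exact_mod_cast (hpos _).ne') this)
  · exact Subtype.ext (by simp [armPoint])
  · intro i j hij
    refine Set.Subset.antisymm ?_ ?_
    · rintro x ⟨⟨s, rfl⟩, t, ht⟩
      refine Subtype.ext ?_
      have h1 := congrFun (congrArg Subtype.val ht) i
      simp only [armPoint, Pi.single_eq_same, Pi.single_eq_of_ne hij] at h1
      simp only [← h1, armPoint, Pi.single_zero]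
    · rintro _ rfl
      exact ⟨⟨0, Subtype.ext (by simp [armPoint])⟩, ⟨0, Subtype.ext (by simp [armPoint])⟩⟩
  · refine Set.eq_univ_of_forall ?_
    rintro ⟨x, i, t, h0, h1, rfl⟩
    have hp : (0 : ℝ) < armLen n (i + 1) := by exact_mod_cast hpos _
    refine Set.mem_iUnion.2 ⟨i, ⟨t / armLen n (i + 1), by positivity, (div_le_one hp).2 h1⟩, ?_⟩
    exact Subtype.ext (congrArg (armPoint n i) (div_mul_cancel₀ _ hp.ne'))

theorem isLightSimplicial_phi {n : ℕ} (hn : 3 ≤ n) :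
    IsLightSimplicial (edges₁ n) (edges₀ n) (phi n) := by
  rintro _ ⟨i, k, hk, rfl⟩
  refine ⟨_, ⟨_, _, adj_phiVertex n hn (i + 1) k hk, rfl⟩, fun s h0 h1 => ?_⟩
  refine Eq.trans (congrArg (phi n) ?_) (phi_armPoint_add hn i k h0 h1)
  rw [lineMap_armPoint, AffineMap.lineMap_apply_module]
  congr 1
  simp only [smul_eq_mul]
  ring

theorem starConvex_Od (n : ℕ) : StarConvex ℝ 0 (Od n) := by
  rw [starConvex_zero_iff]
  rintro _ ⟨i, t, h0, h1, rfl⟩ a ha0 ha1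
  exact ⟨i, a * t, mul_nonneg ha0 h0, (mul_le_of_le_one_left h0 ha1).trans h1, by
    rw [armPoint, armPoint, ← Pi.single_smul, smul_eq_mul]⟩

theorem connectedSpace_Od {n : ℕ} (hn : 3 ≤ n) : ConnectedSpace (Od n) :=
  isConnected_iff_connectedSpace.1 ((starConvex_Od n).isPathConnected
    ⟨⟨0, by omega⟩, 0, le_rfl, Nat.cast_nonneg _, by simp [armPoint]⟩).isConnected

/-- The images of a nonempty clopen set and of its nonempty complement are closed and cover each
connected factor, so they meet there. By compactness the meeting pairs can be chosen compatibly,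
which gives a point common to both. -/
theorem connectedSpace_inverseLimit {X : ℕ → Type*} [∀ i, TopologicalSpace (X i)]
    [∀ i, CompactSpace (X i)] [∀ i, T2Space (X i)] [∀ i, ConnectedSpace (X i)]
    {f : ∀ i, X (i + 1) → X i} (hc : ∀ i, Continuous (f i)) (hf : ∀ i, Function.Surjective (f i)) :
    ConnectedSpace (inverseLimit X f) := by
  have : CompactSpace (inverseLimit X f) :=
    isCompact_iff_compactSpace.1 (isClosed_inverseLimit hc).isCompact
  have hp : ∀ i, Continuous fun z : inverseLimit X f => z.1 i := fun i =>
    (continuous_apply i).comp continuous_subtype_val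
  obtain ⟨z₀, hz₀, -⟩ := exists_mem_inverseLimit hf 0 (Classical.arbitrary (X 0))
  have hpre : PreconnectedSpace (inverseLimit X f) := by
    refine preconnectedSpace_iff_clopen.2 fun A hA => ?_
    by_contra! hcon
    obtain ⟨hne, huniv⟩ := hcon
    have hne' : Aᶜ.Nonempty := Set.nonempty_compl.2 huniv
    have hcl : IsClosed Aᶜ := hA.compl.1
    have meet : ∀ i, ∃ z ∈ A, ∃ w ∈ Aᶜ, z.1 i = w.1 i := by
      intro i
      have hcov : ∀ x : X i, x ∈ (fun z : inverseLimit X f => z.1 i) '' A ∪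
          (fun z : inverseLimit X f => z.1 i) '' Aᶜ := by
        intro x
        obtain ⟨z, hz, rfl⟩ := exists_mem_inverseLimit hf i x
        by_cases hzA : (⟨z, hz⟩ : inverseLimit X f) ∈ A
        · exact Or.inl ⟨_, hzA, rfl⟩
        · exact Or.inr ⟨_, hzA, rfl⟩
      obtain ⟨_, -, ⟨z, hz, rfl⟩, ⟨w, hw, he⟩⟩ :=
        isPreconnected_closed_iff.1 (isPreconnected_univ (α := X i)) _ _
          (hA.1.isCompact.image (hp i)).isClosed (hcl.isCompact.image (hp i)).isClosed
          (fun x _ => hcov x) (by simpa using hne) (by simpa using hne')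
      exact ⟨z, hz, w, hw, he.symm⟩
    obtain ⟨p, hp'⟩ : (⋂ i, {p : inverseLimit X f × inverseLimit X f |
        p ∈ A ×ˢ Aᶜ ∧ p.1.1 i = p.2.1 i}).Nonempty := by
      have hclosed : ∀ i, IsClosed {p : inverseLimit X f × inverseLimit X f |
          p ∈ A ×ˢ Aᶜ ∧ p.1.1 i = p.2.1 i} := fun i =>
        (hA.1.prod hcl).inter (isClosed_eq ((hp i).comp continuous_fst) ((hp i).comp continuous_snd))
      refine IsCompact.nonempty_iInter_of_sequence_nonempty_isCompact_isClosed _ ?_ ?_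
        (hclosed 0).isCompact hclosed
      · rintro i p ⟨h1, h2⟩
        refine ⟨h1, ?_⟩
        rw [← p.1.2 i, ← p.2.2 i, h2]
      · intro i
        obtain ⟨z, hz, w, hw, he⟩ := meet i
        exact ⟨(z, w), ⟨hz, hw⟩, he⟩
    rw [Set.mem_iInter] at hp'
    have he : p.1 = p.2 := Subtype.ext (funext fun i => (hp' i).2)
    exact (hp' 0).1.2 (he ▸ (hp' 0).1.1)
  exact { toPreconnectedSpace := hpre, toNonempty := ⟨⟨z₀, hz₀⟩⟩ }

theorem isContinuum_K {n : ℕ} (hn : 3 ≤ n) : IsContinuum (K n hn) :=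
  ⟨compactSpace_K n hn,
    have := connectedSpace_Od hn
    connectedSpace_inverseLimit (fun _ => bonding_continuous hn) fun _ => bonding_surjective hn,
    inferInstance⟩

theorem isSimpleOdLike_K {n : ℕ} (hn : 3 ≤ n) : IsSimpleOdLike n (K n hn) :=
  ⟨fun _ => Od n, fun _ => inferInstance, fun _ => bonding n hn, fun _ => isSimpleOd_Od hn,
    fun _ => ⟨bonding_continuous hn, bonding_surjective hn⟩, ⟨Homeomorph.refl _⟩⟩

end NOd

theorem mainTheorem1 (n : ℕ) (hn : 3 ≤ n) :
    -- the factor space is a simple-`n`-od, and the bonding map is a continuous light simplicial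
    -- surjection from the subdivision `X₁` to `X₀`
    (NOd.IsSimpleOd n (NOd.Od n) ∧
      Continuous (NOd.bonding n hn) ∧ Function.Surjective (NOd.bonding n hn) ∧
      NOd.IsLightSimplicial (NOd.edges₁ n) (NOd.edges₀ n) (NOd.phi n)) ∧
    -- the inverse limit `K` is a simple-`n`-od-like continuum
    NOd.IsContinuum (NOd.K n hn) ∧
    NOd.IsSimpleOdLike n (NOd.K n hn) ∧
    -- which is not simple-`(n-1)`-od-like
    ¬ NOd.IsSimpleOdLike (n - 1) (NOd.K n hn) ∧
    -- and whose proper nondegenerate subcontinua are arcs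
    ∀ W : Set (NOd.K n hn), IsCompact W → IsConnected W → W.Nontrivial → W ≠ Set.univ →
      NOd.IsArc W :=
  ⟨⟨NOd.isSimpleOd_Od hn, NOd.bonding_continuous hn, NOd.bonding_surjective hn,
    NOd.isLightSimplicial_phi hn⟩, NOd.isContinuum_K hn, NOd.isSimpleOdLike_K hn,
    NOd.not_isSimpleOdLike hn, NOd.isArc_of_subcontinuum hn⟩
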